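/- Let $M$ be a closed, connected, oriented smooth 3-manifold and let $p\colon M\to\Sigma$ be a Seifert fibration over a closed surface $\Sigma$ (orientable or not). That is, every fiber of $p$ has a neighbourhood, consisting of fibers, which is identified, preserving orientations and fibers, with a standard fibered solid torus $(D^2\times S^1)/(\mathbb Z/a\mathbb Z)$, where $g=e^{2\pi i/a}$ acts by $(z,t)\mapsto(gz,g^qt)$ with $\gcd(a,q)=1$, the fibers being the images of the circles $\{z\}\times S^1$. On overlaps, these identifications are required to agree on the rotation action of $S^1$ on the fibers up to reversing its direction. (Thus $M$ carries a local $S^1$-action, which comes from a global one when $\Sigma$ is orientable.) Suppose that $p$ has normalized Seifert invariants $\{b;(\alpha_1,\beta_1),\dots,(\alpha_r,\beta_r)\}$, where $b\in\mathbb Z$, $0<\beta_i<\alpha_i$ and $\gcd(\alpha_i,\beta_i)=1$. This means that there are disjoint fibered solid tori $V_0,V_1,\dots,V_r$ over discs $D_0,\dots,D_r\subset\Sigma$, with central fibers of multiplicities $\alpha_0=1,\alpha_1,\dots,\alpha_r$, and a section of $p$ off these $r+1$ central fibers whose restrictions $q_j$ to $\partial D_j$ satisfy $m_j=\alpha_jq_j+\beta_jh$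 in $H_1(\partial V_j)$, where $\beta_0=b$, $m_j$ is the meridian of $V_j$, $h$ is a regular fiber, $q_j$ and $m_j$ run in the direction of $\partial D_j$, and the orientations of $D_j$ and $h$ together give the orientation of $M$. Put $$e(M)=-b-\sum_{i=1}^r\frac{\beta_i}{\alpha_i}.$$ Then $M$ carries a positive contact structure (a smooth plane field, locally the kernel of a $1$-form $\alpha$ with $\alpha\wedge d\alpha>0$) which is invariant under the local $S^1$-action and transverse to the fibers of $p$ if and only if $e(M)<0$. -/

import Mathlib

open scoped Manifold ContDiff

/-- Euclidean `3`-space, the model space of the `3`-manifolds below. -/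
abbrev E3 : Type := EuclideanSpace ℝ (Fin 3)

/-! ### Oriented 3-manifolds and positive contact structures -/

/-- The atlas of `M` is an oriented atlas: all coordinate changes have positive Jacobian
determinant.  An oriented `3`-manifold is a `3`-manifold with such an atlas. -/
def IsOrientedAtlas (M : Type*) [TopologicalSpace M] [ChartedSpace E3 M] : Prop :=
  ∀ e ∈ atlas E3 M, ∀ e' ∈ atlas E3 M, ∀ y ∈ (e.symm.trans e').source,
    0 < (fderiv ℝ (e' ∘ e.symm) y).det

/-- The exterior derivative `dα_y(u, v)` of a `1`-form `α` on (an open part of) `E3`. -/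
noncomputable def dOneForm (α : E3 → E3 →L[ℝ] ℝ) (y u v : E3) : ℝ :=
  fderiv ℝ α y u v - fderiv ℝ α y v u

/-- The value of the `3`-form `α ∧ dα` at `y` on the standard positively oriented basis. -/
noncomputable def contactVolume (α : E3 → E3 →L[ℝ] ℝ) (y : E3) : ℝ :=
  let e : Fin 3 → E3 := fun i => EuclideanSpace.single i 1
  α y (e 0) * dOneForm α y (e 1) (e 2) - α y (e 1) * dOneForm α y (e 0) (e 2)
    + α y (e 2) * dOneForm α y (e 0) (e 1)

/-- A field of subspaces of the tangent spaces of `M`. -/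
abbrev TangentField (M : Type*) [TopologicalSpace M] [ChartedSpace E3 M] : Type _ :=
  ∀ x : M, Submodule ℝ (TangentSpace (𝓡 3) x)

/-- `ξ` is a positive contact structure on `M` (oriented by its atlas): near every point, in the
chart at that point, `ξ` is the kernel of a smooth `1`-form `α` with `α ∧ dα > 0`.
(So `ξ` is a smooth field of planes; it need not be coorientable, and the sign of `α ∧ dα` does
not depend on the choice of `α`.) -/
def IsPositiveContactStructure {M : Type*} [TopologicalSpace M] [ChartedSpace E3 M]
    (ξ : TangentField M) : Prop :=
  ∀ x : M, ∃ (V : Set E3) (α : E3 → E3 →L[ℝ] ℝ),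
    IsOpen V ∧ chartAt E3 x x ∈ V ∧ V ⊆ (chartAt E3 x).target ∧ ContDiffOn ℝ ∞ α V ∧
    ∀ y ∈ V, 0 < contactVolume α y ∧
      ∀ v : E3, mfderiv 𝓘(ℝ, E3) (𝓡 3) (chartAt E3 x).symm y v ∈ ξ ((chartAt E3 x).symm y) ↔
        α y v = 0

/-! ### Seifert fibrations -/

/-- `D² × ℝ`, the universal cover of the open solid torus `D² × S¹`; the second coordinate is the
angle on `S¹`. -/
def solidTorusCover : Set (ℂ × ℝ) := Metric.ball (0 : ℂ) 1 ×ˢ Set.univ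

/-- The positively oriented frame `∂x, ∂y, ∂θ` of `D² × ℝ`. -/
noncomputable def modelFrame : Fin 3 → ℂ × ℝ := ![(1, 0), (Complex.I, 0), (0, 1)]

/-- The generator `e^{2πi/a}` of `ℤ/aℤ`, raised to the power `k`. -/
noncomputable def rootOfUnityPow (a : ℕ) (k : ℤ) : ℂ :=
  Complex.exp (2 * Real.pi * Complex.I * k / a)

/-- An oriented fibered chart of `p : M → B`: an identification of an open union of fibers with
the standard fibered solid torus `(D² × S¹) / (ℤ/aℤ)`, where the generator `g = e^{2πi/a}` acts by
`(z, t) ↦ (g z, g^q t)` with `q` coprime to `a`, and the fibers are the images of `{z} × S¹`.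
It is recorded as the composite `map` of the coverings
`D² × ℝ → D² × S¹ → (D² × S¹) / (ℤ/aℤ)` with this identification. -/
structure FiberedChart {M B : Type*} [TopologicalSpace M] [ChartedSpace E3 M] (p : M → B) where
  /-- the multiplicity `a` of the central fiber -/
  mult : ℕ
  /-- the exponent `q` -/
  twist : ℤ
  mult_pos : 0 < mult
  coprime : IsCoprime (mult : ℤ) twist
  map : ℂ × ℝ → M
  localDiffeo : IsLocalDiffeomorphOn 𝓘(ℝ, ℂ × ℝ) (𝓡 3) ∞ map solidTorusCover
  /-- `map` preserves the orientation -/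
  orientation : ∀ w ∈ solidTorusCover,
    0 < (Matrix.of fun i j : Fin 3 =>
      (fderiv ℝ (chartAt E3 (map w) ∘ map) w (modelFrame j)) i).det
  /-- two points have the same image iff they agree in `(D² × S¹) / (ℤ/aℤ)` -/
  map_eq_iff : ∀ w ∈ solidTorusCover, ∀ w' ∈ solidTorusCover,
    (map w = map w' ↔ ∃ k n : ℤ, w'.1 = rootOfUnityPow mult k * w.1 ∧
      w'.2 = w.2 + 2 * Real.pi * k * twist / mult + 2 * Real.pi * n)
  /-- two points lie over the same point of the base iff their `D²`-coordinates agree in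
  `D² / (ℤ/aℤ)` -/
  proj_eq_iff : ∀ w ∈ solidTorusCover, ∀ w' ∈ solidTorusCover,
    (p (map w) = p (map w') ↔ ∃ k : ℤ, w'.1 = rootOfUnityPow mult k * w.1)
  /-- the image is a union of fibers of `p` -/
  saturated : ∀ w ∈ solidTorusCover, ∀ x : M, p x = p (map w) → x ∈ map '' solidTorusCover

/-- Two fibered charts are compatible if they induce the same circle action (rotation of the
second coordinate) on the fibers they have in common, up to reversing the direction. -/
def FiberedChart.Compatible {M B : Type*} [TopologicalSpace M] [ChartedSpace E3 M] {p : M → B}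
    (Φ Ψ : FiberedChart p) : Prop :=
  ∀ w ∈ solidTorusCover, ∀ w' ∈ solidTorusCover, Φ.map w = Ψ.map w' →
    (∀ s : ℝ, Φ.map (w.1, w.2 + s) = Ψ.map (w'.1, w'.2 + s)) ∨
    (∀ s : ℝ, Φ.map (w.1, w.2 + s) = Ψ.map (w'.1, w'.2 - s))

/-- A Seifert fibration `M → B` of an oriented `3`-manifold over a (topological) surface `B`: `M`
is covered by compatible oriented fibered charts.  Thus `M` carries a local circle action whose
orbits are the fibers; it comes from a global circle action exactly when the fibers can be
coherently oriented, that is, when `B` is orientable. -/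
structure SeifertFibration (M B : Type*) [TopologicalSpace M] [ChartedSpace E3 M]
    [TopologicalSpace B] where
  proj : M → B
  continuous_proj : Continuous proj
  surjective_proj : Function.Surjective proj
  charts : Set (FiberedChart proj)
  cover : ∀ x : M, ∃ Φ ∈ charts, x ∈ Φ.map '' solidTorusCover
  compatible : ∀ Φ ∈ charts, ∀ Ψ ∈ charts, Φ.Compatible Ψ

/-- Normalized Seifert invariants `{b; (α₁, β₁), …, (α_r, β_r)}`.  (The genus of the base is not
recorded here; it is determined by the base.) -/
structure NormalizedSeifertInvariants where
  b : ℤ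
  r : ℕ
  α : Fin r → ℕ
  β : Fin r → ℤ
  β_pos : ∀ i, 0 < β i
  β_lt : ∀ i, β i < α i
  coprime : ∀ i, IsCoprime (α i : ℤ) (β i)

namespace NormalizedSeifertInvariants

/-- The rational Euler number `e = -b - ∑ βᵢ/αᵢ`. -/
def eulerNumber (I : NormalizedSeifertInvariants) : ℚ :=
  -(I.b : ℚ) - ∑ i, (I.β i : ℚ) / (I.α i : ℚ)

/-- The multiplicities `1, α₁, …, α_r`. -/
def order (I : NormalizedSeifertInvariants) : Option (Fin I.r) → ℕ
  | none => 1
  | some i => I.α i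

/-- The numbers `b, β₁, …, β_r`. -/
def slope (I : NormalizedSeifertInvariants) : Option (Fin I.r) → ℤ
  | none => I.b
  | some i => I.β i

end NormalizedSeifertInvariants

namespace SeifertFibration

variable {M B : Type*} [TopologicalSpace M] [ChartedSpace E3 M] [TopologicalSpace B]

/-- `M` has the normalized Seifert invariants `{b; (α₁, β₁), …, (α_r, β_r)}`.
There are disjoint fibered solid tori `V₀, V₁, …, V_r`, with central fibers of multiplicity
`α₀ = 1, α₁, …, α_r`, and a smooth section `σ` of the fibration off the `r + 1` central fibers
(so that all other fibers are regular) such that on `∂Vⱼ` the curve `qⱼ = σ(∂Dⱼ)`, oriented as the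
boundary of `Dⱼ`, the regular fiber `h` and the meridian `mⱼ` satisfy `mⱼ = αⱼ qⱼ + βⱼ h`
(with `β₀ = b`).  The last relation is expressed in the covering `D² × ℝ`: over the circle of
radius `ρ`, the section is the curve `φ ↦ (ρ e^{iφ}, f φ)`; for `φ` from `0` to `2π` this runs
`αⱼ` times along `qⱼ`, and is homologous to the meridian minus `βⱼ` fibers. -/
def HasNormalizedInvariants (S : SeifertFibration M B) (I : NormalizedSeifertInvariants) : Prop :=
  ∃ (Φ : Option (Fin I.r) → FiberedChart S.proj) (σ : B → M),
    (∀ j, ∀ Ψ ∈ S.charts, (Φ j).Compatible Ψ) ∧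
    (∀ j, (Φ j).mult = I.order j) ∧
    (∀ j j', j ≠ j' → Disjoint ((Φ j).map '' solidTorusCover) ((Φ j').map '' solidTorusCover)) ∧
    (∀ c : B, (∀ j, c ≠ S.proj ((Φ j).map (0, 0))) → S.proj (σ c) = c) ∧
    (∀ Ψ ∈ S.charts, ContMDiffOn 𝓘(ℝ, ℂ) (𝓡 3) ∞ (fun z : ℂ => σ (S.proj (Ψ.map (z, 0))))
      {z | z ∈ Metric.ball (0 : ℂ) 1 ∧
        ∀ j, S.proj (Ψ.map (z, 0)) ≠ S.proj ((Φ j).map (0, 0))}) ∧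
    (∀ j, ∀ ρ ∈ Set.Ioo (0 : ℝ) 1, ∃ f : ℝ → ℝ, Continuous f ∧
      (∀ φ : ℝ, σ (S.proj ((Φ j).map (ρ * Complex.exp (φ * Complex.I), 0))) =
        (Φ j).map (ρ * Complex.exp (φ * Complex.I), f φ)) ∧
      ∀ φ : ℝ, f (φ + 2 * Real.pi) = f φ - 2 * Real.pi * I.slope j)

/-- The pull-back `Φ^*ξ` of `ξ` to `D² × ℝ`, at the point `w`. -/
noncomputable def pullback {p : M → B} (Φ : FiberedChart p) (ξ : TangentField M) (w : ℂ × ℝ) :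
    Set (ℂ × ℝ) :=
  {v | mfderiv 𝓘(ℝ, ℂ × ℝ) (𝓡 3) Φ.map w v ∈ ξ (Φ.map w)}

/-- `ξ` is transverse to the fibers: it does not contain the direction `∂θ` of the fibers. -/
def IsTransverse (S : SeifertFibration M B) (ξ : TangentField M) : Prop :=
  ∀ Φ ∈ S.charts, ∀ w ∈ solidTorusCover, ((0 : ℂ), (1 : ℝ)) ∉ pullback Φ ξ w

/-- `ξ` is `S¹`-invariant: it is invariant under the (local) circle action, which in every
fibered chart is the rotation `(z, θ) ↦ (z, θ + s)`. -/
def IsCircleInvariant (S : SeifertFibration M B) (ξ : TangentField M) : Prop :=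
  ∀ Φ ∈ S.charts, ∀ w ∈ solidTorusCover, ∀ s : ℝ,
    pullback Φ ξ (w.1, w.2 + s) = pullback Φ ξ w

end SeifertFibration

/-!
Throughout, the base is treated as an orbifold: its charts are the fibered charts of the maximal
atlas of `S` (the type `S.Chart`), and a geometric object on the base is a family of local
expressions, one on the unit disc of each fibered chart, which correspond to each other under the
transitions (`SeifertFibration.IsSection`). A transition lifts to
`(z, θ) ↦ (τ z, ε θ + h z)` with `ε = ±1`; the sign is the reason why everything below is
written for densities and for forms twisted by `ε`, and why a nonorientable base needs no separate
treatment.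

*From contact structures to curvature.* A plane field which is invariant under the local circle
action and transverse to the fibers is, in each fibered chart, the kernel of a unique form
`dθ + λ` with `λ` a form on the disc. The `λ` fit together to a connection, that is, a section for
`formAction 1`, and `(dθ + λ) ∧ d(dθ + λ) = dθ ∧ dλ`, so that the contact condition says that the
curvature density `curl λ` is positive. Hence the contact structures in question correspond to the
connections of positive curvature (`SeifertFibration.exists_connection_of_contact`,
`SeifertFibration.exists_contact_of_connection`).

*Which curvatures occur.* The curvatures of two connections differ by an exact density. A density
on the compact base defines a measure on `M` which is fiberwise invariant, and Stokes' theorem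
says that exact densities have zero integral (`SeifertFibration.IsFiberMeasure.integral_eq_zero`).
Conversely, as the base is connected, a density with zero integral is exact: a partition of unity
and the compactly supported Poincaré lemma on the disc move all of it into a single chart
(`SeifertFibration.IsFiberMeasure.isExact`). So there is a connection of positive curvature if and
only if the total curvature, which is the same for all connections, is positive: the curvature can
then be made a constant multiple of any chosen positive density
(`SeifertFibration.IsFiberMeasure.exists_curl_pos_iff`).

*The total curvature.* Off the distinguished fibers the section `σ` is the graph of a function `f`
in each chart, and `dθ - df` is a flat connection. Cutting it off near the distinguished fibers
gives a connection on all of `M` whose curvature is supported in the solid tori `V_j`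
(`SeifertFibration.exists_connection_of_section`). In polar coordinates the contribution of `V_j`
is seen to be determined by the period of `df` around `∂D_j`, that is, by the Seifert invariants:
it is `4 π² β_j / α_j`, and the sum over `j` is `-4 π² e(M)`
(`SeifertFibration.IsFiberMeasure.integral_curvature`).
-/

open Set Filter Topology MeasureTheory

/-! ### Linear algebra of the model -/

/-- The frame `∂x, ∂y, ∂θ` as a basis of `ℂ × ℝ`. -/
noncomputable def modelBasis : Module.Basis (Fin 3) ℝ (ℂ × ℝ) :=
  Module.Basis.ofEquivFun
    { toFun := fun v => ![v.1.re, v.1.im, v.2]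
      invFun := fun f => (⟨f 0, f 1⟩, f 2)
      map_add' := by intro v w; ext i; fin_cases i <;> simp
      map_smul' := by intro c v; ext i; fin_cases i <;> simp
      left_inv := by intro v; simp
      right_inv := by intro f; ext i; fin_cases i <;> simp }

lemma modelBasis_apply (j : Fin 3) : modelBasis j = modelFrame j := by
  rw [modelBasis, Module.Basis.coe_ofEquivFun]
  fin_cases j <;> simp [modelFrame, Complex.ext_iff]

lemma modelBasis_repr (v : ℂ × ℝ) (i : Fin 3) :
    modelBasis.repr v i = (![v.1.re, v.1.im, v.2] : Fin 3 → ℝ) i := by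
  simp [modelBasis]

/-- The determinant of a linear map `ℂ × ℝ → E3` in the frame `∂x, ∂y, ∂θ` and the standard
basis. -/
noncomputable def frameDet (L : ℂ × ℝ →L[ℝ] E3) : ℝ :=
  (Matrix.of fun i j : Fin 3 => (L (modelFrame j)) i).det

lemma frameDet_eq (L : ℂ × ℝ →L[ℝ] E3) :
    frameDet L = (LinearMap.toMatrix modelBasis (EuclideanSpace.basisFun (Fin 3) ℝ).toBasis
      (L : ℂ × ℝ →ₗ[ℝ] E3)).det := by
  unfold frameDet
  congr 1
  ext i j
  simp [LinearMap.toMatrix_apply, modelBasis_apply]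

lemma frameDet_comp (L : ℂ × ℝ →L[ℝ] E3) (T : ℂ × ℝ →L[ℝ] ℂ × ℝ) :
    frameDet (L.comp T) = frameDet L * T.det := by
  rw [frameDet_eq, frameDet_eq, ContinuousLinearMap.det, ← LinearMap.det_toMatrix modelBasis,
    ← Matrix.det_mul, ← LinearMap.toMatrix_comp]
  rfl

lemma frameDet_comp_left (A : E3 →L[ℝ] E3) (L : ℂ × ℝ →L[ℝ] E3) :
    frameDet (A.comp L) = A.det * frameDet L := by
  rw [frameDet_eq, frameDet_eq, ContinuousLinearMap.det,
    ← LinearMap.det_toMatrix (EuclideanSpace.basisFun (Fin 3) ℝ).toBasis,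
    ← Matrix.det_mul, ← LinearMap.toMatrix_comp]
  rfl

lemma complex_det_eq (A : ℂ →L[ℝ] ℂ) :
    A.det = (A 1).re * (A Complex.I).im - (A Complex.I).re * (A 1).im := by
  rw [ContinuousLinearMap.det, ← LinearMap.det_toMatrix Complex.basisOneI, Matrix.det_fin_two]
  simp [LinearMap.toMatrix_apply]

/-- The linear map `(v, s) ↦ (A v, ε s + ℓ v)`: the shape of the derivative of a change of fibered
charts. -/
noncomputable def fiberedLinear (A : ℂ →L[ℝ] ℂ) (ε : ℝ) (l : ℂ →L[ℝ] ℝ) : ℂ × ℝ →L[ℝ] ℂ × ℝ :=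
  (A.comp (ContinuousLinearMap.fst ℝ ℂ ℝ)).prod
    (ε • ContinuousLinearMap.snd ℝ ℂ ℝ + l.comp (ContinuousLinearMap.fst ℝ ℂ ℝ))

lemma fiberedLinear_apply (A : ℂ →L[ℝ] ℂ) (ε : ℝ) (l : ℂ →L[ℝ] ℝ) (v : ℂ × ℝ) :
    fiberedLinear A ε l v = (A v.1, ε * v.2 + l v.1) := by
  simp [fiberedLinear]

lemma fiberedLinear_det (A : ℂ →L[ℝ] ℂ) (ε : ℝ) (l : ℂ →L[ℝ] ℝ) :
    (fiberedLinear A ε l).det = ε * A.det := by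
  rw [complex_det_eq, ContinuousLinearMap.det, ← LinearMap.det_toMatrix modelBasis,
    Matrix.det_fin_three]
  simp [LinearMap.toMatrix_apply, modelBasis_apply, modelBasis_repr, fiberedLinear, modelFrame]
  ring

/-! ### Fibered charts and their transitions -/

lemma isOpen_solidTorusCover : IsOpen solidTorusCover :=
  Metric.isOpen_ball.prod isOpen_univ

lemma mem_solidTorusCover {w : ℂ × ℝ} : w ∈ solidTorusCover ↔ w.1 ∈ Metric.ball (0 : ℂ) 1 := by
  simp [solidTorusCover]

lemma mk_mem_solidTorusCover {z : ℂ} {s : ℝ} (hz : z ∈ Metric.ball (0 : ℂ) 1) :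
    (z, s) ∈ solidTorusCover := mem_solidTorusCover.2 hz

namespace FiberedChart

variable {M B : Type*} [TopologicalSpace M] [ChartedSpace E3 M] {p : M → B}

/-- The orbifold chart `D² → D² / (ℤ/aℤ) ⊆ B` of the base which underlies a fibered chart. -/
def base (Φ : FiberedChart p) (z : ℂ) : B := p (Φ.map (z, 0))

lemma proj_map (Φ : FiberedChart p) {w : ℂ × ℝ} (hw : w ∈ solidTorusCover) :
    p (Φ.map w) = Φ.base w.1 := by
  have h0 : ((w.1, 0) : ℂ × ℝ) ∈ solidTorusCover := mem_solidTorusCover.2 (mem_solidTorusCover.1 hw)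
  exact (Φ.proj_eq_iff w hw _ h0).2 ⟨0, by simp [rootOfUnityPow]⟩

lemma base_eq_iff (Φ : FiberedChart p) {z z' : ℂ} (hz : z ∈ Metric.ball (0 : ℂ) 1)
    (hz' : z' ∈ Metric.ball (0 : ℂ) 1) :
    Φ.base z = Φ.base z' ↔ ∃ k : ℤ, z' = rootOfUnityPow Φ.mult k * z :=
  Φ.proj_eq_iff _ (mk_mem_solidTorusCover hz) _ (mk_mem_solidTorusCover hz')

/-- Every point of the fiber over `Φ.base z` is of the form `Φ.map (z, θ)`. -/
lemma exists_map_eq (Φ : FiberedChart p) {z : ℂ} (hz : z ∈ Metric.ball (0 : ℂ) 1) {x : M}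
    (hx : p x = Φ.base z) : ∃ θ : ℝ, Φ.map (z, θ) = x := by
  obtain ⟨w, hw, rfl⟩ := Φ.saturated (z, 0) (mk_mem_solidTorusCover hz) x hx
  rw [Φ.proj_map hw, eq_comm, Φ.base_eq_iff hz (mem_solidTorusCover.1 hw)] at hx
  obtain ⟨k, hk⟩ := hx
  refine ⟨w.2 - 2 * Real.pi * k * Φ.twist / Φ.mult, ?_⟩
  rw [Φ.map_eq_iff _ (mk_mem_solidTorusCover hz) _ hw]
  exact ⟨k, 0, hk, by push_cast; ring⟩

lemma rootOfUnityPow_norm (a : ℕ) (k : ℤ) : ‖rootOfUnityPow a k‖ = 1 := by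
  have : rootOfUnityPow a k = Complex.exp (((2 * Real.pi * k / a : ℝ) : ℂ) * Complex.I) := by
    unfold rootOfUnityPow; congr 1; push_cast; ring
  rw [this, Complex.norm_exp_ofReal_mul_I]

lemma frameDet_pos (Φ : FiberedChart p) {w : ℂ × ℝ} (hw : w ∈ solidTorusCover) :
    0 < frameDet (fderiv ℝ (chartAt E3 (Φ.map w) ∘ Φ.map) w) := Φ.orientation w hw

/-- `Φ.map (z, s) = Ψ.map (τ z, ε s + h z)` for `z` in the open set `W`, with `ε = ± 1`: a local
change of fibered charts.  The base map `τ` preserves the orientation precisely when the direction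
of the fibers is preserved. -/
structure IsTransition (Φ Ψ : FiberedChart p) (W : Set ℂ) (τ : ℂ → ℂ) (h : ℂ → ℝ) (ε : ℝ) :
    Prop where
  isOpen : IsOpen W
  subset : W ⊆ Metric.ball (0 : ℂ) 1
  mapsTo : MapsTo τ W (Metric.ball (0 : ℂ) 1)
  contDiffOn_base : ContDiffOn ℝ ∞ τ W
  contDiffOn_shift : ContDiffOn ℝ ∞ h W
  sign : ε = 1 ∨ ε = -1
  map_eq : ∀ z ∈ W, ∀ s : ℝ, Φ.map (z, s) = Ψ.map (τ z, ε * s + h z)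
  det_pos : ∀ z ∈ W, 0 < ε * (fderiv ℝ τ z).det

/-- A local inverse of a fibered chart. -/
lemma exists_local_inverse (Φ : FiberedChart p) {w : ℂ × ℝ} (hw : w ∈ solidTorusCover) :
    ∃ (O : Set M) (G : M → ℂ × ℝ), IsOpen O ∧ Φ.map w ∈ O ∧
      ContMDiffOn (𝓡 3) 𝓘(ℝ, ℂ × ℝ) ∞ G O ∧ (∀ y ∈ O, Φ.map (G y) = y) ∧
      (∀ y ∈ O, G y ∈ solidTorusCover) ∧
      (∀ᶠ v in 𝓝 w, G (Φ.map v) = v) ∧ G (Φ.map w) = w := by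
  have H : IsLocalDiffeomorphAt 𝓘(ℝ, ℂ × ℝ) (𝓡 3) ∞ Φ.map w := Φ.localDiffeo ⟨w, hw⟩
  have hG : ContMDiffOn (𝓡 3) 𝓘(ℝ, ℂ × ℝ) ∞ H.localInverse H.localInverse.source :=
    H.contmdiffOn_localInverse
  have hev : ∀ᶠ v in 𝓝 w, H.localInverse (Φ.map v) = v := H.localInverse_eventuallyEq_left
  refine ⟨H.localInverse.source ∩ H.localInverse ⁻¹' solidTorusCover, H.localInverse, ?_, ?_,
    hG.mono inter_subset_left, ?_, fun y hy => hy.2, hev, hev.self_of_nhds⟩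
  · exact hG.continuousOn.isOpen_inter_preimage H.localInverse_open_source isOpen_solidTorusCover
  · refine ⟨H.localInverse_mem_source, ?_⟩
    rw [mem_preimage, hev.self_of_nhds]
    exact hw
  · intro y hy
    exact H.localInverse_right_inv hy.1

lemma continuousOn_map (Φ : FiberedChart p) : ContinuousOn Φ.map solidTorusCover :=
  fun w hw => ((Φ.localDiffeo ⟨w, hw⟩).contMDiffAt.continuousAt).continuousWithinAt

lemma continuousAt_map (Φ : FiberedChart p) {w : ℂ × ℝ} (hw : w ∈ solidTorusCover) :
    ContinuousAt Φ.map w := (Φ.localDiffeo ⟨w, hw⟩).contMDiffAt.continuousAt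

variable [IsManifold (𝓡 3) ∞ M]

lemma contDiffAt_chart_comp (Φ : FiberedChart p) {w : ℂ × ℝ} (hw : w ∈ solidTorusCover) {x : M}
    (hx : Φ.map w ∈ (chartAt E3 x).source) :
    ContDiffAt ℝ ∞ (chartAt E3 x ∘ Φ.map) w := by
  have h1 : ContMDiffAt 𝓘(ℝ, ℂ × ℝ) (𝓡 3) ∞ Φ.map w := (Φ.localDiffeo ⟨w, hw⟩).contMDiffAt
  have h2 : ContMDiffAt (𝓡 3) (𝓡 3) ∞ (chartAt E3 x) (Φ.map w) :=
    contMDiffAt_of_mem_maximalAtlas (IsManifold.chart_mem_maximalAtlas x) hx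
  exact contMDiffAt_iff_contDiffAt.1 (h2.comp w h1)

/-- Compatible fibered charts are related by a transition near every common point. -/
lemma Compatible.exists_isTransition {Φ Ψ : FiberedChart p} (hc : Φ.Compatible Ψ) {w w' : ℂ × ℝ}
    (hw : w ∈ solidTorusCover) (hw' : w' ∈ solidTorusCover) (heq : Φ.map w = Ψ.map w') :
    ∃ (W : Set ℂ) (τ : ℂ → ℂ) (h : ℂ → ℝ) (ε : ℝ), IsTransition Φ Ψ W τ h ε ∧ w.1 ∈ W ∧
      τ w.1 = w'.1 ∧ ε * w.2 + h w.1 = w'.2 := by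
  obtain ⟨O, G, hO, hwO, hG, hΨG, hGmem, hGev, hGw⟩ := Ψ.exists_local_inverse hw'
  rw [← heq] at hwO hGw
  obtain ⟨z0, θ0⟩ := w
  -- the coordinate change in dimension three
  set F : ℂ × ℝ → ℂ × ℝ := fun v => G (Φ.map v) with hF
  have hFsm : ∀ v ∈ solidTorusCover, Φ.map v ∈ O → ContDiffAt ℝ ∞ F v := by
    intro v hv hvO
    have h1 : ContMDiffAt 𝓘(ℝ, ℂ × ℝ) (𝓡 3) ∞ Φ.map v := (Φ.localDiffeo ⟨v, hv⟩).contMDiffAt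
    have h2 := (hG.contMDiffAt (hO.mem_nhds hvO)).comp v h1
    exact contMDiffAt_iff_contDiffAt.1 h2
  have hz0 : z0 ∈ Metric.ball (0 : ℂ) 1 := mem_solidTorusCover.1 hw
  set τ : ℂ → ℂ := fun z => (F (z, θ0)).1 with hτ
  set h0 : ℂ → ℝ := fun z => (F (z, θ0)).2 with hh0
  have hι : Continuous fun z : ℂ => ((z, θ0) : ℂ × ℝ) := by fun_prop
  have hFz0 : F (z0, θ0) = w' := hGw
  have evD : ∀ᶠ z in 𝓝 z0, z ∈ Metric.ball (0 : ℂ) 1 := Metric.isOpen_ball.mem_nhds hz0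
  have evO : ∀ᶠ z in 𝓝 z0, Φ.map (z, θ0) ∈ O := by
    have : ContinuousAt (fun z : ℂ => Φ.map (z, θ0)) z0 :=
      ContinuousAt.comp (f := fun z : ℂ => ((z, θ0) : ℂ × ℝ)) (Φ.continuousAt_map hw)
        hι.continuousAt
    exact this (hO.mem_nhds hwO)
  have hFc : ContinuousAt F (z0, θ0) := (hFsm _ hw hwO).continuousAt
  -- for each `z` the direction of the circle action is either kept or reversed
  have hdich : ∀ z, z ∈ Metric.ball (0 : ℂ) 1 → Φ.map (z, θ0) ∈ O →
      (∀ s : ℝ, Φ.map (z, θ0 + s) = Ψ.map (τ z, h0 z + s)) ∨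
      (∀ s : ℝ, Φ.map (z, θ0 + s) = Ψ.map (τ z, h0 z - s)) := by
    intro z hz hzO
    exact hc (z, θ0) (mk_mem_solidTorusCover hz) (F (z, θ0)) (hGmem _ hzO) (hΨG _ hzO).symm
  -- the alternative is the same for all nearby `z`: it is read off from the sign of the continuous
  -- function `k z`, which takes only the values `± s0`
  obtain ⟨ε, hε, hsign⟩ : ∃ ε : ℝ, (ε = 1 ∨ ε = -1) ∧
      ∀ᶠ z in 𝓝 z0, ∀ s : ℝ, Φ.map (z, θ0 + s) = Ψ.map (τ z, h0 z + ε * s) := by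
    obtain ⟨s0, hs0, hA, hP, hN⟩ : ∃ s0 : ℝ, 0 < s0 ∧ Φ.map (z0, θ0 + s0) ∈ O ∧
        (∀ᶠ v in 𝓝 (w'.1, w'.2 + s0), G (Ψ.map v) = v) ∧
        (∀ᶠ v in 𝓝 (w'.1, w'.2 - s0), G (Ψ.map v) = v) := by
      have e1 : ∀ᶠ s in 𝓝 (0 : ℝ), Φ.map (z0, θ0 + s) ∈ O := by
        have hc1 : ContinuousAt (fun s : ℝ => Φ.map (z0, θ0 + s)) 0 := by
          refine ContinuousAt.comp (f := fun s : ℝ => ((z0, θ0 + s) : ℂ × ℝ)) (g := Φ.map) ?_ ?_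
          · exact Φ.continuousAt_map (mk_mem_solidTorusCover hz0)
          · fun_prop
        exact hc1 (hO.mem_nhds (by simpa using hwO))
      have e2 : ∀ᶠ s in 𝓝 (0 : ℝ), ∀ᶠ v in 𝓝 (w'.1, w'.2 + s), G (Ψ.map v) = v := by
        have hc1 : Tendsto (fun s : ℝ => ((w'.1, w'.2 + s) : ℂ × ℝ)) (𝓝 0) (𝓝 w') := by
          have : Continuous (fun s : ℝ => ((w'.1, w'.2 + s) : ℂ × ℝ)) := by fun_prop
          simpa using this.tendsto 0
        exact hc1.eventually hGev.eventually_nhds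
      have e3 : ∀ᶠ s in 𝓝 (0 : ℝ), ∀ᶠ v in 𝓝 (w'.1, w'.2 - s), G (Ψ.map v) = v := by
        have hc1 : Tendsto (fun s : ℝ => ((w'.1, w'.2 - s) : ℂ × ℝ)) (𝓝 0) (𝓝 w') := by
          have : Continuous (fun s : ℝ => ((w'.1, w'.2 - s) : ℂ × ℝ)) := by fun_prop
          simpa using this.tendsto 0
        exact hc1.eventually hGev.eventually_nhds
      have e4 := ((e1.and (e2.and e3)).filter_mono (nhdsWithin_le_nhds (s := Ioi 0))).and
        self_mem_nhdsWithin
      obtain ⟨s0, ⟨h1, h2, h3⟩, h4⟩ := e4.exists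
      exact ⟨s0, h4, h1, h2, h3⟩
    have hτc : ContinuousAt τ z0 := by
      have := ContinuousAt.comp (f := fun z : ℂ => ((z, θ0) : ℂ × ℝ)) (x := z0) hFc hι.continuousAt
      exact continuous_fst.continuousAt.comp this
    have hh0c : ContinuousAt h0 z0 := by
      have := ContinuousAt.comp (f := fun z : ℂ => ((z, θ0) : ℂ × ℝ)) (x := z0) hFc hι.continuousAt
      exact continuous_snd.continuousAt.comp this
    have hτ0 : τ z0 = w'.1 := by simp [hτ, hFz0]
    have hh00 : h0 z0 = w'.2 := by simp [hh0, hFz0]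
    have tP : Tendsto (fun z => ((τ z, h0 z + s0) : ℂ × ℝ)) (𝓝 z0) (𝓝 (w'.1, w'.2 + s0)) := by
      have : ContinuousAt (fun z => ((τ z, h0 z + s0) : ℂ × ℝ)) z0 := by fun_prop
      simpa [ContinuousAt, hτ0, hh00] using this
    have tN : Tendsto (fun z => ((τ z, h0 z - s0) : ℂ × ℝ)) (𝓝 z0) (𝓝 (w'.1, w'.2 - s0)) := by
      have : ContinuousAt (fun z => ((τ z, h0 z - s0) : ℂ × ℝ)) z0 := by fun_prop
      simpa [ContinuousAt, hτ0, hh00] using this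
    set k : ℂ → ℝ := fun z => (F (z, θ0 + s0)).2 - h0 z with hk
    have hkc : ContinuousAt k z0 := by
      have h1 := (hFsm (z0, θ0 + s0) (mk_mem_solidTorusCover hz0) hA).continuousAt
      have h2 : ContinuousAt (fun z : ℂ => F (z, θ0 + s0)) z0 :=
        ContinuousAt.comp (f := fun z : ℂ => ((z, θ0 + s0) : ℂ × ℝ)) h1 (by fun_prop)
      exact (continuous_snd.continuousAt.comp h2).sub hh0c
    have hkP : ∀ᶠ z in 𝓝 z0, (∀ s : ℝ, Φ.map (z, θ0 + s) = Ψ.map (τ z, h0 z + s)) → k z = s0 := by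
      filter_upwards [tP.eventually hP] with z hz hzs
      simp only [hk, hF, hzs s0, hz]
      ring
    have hkN : ∀ᶠ z in 𝓝 z0, (∀ s : ℝ, Φ.map (z, θ0 + s) = Ψ.map (τ z, h0 z - s)) →
        k z = -s0 := by
      filter_upwards [tN.eventually hN] with z hz hzs
      simp only [hk, hF, hzs s0, hz]
      ring
    rcases hdich z0 hz0 hwO with hd | hd
    · refine ⟨1, Or.inl rfl, ?_⟩
      have hk0 := hkP.self_of_nhds hd
      have hkpos : ∀ᶠ z in 𝓝 z0, 0 < k z := by
        apply hkc.eventually (lt_mem_nhds (by rw [hk0]; exact hs0))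
      filter_upwards [evD, evO, hkN, hkpos] with z h1 h2 h3 h4 s
      rcases hdich z h1 h2 with hz | hz
      · simpa using hz s
      · have := h3 hz; linarith
    · refine ⟨-1, Or.inr rfl, ?_⟩
      have hk0 := hkN.self_of_nhds hd
      have hkpos : ∀ᶠ z in 𝓝 z0, k z < 0 := by
        apply hkc.eventually (gt_mem_nhds (by rw [hk0]; linarith))
      filter_upwards [evD, evO, hkP, hkpos] with z h1 h2 h3 h4 s
      rcases hdich z h1 h2 with hz | hz
      · have := h3 hz; linarith
      · simpa [sub_eq_add_neg] using hz s
  obtain ⟨W, hWsub, hWo, hz0W⟩ := mem_nhds_iff.1 (evD.and (evO.and hsign))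
  have hFon : ∀ z ∈ W, ContDiffAt ℝ ∞ (fun z : ℂ => F (z, θ0)) z := by
    intro z hz
    have h1 := hFsm (z, θ0) (mk_mem_solidTorusCover (hWsub hz).1) (hWsub hz).2.1
    exact ContDiffAt.comp (f := fun z : ℂ => ((z, θ0) : ℂ × ℝ)) z h1 (by fun_prop)
  have hτs : ∀ z ∈ W, ContDiffAt ℝ ∞ τ z := fun z hz => contDiff_fst.contDiffAt.comp z (hFon z hz)
  have hhs : ∀ z ∈ W, ContDiffAt ℝ ∞ (fun z => h0 z - ε * θ0) z :=
    fun z hz => (contDiff_snd.contDiffAt.comp z (hFon z hz)).sub contDiffAt_const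
  have hτm : ∀ z ∈ W, τ z ∈ Metric.ball (0 : ℂ) 1 := fun z hz =>
    mem_solidTorusCover.1 (hGmem _ (hWsub hz).2.1)
  have hmap : ∀ z ∈ W, ∀ s : ℝ, Φ.map (z, s) = Ψ.map (τ z, ε * s + (h0 z - ε * θ0)) := by
    intro z hz s
    have := (hWsub hz).2.2 (s - θ0)
    rw [add_sub_cancel] at this
    rw [this]
    congr 2
    ring
  refine ⟨W, τ, fun z => h0 z - ε * θ0, ε, ⟨hWo, fun z hz => (hWsub hz).1, hτm,
    fun z hz => (hτs z hz).contDiffWithinAt, fun z hz => (hhs z hz).contDiffWithinAt, hε, hmap, ?_⟩,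
    hz0W, by simp [hτ, hFz0], by simp [hh0, hFz0]⟩
  -- the derivative of the transition has determinant `ε * det τ'`, and it preserves the orientation
  intro z hz
  have hzc : (z, θ0) ∈ solidTorusCover := mk_mem_solidTorusCover (hWsub hz).1
  set T : ℂ × ℝ → ℂ × ℝ := fun v => (τ v.1, ε * v.2 + (h0 v.1 - ε * θ0)) with hT
  have hTc : T (z, θ0) ∈ solidTorusCover := mk_mem_solidTorusCover (hτm z hz)
  have hTm : Φ.map (z, θ0) = Ψ.map (T (z, θ0)) := hmap z hz θ0
  have hTd : HasFDerivAt T (fiberedLinear (fderiv ℝ τ z) ε (fderiv ℝ (fun z => h0 z - ε * θ0) z))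
      (z, θ0) := by
    have d1 : HasFDerivAt τ (fderiv ℝ τ z) ((z, θ0) : ℂ × ℝ).1 :=
      ((hτs z hz).differentiableAt (by simp)).hasFDerivAt
    have d2 : HasFDerivAt (fun z => h0 z - ε * θ0) (fderiv ℝ (fun z => h0 z - ε * θ0) z)
      ((z, θ0) : ℂ × ℝ).1 := ((hhs z hz).differentiableAt (by simp)).hasFDerivAt
    have d3 := (d1.comp (z, θ0) hasFDerivAt_fst).prodMk
      ((hasFDerivAt_snd.const_mul ε).add (d2.comp (z, θ0) hasFDerivAt_fst))
    exact d3
  have hev : (chartAt E3 (Φ.map (z, θ0)) ∘ Φ.map) =ᶠ[𝓝 (z, θ0)]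
      (chartAt E3 (Φ.map (z, θ0)) ∘ Ψ.map) ∘ T := by
    have : ∀ᶠ v : ℂ × ℝ in 𝓝 (z, θ0), v.1 ∈ W :=
      continuous_fst.continuousAt (hWo.mem_nhds hz)
    filter_upwards [this] with v hv
    simp only [Function.comp_apply]
    rw [show v = (v.1, v.2) from rfl, hmap v.1 hv v.2]
  have hdet : frameDet (fderiv ℝ (chartAt E3 (Φ.map (z, θ0)) ∘ Φ.map) (z, θ0)) =
      frameDet (fderiv ℝ (chartAt E3 (Φ.map (z, θ0)) ∘ Ψ.map) (T (z, θ0))) *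
        (ε * (fderiv ℝ τ z).det) := by
    rw [← fiberedLinear_det, ← frameDet_comp]
    congr 1
    rw [hev.fderiv_eq]
    refine HasFDerivAt.fderiv (HasFDerivAt.comp _ ?_ hTd)
    refine (ContDiffAt.differentiableAt (Ψ.contDiffAt_chart_comp hTc ?_) (by simp)).hasFDerivAt
    rw [← hTm]
    exact mem_chart_source _ _
  have hp1 := Φ.frameDet_pos hzc
  have hp2 := Ψ.frameDet_pos hTc
  rw [← hTm] at hp2
  rw [hdet] at hp1
  exact pos_of_mul_pos_right hp1 hp2.le

end FiberedChart

/-! ### Roots of unity and deck transformations -/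

lemma rootOfUnityPow_zero (a : ℕ) : rootOfUnityPow a 0 = 1 := by simp [rootOfUnityPow]

lemma rootOfUnityPow_add (a : ℕ) (k l : ℤ) :
    rootOfUnityPow a (k + l) = rootOfUnityPow a k * rootOfUnityPow a l := by
  unfold rootOfUnityPow
  rw [← Complex.exp_add]
  congr 1
  push_cast
  ring

lemma rootOfUnityPow_ne_zero (a : ℕ) (k : ℤ) : rootOfUnityPow a k ≠ 0 := Complex.exp_ne_zero _

lemma rootOfUnityPow_eq_one_iff {a : ℕ} (ha : 0 < a) (k : ℤ) :
    rootOfUnityPow a k = 1 ↔ (a : ℤ) ∣ k := by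
  have ha' : (a : ℂ) ≠ 0 := by exact_mod_cast ha.ne'
  have hpi : (2 * Real.pi * Complex.I : ℂ) ≠ 0 := by simp [Real.pi_ne_zero]
  unfold rootOfUnityPow
  rw [Complex.exp_eq_one_iff]
  constructor
  · rintro ⟨n, hn⟩
    refine ⟨n, ?_⟩
    have h1 : (2 * Real.pi * Complex.I : ℂ) * k = (2 * Real.pi * Complex.I) * (a * n) := by
      field_simp at hn ⊢
      exact hn
    have h2 := mul_left_cancel₀ hpi h1
    exact_mod_cast h2
  · rintro ⟨n, rfl⟩
    refine ⟨n, ?_⟩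
    push_cast
    field_simp

lemma rootOfUnityPow_eq_of_dvd {a : ℕ} (ha : 0 < a) {k l : ℤ} (h : (a : ℤ) ∣ k - l) :
    rootOfUnityPow a k = rootOfUnityPow a l := by
  have h1 := (rootOfUnityPow_eq_one_iff ha (k - l)).2 h
  have h2 := rootOfUnityPow_add a (k - l) l
  rwa [sub_add_cancel, h1, one_mul] at h2

/-- The nontrivial `a`-th roots of unity stay away from `1`. -/
lemma exists_pos_le_norm_rootOfUnityPow_sub_one {a : ℕ} (ha : 0 < a) :
    ∃ δ > 0, ∀ k : ℤ, rootOfUnityPow a k = 1 ∨ δ ≤ ‖rootOfUnityPow a k - 1‖ := by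
  have hfin : ((fun k : ℤ => rootOfUnityPow a k) '' Set.univ).Finite := by
    refine Set.Finite.subset ((Finset.Ico (0 : ℤ) a).finite_toSet.image
      fun k => rootOfUnityPow a k) ?_
    rintro _ ⟨k, -, rfl⟩
    refine ⟨k % a, ?_, ?_⟩
    · simp only [Finset.coe_Ico, Set.mem_Ico]
      exact ⟨Int.emod_nonneg _ (by omega), Int.emod_lt_of_pos _ (by omega)⟩
    · refine rootOfUnityPow_eq_of_dvd ha ?_
      exact ⟨-(k / a), by have := Int.mul_ediv_add_emod k a; linarith⟩
  have hcl : IsClosed (((fun k : ℤ => rootOfUnityPow a k) '' Set.univ) \ {1}) :=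
    (hfin.subset sdiff_subset).isClosed
  have h1 : (((fun k : ℤ => rootOfUnityPow a k) '' Set.univ) \ {1})ᶜ ∈ 𝓝 (1 : ℂ) :=
    hcl.isOpen_compl.mem_nhds (by simp)
  obtain ⟨δ, hδ, hsub⟩ := Metric.mem_nhds_iff.1 h1
  refine ⟨δ, hδ, fun k => ?_⟩
  by_contra! hk
  have h2 : rootOfUnityPow a k ∈ Metric.ball (1 : ℂ) δ := by
    rw [mem_ball_iff_norm]; exact hk.2
  exact hsub h2 ⟨⟨k, trivial, rfl⟩, hk.1⟩

/-- A continuous function with values in a coset of a discrete subgroup `cℤ` is locally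
constant. -/
lemma eventually_eq_of_sub_mem_lattice {X : Type*} [TopologicalSpace X] {f : X → ℝ} {x : X}
    (hf : ContinuousAt f x) {c : ℝ} (hc : 0 < c)
    (h : ∀ᶠ y in 𝓝 x, ∃ m : ℤ, f y = f x + c * m) : ∀ᶠ y in 𝓝 x, f y = f x := by
  have h1 : ∀ᶠ y in 𝓝 x, |f y - f x| < c := by
    have := Metric.continuousAt_iff'.1 hf c hc
    simpa [Real.dist_eq] using this
  filter_upwards [h, h1] with y ⟨m, hm⟩ hy
  rw [hm, add_sub_cancel_left, abs_mul, abs_of_pos hc] at hy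
  have : |(m : ℝ)| < 1 := by nlinarith [abs_nonneg (m : ℝ)]
  have hm0 : m = 0 := by
    rw [← Int.cast_abs] at this
    have : |m| < 1 := by exact_mod_cast this
    exact Int.abs_lt_one_iff.1 this
  simp [hm, hm0]

namespace FiberedChart

variable {M B : Type*} [TopologicalSpace M] [ChartedSpace E3 M] {p : M → B}

lemma mult_cast_pos (Φ : FiberedChart p) : (0 : ℝ) < Φ.mult := by exact_mod_cast Φ.mult_pos

/-- Two points of the same fiber circle `{z} × ℝ` with the same image differ by a multiple of
`2π / a`. -/
lemma exists_int_of_map_eq (Φ : FiberedChart p) {z z' : ℂ} {s s' : ℝ}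
    (hz : z ∈ Metric.ball (0 : ℂ) 1) (hz' : z' ∈ Metric.ball (0 : ℂ) 1)
    (h : Φ.map (z, s) = Φ.map (z', s')) : ∃ m : ℤ, s' = s + 2 * Real.pi / Φ.mult * m := by
  obtain ⟨k, n, -, h2⟩ := (Φ.map_eq_iff _ (mk_mem_solidTorusCover hz) _
    (mk_mem_solidTorusCover hz')).1 h
  have := Φ.mult_cast_pos.ne'
  refine ⟨k * Φ.twist + n * Φ.mult, ?_⟩
  simp only at h2
  rw [h2]
  push_cast
  field_simp
  ring

namespace IsTransition

variable {Φ Ψ Χ : FiberedChart p} {W W' : Set ℂ} {τ τ' : ℂ → ℂ} {h h' : ℂ → ℝ} {ε ε' : ℝ}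

lemma mem_nhds (T : IsTransition Φ Ψ W τ h ε) {z : ℂ} (hz : z ∈ W) : W ∈ 𝓝 z :=
  T.isOpen.mem_nhds hz

lemma contDiffAt_base (T : IsTransition Φ Ψ W τ h ε) {z : ℂ} (hz : z ∈ W) : ContDiffAt ℝ ∞ τ z :=
  T.contDiffOn_base.contDiffAt (T.mem_nhds hz)

lemma contDiffAt_shift (T : IsTransition Φ Ψ W τ h ε) {z : ℂ} (hz : z ∈ W) :
    ContDiffAt ℝ ∞ h z :=
  T.contDiffOn_shift.contDiffAt (T.mem_nhds hz)

lemma hasFDerivAt_base (T : IsTransition Φ Ψ W τ h ε) {z : ℂ} (hz : z ∈ W) :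
    HasFDerivAt τ (fderiv ℝ τ z) z :=
  ((T.contDiffAt_base hz).differentiableAt (by simp)).hasFDerivAt

lemma hasFDerivAt_shift (T : IsTransition Φ Ψ W τ h ε) {z : ℂ} (hz : z ∈ W) :
    HasFDerivAt h (fderiv ℝ h z) z :=
  ((T.contDiffAt_shift hz).differentiableAt (by simp)).hasFDerivAt

lemma sign_mul_sign (T : IsTransition Φ Ψ W τ h ε) : ε * ε = 1 := by
  rcases T.sign with h | h <;> simp [h]

lemma base_eq (T : IsTransition Φ Ψ W τ h ε) {z : ℂ} (hz : z ∈ W) : Φ.base z = Ψ.base (τ z) := by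
  rw [base, T.map_eq z hz 0, Ψ.proj_map (mk_mem_solidTorusCover (T.mapsTo hz))]

lemma det_ne_zero (T : IsTransition Φ Ψ W τ h ε) {z : ℂ} (hz : z ∈ W) :
    (fderiv ℝ τ z).det ≠ 0 := by
  intro h0
  have := T.det_pos z hz
  simp [h0] at this

lemma fderiv_comp (T : IsTransition Φ Ψ W τ h ε) (T' : IsTransition Ψ Χ W' τ' h' ε') {z : ℂ}
    (hz : z ∈ W) (hz' : τ z ∈ W') :
    fderiv ℝ (τ' ∘ τ) z = (fderiv ℝ τ' (τ z)).comp (fderiv ℝ τ z) :=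
  ((T'.hasFDerivAt_base hz').comp z (T.hasFDerivAt_base hz)).fderiv

lemma fderiv_shift_comp (T : IsTransition Φ Ψ W τ h ε) (T' : IsTransition Ψ Χ W' τ' h' ε') {z : ℂ}
    (hz : z ∈ W) (hz' : τ z ∈ W') :
    fderiv ℝ (fun z => ε' * h z + h' (τ z)) z =
      ε' • fderiv ℝ h z + (fderiv ℝ h' (τ z)).comp (fderiv ℝ τ z) :=
  (((T.hasFDerivAt_shift hz).const_mul ε').add
    ((T'.hasFDerivAt_shift hz').comp z (T.hasFDerivAt_base hz))).fderiv

lemma comp (T : IsTransition Φ Ψ W τ h ε) (T' : IsTransition Ψ Χ W' τ' h' ε') :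
    IsTransition Φ Χ (W ∩ τ ⁻¹' W') (τ' ∘ τ) (fun z => ε' * h z + h' (τ z)) (ε' * ε) where
  isOpen := T.contDiffOn_base.continuousOn.isOpen_inter_preimage T.isOpen T'.isOpen
  subset := inter_subset_left.trans T.subset
  mapsTo z hz := T'.mapsTo hz.2
  contDiffOn_base := T'.contDiffOn_base.comp (T.contDiffOn_base.mono inter_subset_left)
    fun z hz => hz.2
  contDiffOn_shift := (contDiffOn_const.mul (T.contDiffOn_shift.mono inter_subset_left)).add
    (T'.contDiffOn_shift.comp (T.contDiffOn_base.mono inter_subset_left) fun z hz => hz.2)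
  sign := by rcases T.sign with h | h <;> rcases T'.sign with h' | h' <;> simp [h, h']
  map_eq z hz s := by
    rw [T.map_eq z hz.1, T'.map_eq _ hz.2]
    simp only [Function.comp_apply]
    congr 2
    ring
  det_pos z hz := by
    rw [T.fderiv_comp T' hz.1 hz.2]
    have h1 := T.det_pos z hz.1
    have h2 := T'.det_pos _ hz.2
    have h3 : ((fderiv ℝ τ' (τ z)).comp (fderiv ℝ τ z)).det =
        (fderiv ℝ τ' (τ z)).det * (fderiv ℝ τ z).det := by
      simp only [ContinuousLinearMap.det]
      exact LinearMap.det_comp _ _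
    rw [h3]
    have := mul_pos h2 h1
    linarith

/-- A transition of a fibered chart to itself is, near every point, a deck transformation of the
universal cover of the fibered solid torus. -/
lemma self_eq (T : IsTransition Φ Φ W τ h ε) {z : ℂ} (hz : z ∈ W) :
    ε = 1 ∧ fderiv ℝ h z = 0 ∧
      ∃ k : ℤ, ∀ᶠ z' in 𝓝 z, τ z' = rootOfUnityPow Φ.mult k * z' := by
  have ha := Φ.mult_cast_pos
  set c : ℝ := 2 * Real.pi / Φ.mult with hc
  have hcpos : 0 < c := by positivity
  have key : ∀ z' ∈ W, ∀ s, ∃ m : ℤ, ε * s + h z' = s + c * m := fun z' hz' s =>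
    Φ.exists_int_of_map_eq (T.subset hz') (T.mapsTo hz') (T.map_eq z' hz' s)
  -- for `ε = -1`, the multiple `c m` of the period would change by `c / 2` from `s = 0` to `s = c / 4`
  have hε : ε = 1 := by
    rcases T.sign with h1 | h1
    · exact h1
    · exfalso
      obtain ⟨m, hm⟩ := key z hz 0
      obtain ⟨m', hm'⟩ := key z hz (c / 4)
      have h2 : c * (1 + 2 * m' - 2 * m) = 0 := by rw [h1] at hm hm'; linarith
      have h3 : (1 + 2 * m' - 2 * m : ℝ) = 0 := by
        rcases mul_eq_zero.1 h2 with h | h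
        · exact absurd h hcpos.ne'
        · exact h
      have h4 : (1 + 2 * m' - 2 * m : ℤ) = 0 := by exact_mod_cast h3
      omega
  -- the shift is continuous with values in a lattice
  have hconst : ∀ᶠ z' in 𝓝 z, h z' = h z := by
    refine eventually_eq_of_sub_mem_lattice (T.contDiffAt_shift hz).continuousAt hcpos ?_
    filter_upwards [T.mem_nhds hz] with z' hz'
    obtain ⟨m, hm⟩ := key z hz 0
    obtain ⟨m', hm'⟩ := key z' hz' 0
    refine ⟨m' - m, ?_⟩
    push_cast
    linarith
  refine ⟨hε, ?_, ?_⟩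
  · have : h =ᶠ[𝓝 z] fun _ => h z := hconst
    rw [this.fderiv_eq, fderiv_fun_const]
    rfl
  · have hdeck : ∀ z' ∈ W, ∃ k n : ℤ, τ z' = rootOfUnityPow Φ.mult k * z' ∧
        h z' = 2 * Real.pi * k * Φ.twist / Φ.mult + 2 * Real.pi * n := by
      intro z' hz'
      obtain ⟨k, n, h1, h2⟩ := (Φ.map_eq_iff _ (mk_mem_solidTorusCover (T.subset hz')) _
        (mk_mem_solidTorusCover (T.mapsTo hz'))).1 (T.map_eq z' hz' 0)
      exact ⟨k, n, h1, by simpa using h2⟩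
    obtain ⟨k, n, -, hk⟩ := hdeck z hz
    refine ⟨k, ?_⟩
    filter_upwards [hconst, T.mem_nhds hz] with z' hz'1 hz'2
    obtain ⟨k', n', h1, h2⟩ := hdeck z' hz'2
    rw [h1]
    congr 1
    -- the rotation angle is determined by the shift, since the twist is coprime to `a`
    refine rootOfUnityPow_eq_of_dvd Φ.mult_pos ?_
    have h3 : (k' * Φ.twist + n' * Φ.mult : ℝ) = k * Φ.twist + n * Φ.mult := by
      have h4 : 2 * Real.pi * k' * Φ.twist / Φ.mult + 2 * Real.pi * n' =
          2 * Real.pi * k * Φ.twist / Φ.mult + 2 * Real.pi * n := by rw [← h2, ← hk, hz'1]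
      have hpi := Real.pi_pos
      field_simp at h4
      linarith
    have h5 : (k' * Φ.twist + n' * Φ.mult : ℤ) = k * Φ.twist + n * Φ.mult := by exact_mod_cast h3
    refine Φ.coprime.dvd_of_dvd_mul_right ⟨n - n', ?_⟩
    linarith

end IsTransition

/-! ### Restriction of fibered charts -/

/-- The affine map `(z, θ) ↦ (z₀ + r z, θ)` as a diffeomorphism. -/
noncomputable def affineDiffeo (z₀ : ℂ) (r : ℝ) (hr : r ≠ 0) :
    Diffeomorph 𝓘(ℝ, ℂ × ℝ) 𝓘(ℝ, ℂ × ℝ) (ℂ × ℝ) (ℂ × ℝ) ∞ where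
  toFun w := (z₀ + r * w.1, w.2)
  invFun w := ((r : ℂ)⁻¹ * (w.1 - z₀), w.2)
  left_inv w := by
    have : (r : ℂ) ≠ 0 := by exact_mod_cast hr
    ext1
    · simp only; field_simp; ring
    · rfl
  right_inv w := by
    have : (r : ℂ) ≠ 0 := by exact_mod_cast hr
    ext1
    · simp only; field_simp; ring
    · rfl
  contMDiff_toFun := by
    rw [contMDiff_iff_contDiff]
    simp only [Equiv.coe_fn_mk]
    fun_prop
  contMDiff_invFun := by
    rw [contMDiff_iff_contDiff]
    simp only [Equiv.coe_fn_symm_mk]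
    fun_prop

lemma affine_mem_ball {z₀ z : ℂ} {r : ℝ} (hr : 0 < r) (hz : z ∈ Metric.ball (0 : ℂ) 1) :
    z₀ + r * z ∈ Metric.ball z₀ r := by
  rw [mem_ball_zero_iff] at hz
  rw [mem_ball_iff_norm, add_sub_cancel_left, norm_mul, Complex.norm_real, Real.norm_eq_abs,
    abs_of_pos hr]
  nlinarith

end FiberedChart

namespace FiberedChart

variable {M B : Type*} [TopologicalSpace M] [ChartedSpace E3 M] {p : M → B}
  [IsManifold (𝓡 3) ∞ M]

/-- The restriction of a fibered chart to the part over a disc `{z₀ + r z}` on which the group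
`ℤ/aℤ` acts like `ℤ/a'ℤ`; this is `ℤ/aℤ` itself if `z₀ = 0`, and trivial for small discs away from
the origin. -/
noncomputable def restrict (Φ : FiberedChart p) (z₀ : ℂ) (r : ℝ) (hr : 0 < r)
    (hball : Metric.ball z₀ r ⊆ Metric.ball 0 1) (a : ℕ) (q : ℤ) (ha : 0 < a)
    (hcop : IsCoprime (a : ℤ) q)
    (hdeck : ∀ z ∈ Metric.ball (0 : ℂ) 1, ∀ z' ∈ Metric.ball (0 : ℂ) 1, ∀ θ θ' : ℝ,
      (∃ k n : ℤ, z₀ + r * z' = rootOfUnityPow Φ.mult k * (z₀ + r * z) ∧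
        θ' = θ + 2 * Real.pi * k * Φ.twist / Φ.mult + 2 * Real.pi * n) ↔
      (∃ k n : ℤ, z' = rootOfUnityPow a k * z ∧
        θ' = θ + 2 * Real.pi * k * q / a + 2 * Real.pi * n))
    (hrot : ∀ z ∈ Metric.ball (0 : ℂ) 1, ∀ z' ∈ Metric.ball (0 : ℂ) 1,
      (∃ k : ℤ, z₀ + r * z' = rootOfUnityPow Φ.mult k * (z₀ + r * z)) ↔
      (∃ k : ℤ, z' = rootOfUnityPow a k * z)) : FiberedChart p where
  mult := a
  twist := q
  mult_pos := ha
  coprime := hcop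
  map w := Φ.map (z₀ + r * w.1, w.2)
  localDiffeo := by
    rintro ⟨w, hw⟩
    have h1 := (affineDiffeo z₀ r hr.ne').isLocalDiffeomorph w
    have h2 : affineDiffeo z₀ r hr.ne' w ∈ solidTorusCover :=
      mem_solidTorusCover.2 (hball (affine_mem_ball hr (mem_solidTorusCover.1 hw)))
    exact h1.comp (𝓡 3) M (Φ.localDiffeo ⟨_, h2⟩)
  orientation := by
    intro w hw
    have h2 : ((z₀ + r * w.1, w.2) : ℂ × ℝ) ∈ solidTorusCover :=
      mem_solidTorusCover.2 (hball (affine_mem_ball hr (mem_solidTorusCover.1 hw)))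
    have hd : HasFDerivAt (fun w : ℂ × ℝ => ((z₀ + r * w.1, w.2) : ℂ × ℝ))
        (fiberedLinear ((r : ℂ) • ContinuousLinearMap.id ℝ ℂ) 1 0) w := by
      have d1 : HasFDerivAt (fun w : ℂ × ℝ => z₀ + (r : ℂ) * w.1)
          ((r : ℂ) • ContinuousLinearMap.fst ℝ ℂ ℝ) w :=
        (hasFDerivAt_fst.const_mul (r : ℂ)).const_add z₀
      have d2 := d1.prodMk (hasFDerivAt_snd (p := w))
      have h4 : (((r : ℂ) • ContinuousLinearMap.fst ℝ ℂ ℝ).prod (ContinuousLinearMap.snd ℝ ℂ ℝ)) =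
          fiberedLinear ((r : ℂ) • ContinuousLinearMap.id ℝ ℂ) 1 0 := by
        ext v <;> simp [fiberedLinear]
      rwa [h4] at d2
    have h3 : fderiv ℝ (chartAt E3 (Φ.map (z₀ + r * w.1, w.2)) ∘
        fun w : ℂ × ℝ => Φ.map (z₀ + r * w.1, w.2)) w =
        (fderiv ℝ (chartAt E3 (Φ.map (z₀ + r * w.1, w.2)) ∘ Φ.map) (z₀ + r * w.1, w.2)).comp
          (fiberedLinear ((r : ℂ) • ContinuousLinearMap.id ℝ ℂ) 1 0) := by
      refine HasFDerivAt.fderiv ?_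
      refine HasFDerivAt.comp (g := chartAt E3 (Φ.map (z₀ + r * w.1, w.2)) ∘ Φ.map) w ?_ hd
      exact ((Φ.contDiffAt_chart_comp h2 (mem_chart_source _ _)).differentiableAt
        (by simp)).hasFDerivAt
    change 0 < frameDet _
    rw [h3, frameDet_comp, fiberedLinear_det, complex_det_eq]
    refine mul_pos (Φ.frameDet_pos h2) ?_
    simp
    positivity
  map_eq_iff := by
    intro w hw w' hw'
    rw [Φ.map_eq_iff _ (mk_mem_solidTorusCover (hball (affine_mem_ball hr
      (mem_solidTorusCover.1 hw)))) _ (mk_mem_solidTorusCover (hball (affine_mem_ball hr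
      (mem_solidTorusCover.1 hw'))))]
    exact hdeck _ (mem_solidTorusCover.1 hw) _ (mem_solidTorusCover.1 hw') _ _
  proj_eq_iff := by
    intro w hw w' hw'
    rw [Φ.proj_eq_iff _ (mk_mem_solidTorusCover (hball (affine_mem_ball hr
      (mem_solidTorusCover.1 hw)))) _ (mk_mem_solidTorusCover (hball (affine_mem_ball hr
      (mem_solidTorusCover.1 hw'))))]
    exact hrot _ (mem_solidTorusCover.1 hw) _ (mem_solidTorusCover.1 hw')
  saturated := by
    intro w hw x hx
    have h2 := hball (affine_mem_ball (z₀ := z₀) hr (mem_solidTorusCover.1 hw))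
    rw [Φ.proj_map (mk_mem_solidTorusCover h2)] at hx
    obtain ⟨θ, rfl⟩ := Φ.exists_map_eq h2 hx
    exact ⟨(w.1, θ), mk_mem_solidTorusCover (mem_solidTorusCover.1 hw), rfl⟩

/-- The fibered chart around a point of the base, in any given neighbourhood of it. -/
lemma exists_restrict [TopologicalSpace B] (Φ : FiberedChart p) (hp : Continuous p) {z₀ : ℂ}
    (hz₀ : z₀ ∈ Metric.ball (0 : ℂ) 1) {O : Set B} (hO : IsOpen O) (hzO : Φ.base z₀ ∈ O) :
    ∃ (Ψ : FiberedChart p) (r : ℝ), 0 < r ∧ Metric.ball z₀ r ⊆ Metric.ball 0 1 ∧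
      (∀ w, Ψ.map w = Φ.map (z₀ + r * w.1, w.2)) ∧
      (∀ z ∈ Metric.ball (0 : ℂ) 1, Ψ.base z ∈ O) := by
  have hcont : ContinuousAt Φ.base z₀ := by
    refine hp.continuousAt.comp (f := fun z : ℂ => Φ.map (z, 0)) ?_
    exact ContinuousAt.comp (f := fun z : ℂ => ((z, 0) : ℂ × ℝ)) (g := Φ.map)
      (Φ.continuousAt_map (mk_mem_solidTorusCover hz₀)) (by fun_prop)
  obtain ⟨R, hR, hRsub⟩ := Metric.mem_nhds_iff.1
    (inter_mem (Metric.isOpen_ball.mem_nhds hz₀) (hcont (hO.mem_nhds hzO)))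
  have hbase : ∀ r, r ≤ R → Metric.ball z₀ r ⊆ Metric.ball 0 1 ∧
      ∀ z ∈ Metric.ball z₀ r, Φ.base z ∈ O := fun r hr =>
    ⟨fun z hz => (hRsub (Metric.ball_subset_ball hr hz)).1,
      fun z hz => (hRsub (Metric.ball_subset_ball hr hz)).2⟩
  -- around the center the group stays the same; elsewhere a small disc meets none of its translates,
  -- and the restricted chart has multiplicity one
  by_cases h0 : z₀ = 0
  · subst h0
    have hR' : (R : ℂ) ≠ 0 := by exact_mod_cast hR.ne'
    have hcancel : ∀ (z z' c : ℂ), (0 + R * z' = c * (0 + R * z) ↔ z' = c * z) := by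
      intro z z' c
      rw [zero_add, zero_add, mul_left_comm]
      exact mul_right_inj' hR'
    refine ⟨Φ.restrict 0 R hR (hbase R le_rfl).1 Φ.mult Φ.twist Φ.mult_pos Φ.coprime ?_ ?_, R, hR,
      (hbase R le_rfl).1, fun w => rfl, ?_⟩
    · intro z _ z' _ θ θ'
      simp only [hcancel]
    · intro z _ z' _
      simp only [hcancel]
    · intro z hz
      exact (hbase R le_rfl).2 _ (affine_mem_ball hR hz)
  · obtain ⟨δ, hδ, hδk⟩ := exists_pos_le_norm_rootOfUnityPow_sub_one Φ.mult_pos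
    have hn0 : 0 < ‖z₀‖ := norm_pos_iff.2 h0
    set r := min R (δ * ‖z₀‖ / 2) with hrdef
    have hr : 0 < r := lt_min hR (by positivity)
    have hr2 : 2 * r ≤ δ * ‖z₀‖ := by
      have := min_le_right R (δ * ‖z₀‖ / 2)
      linarith
    have hr' : (r : ℂ) ≠ 0 := by exact_mod_cast hr.ne'
    obtain ⟨hb1, hb2⟩ := hbase r (min_le_left _ _)
    have hone : ∀ z ∈ Metric.ball (0 : ℂ) 1, ∀ z' ∈ Metric.ball (0 : ℂ) 1, ∀ k : ℤ,
        z₀ + r * z' = rootOfUnityPow Φ.mult k * (z₀ + r * z) → rootOfUnityPow Φ.mult k = 1 := by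
      intro z hz z' hz' k hk
      refine (hδk k).resolve_right fun hle => ?_
      have h1 : (rootOfUnityPow Φ.mult k - 1) * z₀ =
          r * z' - rootOfUnityPow Φ.mult k * (r * z) := by linear_combination -hk
      have h2 : ‖(rootOfUnityPow Φ.mult k - 1) * z₀‖ ≤ r * ‖z'‖ + r * ‖z‖ := by
        rw [h1]
        refine (norm_sub_le _ _).trans ?_
        simp [rootOfUnityPow_norm, abs_of_pos hr]
      rw [norm_mul] at h2
      have h3 := mul_le_mul_of_nonneg_right hle hn0.le
      rw [mem_ball_zero_iff] at hz hz'
      nlinarith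
    have hone1 : ∀ k : ℤ, rootOfUnityPow 1 k = 1 := fun k =>
      (rootOfUnityPow_eq_one_iff one_pos k).2 (by simp)
    have hinj : ∀ z z' : ℂ, z₀ + r * z' = 1 * (z₀ + r * z) ↔ z' = 1 * z := by
      intro z z'
      rw [one_mul, one_mul, add_right_inj]
      exact mul_right_inj' hr'
    refine ⟨Φ.restrict z₀ r hr hb1 1 0 one_pos (by simpa using isCoprime_one_left) ?_ ?_, r, hr,
      hb1, fun w => rfl, ?_⟩
    · intro z hz z' hz' θ θ'
      constructor
      · rintro ⟨k, n, hk, hn⟩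
        have h1 := hone z hz z' hz' k hk
        rw [h1, hinj] at hk
        -- `k = a m` rotates the disc trivially and adds `2 π m q`, a multiple of `2 π`, to the angle
        obtain ⟨m, hm⟩ := (rootOfUnityPow_eq_one_iff Φ.mult_pos k).1 h1
        refine ⟨0, m * Φ.twist + n, by simpa [hone1] using hk, ?_⟩
        rw [hn, hm]
        have := Φ.mult_cast_pos.ne'
        push_cast
        field_simp
        ring
      · rintro ⟨k, n, hk, hn⟩
        rw [hone1, ← hinj] at hk
        exact ⟨0, n, by simpa [rootOfUnityPow_zero] using hk, by simpa using hn⟩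
    · intro z hz z' hz'
      constructor
      · rintro ⟨k, hk⟩
        have h1 := hone z hz z' hz' k hk
        rw [h1, hinj] at hk
        exact ⟨0, by simpa [hone1] using hk⟩
      · rintro ⟨k, hk⟩
        rw [hone1, ← hinj] at hk
        exact ⟨0, by simpa [rootOfUnityPow_zero] using hk⟩
    · intro z hz
      exact hb2 _ (affine_mem_ball hr hz)

end FiberedChart

namespace SeifertFibration

variable {M B : Type*} [TopologicalSpace M] [ChartedSpace E3 M] [TopologicalSpace B]

/-- The maximal atlas of a Seifert fibration: all fibered charts which are compatible with the
given ones. -/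
abbrev Chart (S : SeifertFibration M B) : Type _ :=
  {Φ : FiberedChart S.proj // ∀ Ψ ∈ S.charts, Φ.Compatible Ψ}

variable (S : SeifertFibration M B)

/-- Compatibility is transitive, because the given charts cover `M`. -/
lemma compatible_chart (Φ Ψ : S.Chart) : Φ.1.Compatible Ψ.1 := by
  intro w hw w' hw' heq
  obtain ⟨Χ, hΧ, v, hv, hvx⟩ := S.cover (Φ.1.map w)
  rcases Φ.2 Χ hΧ w hw v hv hvx.symm with h1 | h1 <;>
    rcases Ψ.2 Χ hΧ w' hw' v hv (by rw [← heq, hvx]) with h2 | h2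
  · exact Or.inl fun s => (h1 s).trans (h2 s).symm
  · refine Or.inr fun s => (h1 s).trans ?_
    have := h2 (-s)
    simpa [sub_eq_add_neg] using this.symm
  · refine Or.inr fun s => (h1 s).trans ?_
    have := h2 (-s)
    simpa [sub_eq_add_neg] using this.symm
  · exact Or.inl fun s => (h1 s).trans (h2 s).symm

/-- A chart of the given atlas, as a chart of the maximal atlas. -/
def ofMem {Φ : FiberedChart S.proj} (hΦ : Φ ∈ S.charts) : S.Chart :=
  ⟨Φ, fun Ψ hΨ => S.compatible Φ hΦ Ψ hΨ⟩

lemma exists_base_eq (b : B) : ∃ Φ ∈ S.charts, ∃ z ∈ Metric.ball (0 : ℂ) 1, Φ.base z = b := by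
  obtain ⟨x, rfl⟩ := S.surjective_proj b
  obtain ⟨Φ, hΦ, w, hw, rfl⟩ := S.cover x
  exact ⟨Φ, hΦ, w.1, mem_solidTorusCover.1 hw, (Φ.proj_map hw).symm⟩

/-! ### The base -/

lemma continuousOn_base (Φ : S.Chart) : ContinuousOn Φ.1.base (Metric.ball 0 1) := by
  refine S.continuous_proj.comp_continuousOn ?_
  exact Φ.1.continuousOn_map.comp (by fun_prop) fun z hz => mk_mem_solidTorusCover hz

lemma continuousAt_base (Φ : S.Chart) {z : ℂ} (hz : z ∈ Metric.ball (0 : ℂ) 1) :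
    ContinuousAt Φ.1.base z :=
  (S.continuousOn_base Φ).continuousAt (Metric.isOpen_ball.mem_nhds hz)

section Topology

variable [CompactSpace M] [T2Space B]

lemma isQuotientMap_proj : IsQuotientMap S.proj :=
  S.continuous_proj.isClosedMap.isQuotientMap S.continuous_proj S.surjective_proj

lemma isOpen_image_base (Φ : S.Chart) {V : Set ℂ} (hV : IsOpen V)
    (hVD : V ⊆ Metric.ball (0 : ℂ) 1) : IsOpen (Φ.1.base '' V) := by
  rw [← S.isQuotientMap_proj.isOpen_preimage, isOpen_iff_mem_nhds]
  rintro x ⟨z, hz, hzx⟩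
  obtain ⟨θ, rfl⟩ := Φ.1.exists_map_eq (hVD hz) hzx.symm
  obtain ⟨O, G, hO, hxO, hG, hΦG, hGD, -, hGx⟩ :=
    Φ.1.exists_local_inverse (mk_mem_solidTorusCover (s := θ) (hVD hz))
  have h1 : ∀ᶠ y in 𝓝 (Φ.1.map (z, θ)), (G y).1 ∈ V := by
    have : ContinuousAt G (Φ.1.map (z, θ)) := hG.continuousOn.continuousAt (hO.mem_nhds hxO)
    refine (continuous_fst.continuousAt.comp this) (hV.mem_nhds ?_)
    simpa [hGx] using hz
  filter_upwards [h1, hO.mem_nhds hxO] with y hy hyO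
  refine ⟨(G y).1, hy, ?_⟩
  rw [← Φ.1.proj_map (hGD y hyO), hΦG y hyO]

lemma image_base_mem_nhds (Φ : S.Chart) {z : ℂ} (hz : z ∈ Metric.ball (0 : ℂ) 1) {V : Set ℂ}
    (hV : V ∈ 𝓝 z) : Φ.1.base '' V ∈ 𝓝 (Φ.1.base z) := by
  obtain ⟨U, hU, hUo, hzU⟩ := mem_nhds_iff.1 (inter_mem hV (Metric.isOpen_ball.mem_nhds hz))
  exact mem_of_superset ((S.isOpen_image_base Φ hUo (hU.trans inter_subset_right)).mem_nhds
    ⟨z, hzU, rfl⟩) (image_mono (hU.trans inter_subset_left))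

omit [T2Space B] in
include S in
lemma compactSpace_base : CompactSpace B :=
  ⟨by rw [← S.surjective_proj.range_eq]; exact isCompact_range S.continuous_proj⟩

omit [T2Space B] [CompactSpace M] in
include S in
lemma connectedSpace_base [ConnectedSpace M] : ConnectedSpace B :=
  S.surjective_proj.connectedSpace S.continuous_proj

omit [CompactSpace M] in
lemma isClosed_image_base (Φ : S.Chart) {r : ℝ} (hr : r < 1) :
    IsClosed (Φ.1.base '' Metric.closedBall 0 r) :=
  ((isCompact_closedBall (0 : ℂ) r).image_of_continuousOn ((S.continuousOn_base Φ).mono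
    (Metric.closedBall_subset_ball hr))).isClosed

end Topology

/-! ### Charts of the maximal atlas -/

variable [IsManifold (𝓡 3) ∞ M]

/-- Every point of the base is the center of a chart in any given neighbourhood. -/
lemma exists_chart_base_zero {b : B} {O : Set B} (hO : IsOpen O) (hb : b ∈ O) :
    ∃ Φ : S.Chart, Φ.1.base 0 = b ∧ ∀ z ∈ Metric.ball (0 : ℂ) 1, Φ.1.base z ∈ O := by
  obtain ⟨Φ, hΦ, z₀, hz₀, rfl⟩ := S.exists_base_eq b
  obtain ⟨Ψ, r, hr, hball, hmap, hΨO⟩ := Φ.exists_restrict S.continuous_proj hz₀ hO hb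
  refine ⟨⟨Ψ, fun Χ hΧ w hw w' hw' heq => ?_⟩, ?_, hΨO⟩
  · rw [hmap] at heq
    have := S.compatible Φ hΦ Χ hΧ _ (mk_mem_solidTorusCover (hball (FiberedChart.affine_mem_ball
      hr (mem_solidTorusCover.1 hw)))) w' hw' heq
    simpa only [hmap] using this
  · simp [FiberedChart.base, hmap]

/-- Charts over the same point of the base are related by a transition there. -/
lemma exists_isTransition (Φ Ψ : S.Chart) {z z' : ℂ} (hz : z ∈ Metric.ball (0 : ℂ) 1)
    (hz' : z' ∈ Metric.ball (0 : ℂ) 1) (h : Φ.1.base z = Ψ.1.base z') :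
    ∃ (W : Set ℂ) (τ : ℂ → ℂ) (g : ℂ → ℝ) (ε : ℝ),
      FiberedChart.IsTransition Φ.1 Ψ.1 W τ g ε ∧ z ∈ W ∧ τ z = z' := by
  obtain ⟨θ, hθ⟩ := Ψ.1.exists_map_eq hz' h
  obtain ⟨W, τ, g, ε, T, h1, h2, -⟩ := (S.compatible_chart Φ Ψ).exists_isTransition
    (mk_mem_solidTorusCover hz) (mk_mem_solidTorusCover hz') hθ.symm
  exact ⟨W, τ, g, ε, T, h1, h2⟩

end SeifertFibration

/-! ### Natural fields on the base -/

/-- A natural kind of fields on the orbifold charts of the base of a Seifert fibration: a transition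
with sign `ε`, whose base map and shift have the derivatives `A` and `l` at a point, pulls values of
the field back by `act ε A l`. -/
structure NaturalAction (V : Type*) [NormedAddCommGroup V] [NormedSpace ℝ V] where
  act : ℝ → (ℂ →L[ℝ] ℂ) → (ℂ →L[ℝ] ℝ) → V → V
  act_comp : ∀ ε ε' : ℝ, (ε' = 1 ∨ ε' = -1) → ∀ A A' l l' v,
    act (ε' * ε) (A'.comp A) (ε' • l + l'.comp A) v = act ε A l (act ε' A' l' v)
  injective : ∀ ε : ℝ, (ε = 1 ∨ ε = -1) → ∀ A l, A.det ≠ 0 → Function.Injective (act ε A l)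
  contDiff : ∀ ε : ℝ, ContDiff ℝ ∞
    fun x : (ℂ →L[ℝ] ℂ) × (ℂ →L[ℝ] ℝ) × V => act ε x.1 x.2.1 x.2.2

lemma surjective_of_det_ne_zero {A : ℂ →L[ℝ] ℂ} (hA : A.det ≠ 0) : Function.Surjective A := by
  have := (LinearMap.equivOfDetNeZero (A : ℂ →ₗ[ℝ] ℂ) hA).surjective
  intro y
  obtain ⟨x, hx⟩ := this y
  exact ⟨x, hx⟩

lemma det_comp_complex (A' A : ℂ →L[ℝ] ℂ) : (A'.comp A).det = A'.det * A.det := by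
  simp only [ContinuousLinearMap.det]
  exact LinearMap.det_comp _ _

lemma contDiff_det : ContDiff ℝ ∞ fun A : ℂ →L[ℝ] ℂ => A.det := by
  simp only [complex_det_eq, ← Complex.reCLM_apply, ← Complex.imCLM_apply]
  fun_prop

/-- The pull-back of the local connection forms `l` (`c = 1`) of a connection `dθ + l`, or of the
`1`-forms on the base with values in the local system of fiber orientations (`c = 0`). -/
noncomputable def formAction (c : ℝ) : NaturalAction (ℂ →L[ℝ] ℝ) where
  act ε A l v := ε • (v.comp A + c • l)
  act_comp := by
    intro ε ε' hε' A A' l l' v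
    rcases hε' with rfl | rfl
    · ext x; simp; ring
    · ext x; simp; ring
  injective := by
    intro ε hε A l hA v v' hvv'
    have hε0 : ε ≠ 0 := by rcases hε with rfl | rfl <;> norm_num
    have h1 := add_right_cancel (smul_right_injective _ hε0 hvv')
    ext1 y
    obtain ⟨x, rfl⟩ := surjective_of_det_ne_zero hA y
    exact congrArg (fun f : ℂ →L[ℝ] ℝ => f x) h1
  contDiff := by
    intro ε
    refine ContDiff.const_smul ε (ContDiff.add ?_ (ContDiff.const_smul c ?_))
    · exact ContDiff.clm_comp (contDiff_snd.comp contDiff_snd) contDiff_fst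
    · exact contDiff_fst.comp contDiff_snd

/-- The pull-back of densities on the base. -/
noncomputable def densityAction : NaturalAction ℝ where
  act ε A _ g := ε * A.det * g
  act_comp := by
    intro ε ε' hε' A A' l l' g
    rw [det_comp_complex]
    ring
  injective := by
    intro ε hε A l hA
    refine mul_right_injective₀ (mul_ne_zero ?_ hA)
    rcases hε with rfl | rfl <;> norm_num
  contDiff := by
    intro ε
    exact (contDiff_const.mul (contDiff_det.comp contDiff_fst)).mul
      (contDiff_snd.comp contDiff_snd)

namespace SeifertFibration

open FiberedChart

variable {M B : Type*} [TopologicalSpace M] [ChartedSpace E3 M] [TopologicalSpace B]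
  (S : SeifertFibration M B) {V : Type*} [NormedAddCommGroup V] [NormedSpace ℝ V]

/-- A smooth natural field, given in the charts of the set `C`. -/
structure IsSection (𝒩 : NaturalAction V) (C : Set S.Chart) (F : S.Chart → ℂ → V) : Prop where
  contDiffOn : ∀ Φ ∈ C, ContDiffOn ℝ ∞ (F Φ) (Metric.ball 0 1)
  eq_act : ∀ Φ ∈ C, ∀ Ψ ∈ C, ∀ W τ h ε, IsTransition Φ.1 Ψ.1 W τ h ε → ∀ z ∈ W,
    F Φ z = 𝒩.act ε (fderiv ℝ τ z) (fderiv ℝ h z) (F Ψ (τ z))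

variable [IsManifold (𝓡 3) ∞ M]

variable {S}

/-- A natural field is determined by, and may be prescribed in, any set of charts whose images cover
the base. -/
lemma IsSection.exists_extension {𝒩 : NaturalAction V} {C : Set S.Chart} {F : S.Chart → ℂ → V}
    (hF : S.IsSection 𝒩 C F)
    (hC : ∀ b : B, ∃ Φ ∈ C, ∃ z ∈ Metric.ball (0 : ℂ) 1, Φ.1.base z = b) :
    ∃ F' : S.Chart → ℂ → V, S.IsSection 𝒩 univ F' ∧
      ∀ Φ ∈ C, ∀ z ∈ Metric.ball (0 : ℂ) 1, F' Φ z = F Φ z := by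
  -- values transported by two transitions into charts of `C` agree
  have indep : ∀ (Ψ : S.Chart), ∀ Φ₁ ∈ C, ∀ Φ₂ ∈ C, ∀ W₁ τ₁ h₁ ε₁ W₂ τ₂ h₂ ε₂,
      IsTransition Ψ.1 Φ₁.1 W₁ τ₁ h₁ ε₁ → IsTransition Ψ.1 Φ₂.1 W₂ τ₂ h₂ ε₂ →
      ∀ z ∈ W₁, z ∈ W₂ →
      𝒩.act ε₁ (fderiv ℝ τ₁ z) (fderiv ℝ h₁ z) (F Φ₁ (τ₁ z)) =
        𝒩.act ε₂ (fderiv ℝ τ₂ z) (fderiv ℝ h₂ z) (F Φ₂ (τ₂ z)) := by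
    intro Ψ Φ₁ hΦ₁ Φ₂ hΦ₂ W₁ τ₁ h₁ ε₁ W₂ τ₂ h₂ ε₂ T₁ T₂ z hz₁ hz₂
    obtain ⟨W, τ, h, ε, T, hzW, hτz⟩ := S.exists_isTransition Φ₁ Ψ (T₁.mapsTo hz₁)
      (T₁.subset hz₁) (T₁.base_eq hz₁).symm
    have e₁ := hF.eq_act _ hΦ₁ _ hΦ₁ _ _ _ _ (T.comp T₁) (τ₁ z) ⟨hzW, by simpa [hτz]⟩
    have e₂ := hF.eq_act _ hΦ₁ _ hΦ₂ _ _ _ _ (T.comp T₂) (τ₁ z) ⟨hzW, by simpa [hτz]⟩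
    rw [T.fderiv_comp T₁ hzW (by simpa [hτz]), T.fderiv_shift_comp T₁ hzW (by simpa [hτz]),
      𝒩.act_comp _ _ T₁.sign] at e₁
    rw [T.fderiv_comp T₂ hzW (by simpa [hτz]), T.fderiv_shift_comp T₂ hzW (by simpa [hτz]),
      𝒩.act_comp _ _ T₂.sign] at e₂
    have := 𝒩.injective _ T.sign _ _ (T.det_ne_zero hzW) (e₁.symm.trans e₂)
    simpa [hτz] using this
  have hex : ∀ (Ψ : S.Chart) (z : ℂ), z ∈ Metric.ball (0 : ℂ) 1 → ∃ v : V, ∀ Φ ∈ C, ∀ W τ h ε,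
      IsTransition Ψ.1 Φ.1 W τ h ε → z ∈ W →
      v = 𝒩.act ε (fderiv ℝ τ z) (fderiv ℝ h z) (F Φ (τ z)) := by
    intro Ψ z hz
    obtain ⟨Φ, hΦ, z', hz', hb⟩ := hC (Ψ.1.base z)
    obtain ⟨W, τ, h, ε, T, hzW, hτz⟩ := S.exists_isTransition Ψ Φ hz hz' hb.symm
    exact ⟨_, fun Φ₂ hΦ₂ W₂ τ₂ h₂ ε₂ T₂ hz₂ =>
      indep Ψ Φ hΦ Φ₂ hΦ₂ W τ h ε W₂ τ₂ h₂ ε₂ T T₂ z hzW hz₂⟩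
  choose! F' hF' using hex
  refine ⟨F', ⟨?_, ?_⟩, ?_⟩
  · intro Ψ _ z hz
    obtain ⟨Φ, hΦ, z', hz', hb⟩ := hC (Ψ.1.base z)
    obtain ⟨W, τ, h, ε, T, hzW, hτz⟩ := S.exists_isTransition Ψ Φ hz hz' hb.symm
    have hev : F' Ψ =ᶠ[𝓝 z] fun y => 𝒩.act ε (fderiv ℝ τ y) (fderiv ℝ h y) (F Φ (τ y)) := by
      filter_upwards [T.mem_nhds hzW] with y hy
      exact hF' Ψ y (T.subset hy) Φ hΦ W τ h ε T hy
    refine ContDiffAt.contDiffWithinAt (ContDiffAt.congr_of_eventuallyEq ?_ hev)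
    have d1 : ContDiffAt ℝ ∞ (fderiv ℝ τ) z := (T.contDiffAt_base hzW).fderiv_right (by simp)
    have d2 : ContDiffAt ℝ ∞ (fderiv ℝ h) z := (T.contDiffAt_shift hzW).fderiv_right (by simp)
    have d3 : ContDiffAt ℝ ∞ (fun y => F Φ (τ y)) z :=
      ((hF.contDiffOn Φ hΦ).contDiffAt (Metric.isOpen_ball.mem_nhds (T.mapsTo hzW))).comp z
        (T.contDiffAt_base hzW)
    exact (𝒩.contDiff ε).contDiffAt.comp z (d1.prodMk (d2.prodMk d3))
  · intro Ψ₁ _ Ψ₂ _ W τ h ε T z hz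
    obtain ⟨Φ, hΦ, z', hz', hb⟩ := hC (Ψ₂.1.base (τ z))
    obtain ⟨W', τ', h', ε', T', hzW', hτz'⟩ :=
      S.exists_isTransition Ψ₂ Φ (T.mapsTo hz) hz' hb.symm
    rw [hF' Ψ₂ (τ z) (T.mapsTo hz) Φ hΦ _ _ _ _ T' hzW',
      hF' Ψ₁ z (T.subset hz) Φ hΦ _ _ _ _ (T.comp T') ⟨hz, hzW'⟩, T.fderiv_comp T' hz hzW',
      T.fderiv_shift_comp T' hz hzW', 𝒩.act_comp _ _ T'.sign]
    rfl
  · intro Φ hΦ z hz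
    obtain ⟨W, τ, h, ε, T, hzW, hτz⟩ := S.exists_isTransition Φ Φ hz hz rfl
    rw [hF' Φ z hz Φ hΦ _ _ _ _ T hzW, ← hF.eq_act _ hΦ _ hΦ _ _ _ _ T z hzW]

variable [T2Space B]

/-- Extension by zero of a compactly supported field in one chart, which has to be invariant under
the rotations by `a`-th roots of unity. -/
lemma exists_isSection_extend_zero {𝒩 : NaturalAction V}
    (h0 : ∀ ε A l, 𝒩.act ε A l 0 = 0) (Φ₀ : S.Chart) {s : ℂ → V} {r : ℝ} (hr0 : 0 ≤ r) (hr : r < 1)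
    (hs : ContDiffOn ℝ ∞ s (Metric.ball 0 1)) (hsupp : ∀ z, r < ‖z‖ → s z = 0)
    (hrot : ∀ k : ℤ, ∀ z ∈ Metric.ball (0 : ℂ) 1, s z =
      𝒩.act 1 (rootOfUnityPow Φ₀.1.mult k • ContinuousLinearMap.id ℝ ℂ) 0
        (s (rootOfUnityPow Φ₀.1.mult k * z))) :
    ∃ F : S.Chart → ℂ → V, S.IsSection 𝒩 univ F ∧
      (∀ z ∈ Metric.ball (0 : ℂ) 1, F Φ₀ z = s z) ∧
      ∀ Ψ : S.Chart, ∀ z ∈ Metric.ball (0 : ℂ) 1,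
        Ψ.1.base z ∉ Φ₀.1.base '' Metric.closedBall 0 r → F Ψ z = 0 := by
  classical
  set K := Φ₀.1.base '' Metric.closedBall 0 r with hK
  have hKc : IsClosed K := S.isClosed_image_base Φ₀ hr
  -- the field is prescribed in `Φ₀` and in the charts disjoint from its support; a self-transition of
  -- `Φ₀` is a rotation, and this is where the invariance enters
  set C : Set S.Chart := {Φ₀} ∪ {Ψ | ∀ z ∈ Metric.ball (0 : ℂ) 1, Ψ.1.base z ∉ K} with hC
  set F₀ : S.Chart → ℂ → V := fun Ψ => if Ψ = Φ₀ then s else 0 with hF₀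
  have hΦ₀ : ¬ ∀ z ∈ Metric.ball (0 : ℂ) 1, Φ₀.1.base z ∉ K := by
    intro h
    exact h 0 (by simp) ⟨0, by simpa using hr0, rfl⟩
  have hne : ∀ {Ψ : S.Chart}, (∀ z ∈ Metric.ball (0 : ℂ) 1, Ψ.1.base z ∉ K) → F₀ Ψ = 0 := by
    intro Ψ hΨ
    simp only [hF₀]
    rw [if_neg]
    rintro rfl
    exact hΦ₀ hΨ
  have hself : F₀ Φ₀ = s := by simp [hF₀]
  have hout : ∀ z ∈ Metric.ball (0 : ℂ) 1, Φ₀.1.base z ∉ K → s z = 0 := by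
    intro z hz hzK
    refine hsupp z (lt_of_not_ge fun hle => hzK ⟨z, by simpa using hle, rfl⟩)
  have hsec : S.IsSection 𝒩 C F₀ := by
    refine ⟨?_, ?_⟩
    · rintro Φ (rfl | hΦ)
      · rwa [hself]
      · rw [hne hΦ]; exact contDiffOn_const
    · rintro Φ (rfl | hΦ) Ψ (rfl | hΨ) W τ h ε T z hz
      · obtain ⟨rfl, hh, k, hk⟩ := T.self_eq hz
        have hfd : fderiv ℝ τ z = rootOfUnityPow Ψ.1.mult k • ContinuousLinearMap.id ℝ ℂ := by
          have hk' : τ =ᶠ[𝓝 z] fun z' => rootOfUnityPow Ψ.1.mult k * z' := hk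
          rw [hk'.fderiv_eq]
          exact ((hasFDerivAt_id z).const_mul _).fderiv
        rw [hself, hh, hfd, hk.self_of_nhds]
        exact hrot k z (T.subset hz)
      · rw [hne hΨ, hself, Pi.zero_apply, h0]
        refine hout z (T.subset hz) ?_
        rw [T.base_eq hz]
        exact hΨ _ (T.mapsTo hz)
      · rw [hne hΦ, hself, Pi.zero_apply, hout _ (T.mapsTo hz), h0]
        rw [← T.base_eq hz]
        exact hΦ _ (T.subset hz)
      · rw [hne hΦ, hne hΨ, Pi.zero_apply, Pi.zero_apply, h0]
  have hcov : ∀ b : B, b ∉ K → ∃ Φ : S.Chart, Φ.1.base 0 = b ∧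
      ∀ z ∈ Metric.ball (0 : ℂ) 1, Φ.1.base z ∉ K := fun b hb =>
    S.exists_chart_base_zero hKc.isOpen_compl hb
  obtain ⟨F, hF, hFC⟩ := hsec.exists_extension (by
    intro b
    by_cases hb : b ∈ K
    · obtain ⟨z, hz, rfl⟩ := hb
      exact ⟨Φ₀, Or.inl rfl, z, Metric.closedBall_subset_ball hr hz, rfl⟩
    · obtain ⟨Φ, h1, h2⟩ := hcov b hb
      exact ⟨Φ, Or.inr h2, 0, by simp, h1⟩)
  refine ⟨F, hF, fun z hz => by rw [hFC Φ₀ (Or.inl rfl) z hz, hself], ?_⟩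
  intro Ψ z hz hzK
  obtain ⟨Φ, h1, h2⟩ := hcov _ hzK
  obtain ⟨W, τ, h, ε, T, hzW, hτz⟩ := S.exists_isTransition Ψ Φ hz (by simp) h1.symm
  rw [hF.eq_act _ trivial _ trivial _ _ _ _ T z hzW, hτz, hFC Φ (Or.inr h2) 0 (by simp), hne h2,
    Pi.zero_apply, h0]

end SeifertFibration

/-! ### Exterior derivatives of one-forms -/

section ExteriorDerivative

variable {E F : Type*} [NormedAddCommGroup E] [NormedSpace ℝ E] [NormedAddCommGroup F]
  [NormedSpace ℝ F]

/-- The exterior derivative `dη_x(u, v)` of a `1`-form on a normed space. -/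
noncomputable def extd (η : E → E →L[ℝ] ℝ) (x u v : E) : ℝ :=
  fderiv ℝ η x u v - fderiv ℝ η x v u

lemma extd_congr {η η' : E → E →L[ℝ] ℝ} {x : E} (h : η =ᶠ[𝓝 x] η') (u v : E) :
    extd η x u v = extd η' x u v := by
  simp only [extd, h.fderiv_eq]

lemma extd_add {η η' : E → E →L[ℝ] ℝ} {x : E} (h : DifferentiableAt ℝ η x)
    (h' : DifferentiableAt ℝ η' x) (u v : E) :
    extd (fun y => η y + η' y) x u v = extd η x u v + extd η' x u v := by
  simp only [extd, fderiv_fun_add h h', _root_.add_apply]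
  ring

lemma extd_const_smul {η : E → E →L[ℝ] ℝ} {x : E} (h : DifferentiableAt ℝ η x) (c : ℝ) (u v : E) :
    extd (fun y => c • η y) x u v = c * extd η x u v := by
  simp only [extd, fderiv_fun_const_smul h, _root_.smul_apply, smul_eq_mul]
  ring

lemma extd_smul {η : E → E →L[ℝ] ℝ} {f : E → ℝ} {x : E} (h : DifferentiableAt ℝ η x)
    (hf : DifferentiableAt ℝ f x) (u v : E) :
    extd (fun y => f y • η y) x u v =
      f x * extd η x u v + (fderiv ℝ f x u * η x v - fderiv ℝ f x v * η x u) := by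
  simp only [extd, fderiv_fun_smul hf h, _root_.add_apply,
    _root_.smul_apply, smul_eq_mul, ContinuousLinearMap.smulRight_apply]
  ring

lemma extd_pullback {η : F → F →L[ℝ] ℝ} {f : E → F} {x : E} (hη : DifferentiableAt ℝ η (f x))
    (hf : ContDiffAt ℝ ∞ f x) (u v : E) :
    extd (fun y => (η (f y)).comp (fderiv ℝ f y)) x u v =
      extd η (f x) (fderiv ℝ f x u) (fderiv ℝ f x v) := by
  have h1 : HasFDerivAt f (fderiv ℝ f x) x := (hf.differentiableAt (by simp)).hasFDerivAt
  have h2 : HasFDerivAt (fun y => η (f y)) ((fderiv ℝ η (f x)).comp (fderiv ℝ f x)) x :=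
    hη.hasFDerivAt.comp x h1
  have h3 : HasFDerivAt (fderiv ℝ f) (fderiv ℝ (fderiv ℝ f) x) x :=
    ((hf.fderiv_right (m := 1) (by norm_cast)).differentiableAt (by simp)).hasFDerivAt
  have hsymm : fderiv ℝ (fderiv ℝ f) x u v = fderiv ℝ (fderiv ℝ f) x v u :=
    (hf.isSymmSndFDerivAt (by
      rw [minSmoothness_of_isRCLikeNormedField]
      exact WithTop.coe_le_coe.2 (le_top : (2 : ℕ∞) ≤ ⊤))).eq u v
  simp only [extd, (h2.clm_comp h3).fderiv]
  simp [hsymm]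

lemma extd_fderiv {f : E → ℝ} {x : E} (hf : ContDiffAt ℝ ∞ f x) (u v : E) :
    extd (fderiv ℝ f) x u v = 0 := by
  have hsymm : fderiv ℝ (fderiv ℝ f) x u v = fderiv ℝ (fderiv ℝ f) x v u :=
    (hf.isSymmSndFDerivAt (by
      rw [minSmoothness_of_isRCLikeNormedField]
      exact WithTop.coe_le_coe.2 (le_top : (2 : ℕ∞) ≤ ⊤))).eq u v
  simp [extd, hsymm]

end ExteriorDerivative

/-- The coefficient of `dx ∧ dy` in the exterior derivative of a `1`-form on `ℂ`. -/
noncomputable def curl (η : ℂ → ℂ →L[ℝ] ℝ) (z : ℂ) : ℝ := extd η z 1 Complex.I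

lemma extd_eq_det_mul_curl (η : ℂ → ℂ →L[ℝ] ℝ) (z : ℂ) (A : ℂ →L[ℝ] ℂ) :
    extd η z (A 1) (A Complex.I) = A.det * curl η z := by
  rw [complex_det_eq]
  have h1 : ∀ w : ℂ, w = w.re • (1 : ℂ) + w.im • Complex.I := fun w => by simp
  conv_lhs => rw [h1 (A 1), h1 (A Complex.I)]
  simp only [curl, extd, map_add, map_smul, _root_.add_apply,
    _root_.smul_apply, smul_eq_mul]
  ring

lemma contDiffAt_curl {η : ℂ → ℂ →L[ℝ] ℝ} {z : ℂ} (h : ContDiffAt ℝ ∞ η z) :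
    ContDiffAt ℝ ∞ (curl η) z := by
  have h1 : ContDiffAt ℝ ∞ (fderiv ℝ η) z := h.fderiv_right (by simp)
  exact ((h1.clm_apply contDiffAt_const).clm_apply contDiffAt_const).sub
    ((h1.clm_apply contDiffAt_const).clm_apply contDiffAt_const)

lemma contDiffOn_curl {η : ℂ → ℂ →L[ℝ] ℝ} {U : Set ℂ} (hU : IsOpen U) (h : ContDiffOn ℝ ∞ η U) :
    ContDiffOn ℝ ∞ (curl η) U := fun _ hz =>
  (contDiffAt_curl (h.contDiffAt (hU.mem_nhds hz))).contDiffWithinAt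

lemma ContDiffOn.differentiableAt_of_isOpen {E F : Type*} [NormedAddCommGroup E] [NormedSpace ℝ E]
    [NormedAddCommGroup F] [NormedSpace ℝ F] {f : E → F} {U : Set E} (h : ContDiffOn ℝ ∞ f U)
    (hU : IsOpen U) {x : E} (hx : x ∈ U) : DifferentiableAt ℝ f x :=
  (h.contDiffAt (hU.mem_nhds hx)).differentiableAt (by simp)

/-- Functions, as natural fields. -/
noncomputable def functionAction : NaturalAction ℝ where
  act _ _ _ v := v
  act_comp _ _ _ _ _ _ _ _ := rfl
  injective _ _ _ _ _ := Function.injective_id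
  contDiff _ := contDiff_snd.comp contDiff_snd

/-- A radial bump function, with support the disc of radius `1 / 2`. -/
noncomputable def radialBump (z : ℂ) : ℝ := Real.smoothTransition ((1 / 4 - ‖z‖ ^ 2) * (16 / 3))

lemma contDiff_radialBump : ContDiff ℝ ∞ radialBump :=
  Real.smoothTransition.contDiff.comp ((contDiff_const.sub (contDiff_norm_sq ℝ)).mul contDiff_const)

lemma radialBump_nonneg (z : ℂ) : 0 ≤ radialBump z := Real.smoothTransition.nonneg _

lemma radialBump_pos {z : ℂ} (hz : ‖z‖ < 1 / 2) : 0 < radialBump z := by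
  apply Real.smoothTransition.pos_of_pos
  nlinarith [norm_nonneg z]

lemma radialBump_eq_zero {z : ℂ} (hz : 1 / 2 ≤ ‖z‖) : radialBump z = 0 := by
  apply Real.smoothTransition.zero_of_nonpos
  nlinarith [norm_nonneg z]

lemma radialBump_eq_one {z : ℂ} (hz : ‖z‖ ≤ 1 / 4) : radialBump z = 1 := by
  apply Real.smoothTransition.one_of_one_le
  nlinarith [norm_nonneg z]

lemma radialBump_rootOfUnityPow_mul (a : ℕ) (k : ℤ) (z : ℂ) :
    radialBump (rootOfUnityPow a k * z) = radialBump z := by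
  simp [radialBump, FiberedChart.rootOfUnityPow_norm]

lemma det_rootOfUnityPow_smul_id (a : ℕ) (k : ℤ) :
    (rootOfUnityPow a k • ContinuousLinearMap.id ℝ ℂ).det = 1 := by
  have h1 : Complex.normSq (rootOfUnityPow a k) = 1 := by
    rw [Complex.normSq_eq_norm_sq, FiberedChart.rootOfUnityPow_norm, one_pow]
  rw [complex_det_eq, ← h1, Complex.normSq_apply]
  simp

namespace SeifertFibration

open FiberedChart

variable {M B : Type*} [TopologicalSpace M] [ChartedSpace E3 M] [TopologicalSpace B]
  {S : SeifertFibration M B}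

/-! ### Operations on natural fields -/

lemma IsSection.add_form {c c' : ℝ} {C : Set S.Chart} {l l' : S.Chart → ℂ → ℂ →L[ℝ] ℝ}
    (h : S.IsSection (formAction c) C l) (h' : S.IsSection (formAction c') C l') :
    S.IsSection (formAction (c + c')) C fun Φ z => l Φ z + l' Φ z where
  contDiffOn Φ hΦ := (h.contDiffOn Φ hΦ).add (h'.contDiffOn Φ hΦ)
  eq_act Φ hΦ Ψ hΨ W τ g ε T z hz := by
    rw [h.eq_act Φ hΦ Ψ hΨ W τ g ε T z hz, h'.eq_act Φ hΦ Ψ hΨ W τ g ε T z hz]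
    ext v
    simp [formAction]
    ring

lemma IsSection.const_smul_form {c : ℝ} {C : Set S.Chart} {l : S.Chart → ℂ → ℂ →L[ℝ] ℝ}
    (h : S.IsSection (formAction c) C l) (a : ℝ) :
    S.IsSection (formAction (a * c)) C fun Φ z => a • l Φ z where
  contDiffOn Φ hΦ := (h.contDiffOn Φ hΦ).const_smul a
  eq_act Φ hΦ Ψ hΨ W τ g ε T z hz := by
    rw [h.eq_act Φ hΦ Ψ hΨ W τ g ε T z hz]
    ext v
    simp [formAction]
    ring

variable (S) in
/-- A smooth function on the base, as an orbifold. -/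
def IsSmooth (u : B → ℝ) : Prop :=
  ∀ Φ : S.Chart, ContDiffOn ℝ ∞ (fun z => u (Φ.1.base z)) (Metric.ball 0 1)

lemma IsSmooth.sub {u v : B → ℝ} (hu : S.IsSmooth u) (hv : S.IsSmooth v) :
    S.IsSmooth fun b => u b - v b := fun Φ => (hu Φ).sub (hv Φ)

lemma IsSmooth.mul {u v : B → ℝ} (hu : S.IsSmooth u) (hv : S.IsSmooth v) :
    S.IsSmooth fun b => u b * v b := fun Φ => (hu Φ).mul (hv Φ)

lemma isSmooth_const (c : ℝ) : S.IsSmooth fun _ => c := fun _ => contDiffOn_const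

lemma IsSmooth.sum {ι : Type*} {t : Finset ι} {u : ι → B → ℝ} (hu : ∀ i ∈ t, S.IsSmooth (u i)) :
    S.IsSmooth fun b => ∑ i ∈ t, u i b := fun Φ => ContDiffOn.sum fun i hi => hu i hi Φ

lemma IsSection.smul_form {C : Set S.Chart} {l : S.Chart → ℂ → ℂ →L[ℝ] ℝ}
    (h : S.IsSection (formAction 0) C l) {u : B → ℝ} (hu : S.IsSmooth u) :
    S.IsSection (formAction 0) C fun Φ z => u (Φ.1.base z) • l Φ z where
  contDiffOn Φ hΦ := (hu Φ).smul (h.contDiffOn Φ hΦ)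
  eq_act Φ hΦ Ψ hΨ W τ g ε T z hz := by
    rw [h.eq_act Φ hΦ Ψ hΨ W τ g ε T z hz, T.base_eq hz]
    ext v
    simp [formAction]
    ring

lemma IsSection.sum_density {ι : Type*} {t : Finset ι} {C : Set S.Chart} {g : ι → S.Chart → ℂ → ℝ}
    (h : ∀ i ∈ t, S.IsSection densityAction C (g i)) :
    S.IsSection densityAction C fun Φ z => ∑ i ∈ t, g i Φ z where
  contDiffOn Φ hΦ := ContDiffOn.sum fun i hi => (h i hi).contDiffOn Φ hΦ
  eq_act Φ hΦ Ψ hΨ W τ f ε T z hz := by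
    simp only [densityAction, Finset.mul_sum]
    exact Finset.sum_congr rfl fun i hi => (h i hi).eq_act Φ hΦ Ψ hΨ W τ f ε T z hz

/-- The curvature of a connection, and the exterior derivative of a `1`-form with values in the
local system of fiber orientations, are densities on the base. -/
lemma IsSection.curl {c : ℝ} {C : Set S.Chart} {l : S.Chart → ℂ → ℂ →L[ℝ] ℝ}
    (h : S.IsSection (formAction c) C l) :
    S.IsSection densityAction C fun Φ z => curl (l Φ) z where
  contDiffOn Φ hΦ := contDiffOn_curl Metric.isOpen_ball (h.contDiffOn Φ hΦ)
  eq_act Φ hΦ Ψ hΨ W τ f ε T z hz := by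
    have hev : l Φ =ᶠ[𝓝 z] fun y =>
        ε • ((l Ψ (τ y)).comp (fderiv ℝ τ y) + c • fderiv ℝ f y) := by
      filter_upwards [T.mem_nhds hz] with y hy
      exact h.eq_act Φ hΦ Ψ hΨ W τ f ε T y hy
    have dl : DifferentiableAt ℝ (l Ψ) (τ z) :=
      (h.contDiffOn Ψ hΨ).differentiableAt_of_isOpen Metric.isOpen_ball (T.mapsTo hz)
    have dτ : DifferentiableAt ℝ (fderiv ℝ τ) z :=
      (((T.contDiffAt_base hz).fderiv_right (m := 1) (by norm_cast)).differentiableAt (by simp))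
    have df : DifferentiableAt ℝ (fderiv ℝ f) z :=
      (((T.contDiffAt_shift hz).fderiv_right (m := 1) (by norm_cast)).differentiableAt (by simp))
    have d1 : DifferentiableAt ℝ (fun y => (l Ψ (τ y)).comp (fderiv ℝ τ y)) z :=
      (dl.comp z (T.hasFDerivAt_base hz).differentiableAt).clm_comp dτ
    have d2 : DifferentiableAt ℝ (fun y => c • fderiv ℝ f y) z := df.const_smul c
    simp only [densityAction, _root_.curl]
    rw [extd_congr hev, extd_const_smul (d1.fun_add d2), extd_add d1 d2, extd_const_smul df,
      extd_fderiv (T.contDiffAt_shift hz), extd_pullback dl (T.contDiffAt_base hz),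
      extd_eq_det_mul_curl, _root_.curl]
    ring

/-! ### Functions on the base -/

variable [IsManifold (𝓡 3) ∞ M]

lemma IsSection.exists_function {F : S.Chart → ℂ → ℝ} (hF : S.IsSection functionAction univ F) :
    ∃ u : B → ℝ, ∀ Φ : S.Chart, ∀ z ∈ Metric.ball (0 : ℂ) 1, u (Φ.1.base z) = F Φ z := by
  have : ∀ b : B, ∃ v : ℝ, ∀ Φ : S.Chart, ∀ z ∈ Metric.ball (0 : ℂ) 1, Φ.1.base z = b →
      v = F Φ z := by
    intro b
    obtain ⟨Φ, h1, -⟩ := S.exists_chart_base_zero isOpen_univ (mem_univ b)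
    refine ⟨F Φ 0, fun Ψ z hz hb => ?_⟩
    obtain ⟨W, τ, h, ε, T, hzW, hτz⟩ := S.exists_isTransition Φ Ψ (by simp) hz (h1.trans hb.symm)
    rw [hF.eq_act _ trivial _ trivial _ _ _ _ T 0 hzW, hτz]
    rfl
  choose u hu using this
  exact ⟨u, fun Φ z hz => hu _ Φ z hz rfl⟩

omit [IsManifold (𝓡 3) ∞ M] in
lemma isSmooth_of_eq {F : S.Chart → ℂ → ℝ} (hF : ∀ Φ, ContDiffOn ℝ ∞ (F Φ) (Metric.ball 0 1))
    {u : B → ℝ} (hu : ∀ Φ : S.Chart, ∀ z ∈ Metric.ball (0 : ℂ) 1, u (Φ.1.base z) = F Φ z) :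
    S.IsSmooth u := fun Φ => (hF Φ).congr (hu Φ)

/-- The quotient of two densities is a smooth function on the base. -/
lemma IsSection.exists_ratio {g ρ : S.Chart → ℂ → ℝ} (hg : S.IsSection densityAction univ g)
    (hρ : S.IsSection densityAction univ ρ)
    (hpos : ∀ Φ, ∀ z ∈ Metric.ball (0 : ℂ) 1, 0 < ρ Φ z) :
    ∃ u : B → ℝ, S.IsSmooth u ∧ ∀ Φ : S.Chart, ∀ z ∈ Metric.ball (0 : ℂ) 1,
      u (Φ.1.base z) * ρ Φ z = g Φ z := by
  have hsm : ∀ Φ : S.Chart, ContDiffOn ℝ ∞ (fun z => g Φ z / ρ Φ z) (Metric.ball 0 1) := fun Φ =>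
    (hg.contDiffOn Φ trivial).div (hρ.contDiffOn Φ trivial) fun z hz => (hpos Φ z hz).ne'
  have hF : S.IsSection functionAction univ fun Φ z => g Φ z / ρ Φ z := by
    refine ⟨fun Φ _ => hsm Φ, ?_⟩
    intro Φ _ Ψ _ W τ h ε T z hz
    rw [hg.eq_act _ trivial _ trivial _ _ _ _ T z hz, hρ.eq_act _ trivial _ trivial _ _ _ _ T z hz]
    have h1 := (T.det_pos z hz).ne'
    simp only [densityAction, functionAction]
    rw [mul_div_mul_left _ _ h1]
  obtain ⟨u, hu⟩ := hF.exists_function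
  refine ⟨u, isSmooth_of_eq hsm hu, fun Φ z hz => ?_⟩
  rw [hu Φ z hz, div_mul_cancel₀ _ (hpos Φ z hz).ne']

variable [T2Space B]

/-- The radial bump function of a chart, as a smooth function on the base. -/
lemma exists_bump (Φ₀ : S.Chart) : ∃ u : B → ℝ, S.IsSmooth u ∧ (∀ b, 0 ≤ u b) ∧
    (∀ z ∈ Metric.ball (0 : ℂ) 1, u (Φ₀.1.base z) = radialBump z) ∧
    ∀ b, b ∉ Φ₀.1.base '' Metric.closedBall 0 (1 / 2) → u b = 0 := by
  obtain ⟨F, hF, h1, h2⟩ := exists_isSection_extend_zero (𝒩 := functionAction) (fun _ _ _ => rfl) Φ₀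
    (s := radialBump) (r := 1 / 2) (by norm_num) (by norm_num) contDiff_radialBump.contDiffOn
    (fun z hz => radialBump_eq_zero hz.le)
    (fun k z _ => (radialBump_rootOfUnityPow_mul _ _ _).symm)
  obtain ⟨u, hu⟩ := hF.exists_function
  have h3 : ∀ z ∈ Metric.ball (0 : ℂ) 1, u (Φ₀.1.base z) = radialBump z := fun z hz => by
    rw [hu Φ₀ z hz, h1 z hz]
  have h4 : ∀ b, b ∉ Φ₀.1.base '' Metric.closedBall 0 (1 / 2) → u b = 0 := by
    intro b hb
    obtain ⟨Ψ, -, z, hz, rfl⟩ := S.exists_base_eq b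
    obtain ⟨Φ, hΦ, -⟩ := S.exists_chart_base_zero isOpen_univ (mem_univ (Ψ.base z))
    rw [← hΦ] at hb ⊢
    rw [hu Φ 0 (by simp), h2 Φ 0 (by simp) hb]
  refine ⟨u, isSmooth_of_eq (fun Φ => hF.contDiffOn Φ trivial) hu, fun b => ?_, h3, h4⟩
  by_cases hb : b ∈ Φ₀.1.base '' Metric.closedBall 0 (1 / 2)
  · obtain ⟨z, hz, rfl⟩ := hb
    rw [h3 z (Metric.closedBall_subset_ball (by norm_num) hz)]
    exact radialBump_nonneg z
  · rw [h4 b hb]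

/-- The bump density of a chart. -/
lemma exists_bump_density (Φ₀ : S.Chart) : ∃ g : S.Chart → ℂ → ℝ,
    S.IsSection densityAction univ g ∧ (∀ Ψ, ∀ z ∈ Metric.ball (0 : ℂ) 1, 0 ≤ g Ψ z) ∧
    ∀ Ψ : S.Chart, ∀ z ∈ Metric.ball (0 : ℂ) 1,
      Ψ.1.base z ∈ Φ₀.1.base '' Metric.ball 0 (1 / 2) → 0 < g Ψ z := by
  obtain ⟨F, hF, h1, h2⟩ := exists_isSection_extend_zero (𝒩 := densityAction)
    (fun _ _ _ => mul_zero _) Φ₀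
    (s := radialBump) (r := 1 / 2) (by norm_num) (by norm_num) contDiff_radialBump.contDiffOn
    (fun z hz => radialBump_eq_zero hz.le)
    (fun k z _ => by
      simp only [densityAction, det_rootOfUnityPow_smul_id, radialBump_rootOfUnityPow_mul, one_mul])
  have key : ∀ Ψ : S.Chart, ∀ z ∈ Metric.ball (0 : ℂ) 1, ∀ z' ∈ Metric.ball (0 : ℂ) 1,
      Φ₀.1.base z' = Ψ.1.base z → ∃ c > 0, F Ψ z = c * radialBump z' := by
    intro Ψ z hz z' hz' hb
    obtain ⟨W, τ, h, ε, T, hzW, rfl⟩ := S.exists_isTransition Ψ Φ₀ hz hz' hb.symm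
    refine ⟨_, T.det_pos z hzW, ?_⟩
    rw [hF.eq_act _ trivial _ trivial _ _ _ _ T z hzW, h1 _ hz']
    rfl
  refine ⟨F, hF, fun Ψ z hz => ?_, fun Ψ z hz hzb => ?_⟩
  · by_cases hb : Ψ.1.base z ∈ Φ₀.1.base '' Metric.closedBall 0 (1 / 2)
    · obtain ⟨z', hz', hb'⟩ := hb
      obtain ⟨c, hc, he⟩ := key Ψ z hz z' (Metric.closedBall_subset_ball (by norm_num) hz') hb'
      rw [he]
      exact mul_nonneg hc.le (radialBump_nonneg _)
    · rw [h2 Ψ z hz hb]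
  · obtain ⟨z', hz', hb'⟩ := hzb
    obtain ⟨c, hc, he⟩ := key Ψ z hz z' (Metric.ball_subset_ball (by norm_num) hz') hb'
    rw [he]
    exact mul_pos hc (radialBump_pos (by simpa using hz'))

variable [CompactSpace M]

lemma continuous_of_isSmooth {u : B → ℝ} (hu : S.IsSmooth u) : Continuous u := by
  rw [continuous_iff_continuousAt]
  intro b
  obtain ⟨Φ, rfl, -⟩ := S.exists_chart_base_zero isOpen_univ (mem_univ b)
  intro N hN
  have h1 : ContinuousAt (fun z => u (Φ.1.base z)) 0 :=
    ((hu Φ).continuousOn).continuousAt (Metric.isOpen_ball.mem_nhds (by simp))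
  have h2 := S.image_base_mem_nhds Φ (z := 0) (by simp) (h1 hN)
  refine Filter.mem_map.2 (mem_of_superset h2 ?_)
  rintro _ ⟨z, hz, rfl⟩
  exact hz

omit [IsManifold (𝓡 3) ∞ M] in
/-- Finitely many half-discs of charts cover the base. -/
lemma exists_finset_cover (Φ : B → S.Chart) (hΦ : ∀ b, (Φ b).1.base 0 = b) :
    ∃ t : Finset B, ∀ b : B, ∃ i ∈ t, b ∈ (Φ i).1.base '' Metric.ball 0 (1 / 2) := by
  have := S.compactSpace_base
  obtain ⟨t, ht⟩ := CompactSpace.elim_nhds_subcover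
    (fun b => (Φ b).1.base '' Metric.ball 0 (1 / 2)) (fun b => by
      have := S.image_base_mem_nhds (Φ b) (z := 0) (by simp)
        (Metric.ball_mem_nhds (0 : ℂ) (by norm_num : (0 : ℝ) < 1 / 2))
      rwa [hΦ] at this)
  refine ⟨t, fun b => ?_⟩
  have hb : b ∈ ⋃ x ∈ t, (Φ x).1.base '' Metric.ball 0 (1 / 2) := ht ▸ mem_univ b
  simpa using hb

/-- A smooth partition of unity on the base. -/
lemma exists_partitionOfUnity (Φ : B → S.Chart) (hΦ : ∀ b, (Φ b).1.base 0 = b) :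
    ∃ (t : Finset B) (χ : B → B → ℝ), (∀ i, S.IsSmooth (χ i)) ∧
      (∀ i b, b ∉ (Φ i).1.base '' Metric.closedBall 0 (1 / 2) → χ i b = 0) ∧
      ∀ b, ∑ i ∈ t, χ i b = 1 := by
  obtain ⟨t, ht⟩ := exists_finset_cover Φ hΦ
  choose β h1 h2 h3 h4 using fun b => exists_bump (Φ b)
  have hpos : ∀ b, 0 < ∑ i ∈ t, β i b := by
    intro b
    obtain ⟨i, hi, z, hz, rfl⟩ := ht b
    refine Finset.sum_pos' (fun i _ => h2 i _) ⟨i, hi, ?_⟩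
    rw [h3 i z (Metric.ball_subset_ball (by norm_num) hz)]
    exact radialBump_pos (by simpa using hz)
  refine ⟨t, fun i b => β i b / ∑ j ∈ t, β j b, fun i Ψ => ?_, fun i b hb => ?_, fun b => ?_⟩
  · exact (h1 i Ψ).div (IsSmooth.sum (t := t) (fun j _ => h1 j) Ψ) fun z _ => (hpos _).ne'
  · simp [h4 i b hb]
  · rw [← Finset.sum_div, div_self (hpos b).ne']

variable (S) in
/-- The base carries a smooth positive density. -/
lemma exists_density : ∃ ρ : S.Chart → ℂ → ℝ, S.IsSection densityAction univ ρ ∧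
    ∀ Ψ, ∀ z ∈ Metric.ball (0 : ℂ) 1, 0 < ρ Ψ z := by
  choose Φ hΦ _ using fun b : B => S.exists_chart_base_zero isOpen_univ (mem_univ b)
  obtain ⟨t, ht⟩ := exists_finset_cover Φ hΦ
  choose g h1 h2 h3 using fun b => exists_bump_density (Φ b)
  refine ⟨fun Ψ z => ∑ i ∈ t, g i Ψ z, IsSection.sum_density fun i _ => h1 i, fun Ψ z hz => ?_⟩
  obtain ⟨i, hi, hb⟩ := ht (Ψ.1.base z)
  exact Finset.sum_pos' (fun i _ => h2 i Ψ z hz) ⟨i, hi, h3 i Ψ z hz hb⟩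

end SeifertFibration

/-! ### The invariant measure of a density -/

lemma setLIntegral_eq_inter_of_eq_zero {α : Type*} [MeasurableSpace α] {μ : Measure α} {s t : Set α}
    {f : α → ENNReal} (hs : MeasurableSet s) (ht : MeasurableSet t)
    (h : ∀ x ∈ s, x ∉ t → f x = 0) : ∫⁻ x in s, f x ∂μ = ∫⁻ x in s ∩ t, f x ∂μ := by
  rw [← lintegral_indicator hs, ← lintegral_indicator (hs.inter ht)]
  congr 1
  ext x
  by_cases hxs : x ∈ s <;> by_cases hxt : x ∈ t <;> simp [hxs, hxt]
  exact h x hxs hxt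

namespace FiberedChart

variable {M B : Type*} [TopologicalSpace M] [ChartedSpace E3 M] {p : M → B}

/-- A fundamental domain of the universal covering of a fibered solid torus. -/
def fundamentalDomain (Φ : FiberedChart p) : Set (ℂ × ℝ) :=
  Metric.ball 0 1 ×ˢ Ico 0 (2 * Real.pi / Φ.mult)

lemma measurableSet_fundamentalDomain (Φ : FiberedChart p) :
    MeasurableSet Φ.fundamentalDomain := measurableSet_ball.prod measurableSet_Ico

lemma fundamentalDomain_subset (Φ : FiberedChart p) : Φ.fundamentalDomain ⊆ solidTorusCover :=
  fun _ hw => mem_solidTorusCover.2 hw.1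

/-- The covering `D² × ℝ → (D² × S¹) / (ℤ/aℤ)` is injective on sets of height less than `2π / a`. -/
lemma eq_of_map_eq (Φ : FiberedChart p) {w w' : ℂ × ℝ} (hw : w ∈ solidTorusCover)
    (hw' : w' ∈ solidTorusCover) (hlt : |w'.2 - w.2| < 2 * Real.pi / Φ.mult)
    (h : Φ.map w = Φ.map w') : w = w' := by
  obtain ⟨k, n, h1, h2⟩ := (Φ.map_eq_iff w hw w' hw').1 h
  have ha := Φ.mult_cast_pos
  have hpi := Real.pi_pos
  have h3 : w'.2 - w.2 = 2 * Real.pi / Φ.mult * ((k * Φ.twist + n * Φ.mult : ℤ) : ℝ) := by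
    rw [h2]
    push_cast
    field_simp
    ring
  have hc : 0 < 2 * Real.pi / (Φ.mult : ℝ) := by positivity
  have h4 : (k * Φ.twist + n * Φ.mult : ℤ) = 0 := by
    rw [h3, abs_mul, abs_of_pos hc, ← Int.cast_abs] at hlt
    have h5 : ((|k * Φ.twist + n * Φ.mult| : ℤ) : ℝ) < 1 := by
      by_contra! hge
      nlinarith
    exact Int.abs_lt_one_iff.1 (by exact_mod_cast h5)
  have h5 : (Φ.mult : ℤ) ∣ k :=
    Φ.coprime.dvd_of_dvd_mul_right ⟨-n, by linarith⟩
  rw [(rootOfUnityPow_eq_one_iff Φ.mult_pos k).2 h5, one_mul] at h1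
  rw [h4] at h3
  simp only [Int.cast_zero, mul_zero] at h3
  exact Prod.ext h1.symm (by linarith)

lemma injOn_fundamentalDomain (Φ : FiberedChart p) : InjOn Φ.map Φ.fundamentalDomain := by
  intro w hw w' hw' h
  refine Φ.eq_of_map_eq (Φ.fundamentalDomain_subset hw) (Φ.fundamentalDomain_subset hw') ?_ h
  have h1 := hw.2
  have h2 := hw'.2
  rw [mem_Ico] at h1 h2
  rw [abs_lt]
  constructor <;> linarith [h1.1, h1.2, h2.1, h2.2]

lemma exists_mem_fundamentalDomain (Φ : FiberedChart p) {w : ℂ × ℝ} (hw : w ∈ solidTorusCover) :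
    ∃ w' ∈ Φ.fundamentalDomain, Φ.map w' = Φ.map w := by
  have ha := Φ.mult_cast_pos
  have hpi := Real.pi_pos
  set c := 2 * Real.pi / (Φ.mult : ℝ) with hc
  have hcpos : 0 < c := by positivity
  obtain ⟨u, v, huv⟩ := Φ.coprime
  set m : ℤ := -⌊w.2 / c⌋ with hm
  have hk : (m * v) * Φ.twist + (m * u) * Φ.mult = m := by
    linear_combination m * huv
  have hz : rootOfUnityPow Φ.mult (m * v) * w.1 ∈ Metric.ball (0 : ℂ) 1 := by
    rw [mem_ball_zero_iff, norm_mul, rootOfUnityPow_norm, one_mul]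
    simpa using mem_solidTorusCover.1 hw
  refine ⟨(rootOfUnityPow Φ.mult (m * v) * w.1, w.2 + c * m), ⟨hz, ?_⟩, ?_⟩
  · have h1 := Int.floor_le (w.2 / c)
    have h2 := Int.lt_floor_add_one (w.2 / c)
    rw [le_div_iff₀ hcpos] at h1
    rw [div_lt_iff₀ hcpos] at h2
    rw [mem_Ico, hm]
    push_cast
    constructor <;> linarith
  · refine ((Φ.map_eq_iff w hw _ (mk_mem_solidTorusCover hz)).2 ⟨m * v, m * u, rfl, ?_⟩).symm
    simp only
    have : (m : ℝ) = (m * v) * Φ.twist + (m * u) * Φ.mult := by exact_mod_cast hk.symm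
    rw [hc]
    conv_lhs => rw [this]
    push_cast
    field_simp
    ring

/-- The box `{|z| < 1/2, |θ - θ₀| < π / a}`, on which a fibered chart is injective. -/
def box (Φ : FiberedChart p) (θ₀ : ℝ) : Set (ℂ × ℝ) :=
  Metric.ball 0 (1 / 2) ×ˢ Ioo (θ₀ - Real.pi / Φ.mult) (θ₀ + Real.pi / Φ.mult)

lemma isOpen_box (Φ : FiberedChart p) (θ₀ : ℝ) : IsOpen (Φ.box θ₀) :=
  Metric.isOpen_ball.prod isOpen_Ioo

lemma box_subset (Φ : FiberedChart p) (θ₀ : ℝ) : Φ.box θ₀ ⊆ solidTorusCover :=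
  fun _ hw => mem_solidTorusCover.2 (Metric.ball_subset_ball (by norm_num) hw.1)

lemma injOn_box (Φ : FiberedChart p) (θ₀ : ℝ) : InjOn Φ.map (Φ.box θ₀) := by
  intro w hw w' hw' h
  refine Φ.eq_of_map_eq (Φ.box_subset θ₀ hw) (Φ.box_subset θ₀ hw') ?_ h
  have h1 := hw.2
  have h2 := hw'.2
  have h3 : 2 * Real.pi / (Φ.mult : ℝ) = Real.pi / Φ.mult + Real.pi / Φ.mult := by ring
  rw [mem_Ioo] at h1 h2
  rw [abs_lt]
  constructor <;> linarith [h1.1, h1.2, h2.1, h2.2]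

lemma isOpen_image_map (Φ : FiberedChart p) {U : Set (ℂ × ℝ)} (hU : IsOpen U)
    (hUs : U ⊆ solidTorusCover) : IsOpen (Φ.map '' U) := by
  rw [isOpen_iff_mem_nhds]
  rintro _ ⟨w, hw, rfl⟩
  obtain ⟨O, G, hO, hwO, hG, hΦG, -, -, hGw⟩ := Φ.exists_local_inverse (hUs hw)
  have h1 : ∀ᶠ y in 𝓝 (Φ.map w), G y ∈ U :=
    (hG.continuousOn.continuousAt (hO.mem_nhds hwO)) (hU.mem_nhds (by rwa [hGw]))
  filter_upwards [h1, hO.mem_nhds hwO] with y hy hyO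
  exact ⟨G y, hy, hΦG y hyO⟩

end FiberedChart

namespace SeifertFibration

open FiberedChart

variable {M B : Type*} [TopologicalSpace M] [ChartedSpace E3 M] [TopologicalSpace B]
  {S : SeifertFibration M B} [IsManifold (𝓡 3) ∞ M]

/-- Change of variables between a fundamental domain of a fibered chart and a box of another one. -/
lemma lintegral_box_eq {ρ : S.Chart → ℂ → ℝ} (hρ : S.IsSection densityAction univ ρ)
    (Φ Ψ : S.Chart) (θ₀ : ℝ) (f : M → ENNReal) :
    ∫⁻ w in Ψ.1.box θ₀ ∩ (solidTorusCover ∩ Ψ.1.map ⁻¹' (Φ.1.map '' solidTorusCover)),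
        f (Ψ.1.map w) * ENNReal.ofReal (ρ Ψ w.1) =
      ∫⁻ w in Φ.1.fundamentalDomain ∩ (solidTorusCover ∩ Φ.1.map ⁻¹' (Ψ.1.map '' Ψ.1.box θ₀)),
        f (Φ.1.map w) * ENNReal.ofReal (ρ Φ w.1) := by
  set A := Φ.1.fundamentalDomain ∩ (solidTorusCover ∩ Φ.1.map ⁻¹' (Ψ.1.map '' Ψ.1.box θ₀)) with hA
  have hAm : MeasurableSet A := by
    refine Φ.1.measurableSet_fundamentalDomain.inter (IsOpen.measurableSet ?_)
    exact Φ.1.continuousOn_map.isOpen_inter_preimage isOpen_solidTorusCover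
      (Ψ.1.isOpen_image_map (Ψ.1.isOpen_box θ₀) (Ψ.1.box_subset θ₀))
  have hex : ∀ w, w ∈ A → ∃ w', w' ∈ Ψ.1.box θ₀ ∧ Ψ.1.map w' = Φ.1.map w := fun w hw => hw.2.2
  -- `F` is the change of charts; near each point of `A` it agrees with a transition, since the box is
  -- open and `Ψ.map` is injective on it
  choose! F hFbox hF using hex
  have hFT : ∀ w, w ∈ A → ∃ L : ℂ × ℝ →L[ℝ] ℂ × ℝ, HasFDerivWithinAt F L A w ∧
      |L.det| * ρ Ψ (F w).1 = ρ Φ w.1 := by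
    intro w hw
    obtain ⟨W, τ, h, ε, T, hwW, hτ, hh⟩ := (S.compatible_chart Φ Ψ).exists_isTransition hw.2.1
      (Ψ.1.box_subset θ₀ (hFbox w hw)) (hF w hw).symm
    have hTd : HasFDerivAt (fun v : ℂ × ℝ => (τ v.1, ε * v.2 + h v.1))
        (fiberedLinear (fderiv ℝ τ w.1) ε (fderiv ℝ h w.1)) w :=
      ((T.hasFDerivAt_base hwW).comp w hasFDerivAt_fst).prodMk
        ((hasFDerivAt_snd.const_mul ε).add ((T.hasFDerivAt_shift hwW).comp w hasFDerivAt_fst))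
    have hTw : (τ w.1, ε * w.2 + h w.1) = F w := Prod.ext hτ hh
    have hev1 : ∀ᶠ v : ℂ × ℝ in 𝓝 w, (τ v.1, ε * v.2 + h v.1) ∈ Ψ.1.box θ₀ := by
      refine hTd.continuousAt ((Ψ.1.isOpen_box θ₀).mem_nhds ?_)
      rw [hTw]
      exact hFbox w hw
    have hev2 : ∀ᶠ v : ℂ × ℝ in 𝓝 w, v.1 ∈ W := continuous_fst.continuousAt (T.mem_nhds hwW)
    refine ⟨_, hTd.hasFDerivWithinAt.congr_of_eventuallyEq ?_ hTw.symm, ?_⟩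
    · filter_upwards [nhdsWithin_le_nhds hev1, nhdsWithin_le_nhds hev2, self_mem_nhdsWithin]
        with v hv1 hv2 hvA
      refine Ψ.1.injOn_box θ₀ (hFbox v hvA) hv1 ?_
      rw [hF v hvA, ← T.map_eq v.1 hv2 v.2]
    · rw [fiberedLinear_det, hρ.eq_act Φ trivial Ψ trivial _ _ _ _ T w.1 hwW, ← hτ,
        abs_of_pos (T.det_pos _ hwW)]
      rfl
  choose! F' hF'd hF'ρ using hFT
  have hinj : InjOn F A := by
    intro w hw w' hw' h
    refine Φ.1.injOn_fundamentalDomain hw.1 hw'.1 ?_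
    rw [← hF w hw, ← hF w' hw', h]
  have himg : F '' A =
      Ψ.1.box θ₀ ∩ (solidTorusCover ∩ Ψ.1.map ⁻¹' (Φ.1.map '' solidTorusCover)) := by
    ext v
    constructor
    · rintro ⟨w, hw, rfl⟩
      exact ⟨hFbox w hw, Ψ.1.box_subset θ₀ (hFbox w hw), w, hw.2.1, (hF w hw).symm⟩
    · rintro ⟨hv, -, w, hw, hwv⟩
      obtain ⟨w', hw', hww'⟩ := Φ.1.exists_mem_fundamentalDomain hw
      have hw'A : w' ∈ A := ⟨hw', Φ.1.fundamentalDomain_subset hw', v, hv, by rw [hww', hwv]⟩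
      exact ⟨w', hw'A, Ψ.1.injOn_box θ₀ (hFbox w' hw'A) hv (by rw [hF w' hw'A, hww', hwv])⟩
  have hHaar : (volume : Measure (ℂ × ℝ)).IsAddHaarMeasure := by
    rw [Measure.volume_eq_prod]
    infer_instance
  rw [← himg, lintegral_image_eq_lintegral_abs_det_fderiv_mul volume hAm hF'd hinj]
  refine setLIntegral_congr_fun hAm fun w hw => ?_
  rw [hF w hw, ← hF'ρ w hw, ENNReal.ofReal_mul (abs_nonneg _)]
  ring

variable [CompactSpace M] [MeasurableSpace M] [BorelSpace M]

/-- The positive part of a density on the base, together with the length `dθ` of the fibers, defines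
a finite measure on `M`. -/
lemma exists_measure {ρ : S.Chart → ℂ → ℝ} (hρ : S.IsSection densityAction univ ρ) :
    ∃ ν : Measure M, IsFiniteMeasure ν ∧ ∀ (Φ : S.Chart) (f : M → ENNReal), Measurable f →
      (∀ x, x ∉ Φ.1.map '' solidTorusCover → f x = 0) →
      ∫⁻ x, f x ∂ν =
        ∫⁻ w in Φ.1.fundamentalDomain, f (Φ.1.map w) * ENNReal.ofReal (ρ Φ w.1) := by
  classical
  have hch : ∀ x : M, ∃ (Φ : S.Chart) (θ : ℝ), Φ.1.map (0, θ) = x := by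
    intro x
    obtain ⟨Φ, h1, -⟩ := S.exists_chart_base_zero isOpen_univ (mem_univ (S.proj x))
    obtain ⟨θ, hθ⟩ := Φ.1.exists_map_eq (z := 0) (by simp) h1.symm
    exact ⟨Φ, θ, hθ⟩
  choose Ψ θ hΨ using hch
  set O : M → Set M := fun x => (Ψ x).1.map '' (Ψ x).1.box (θ x) with hO
  have hOo : ∀ x, IsOpen (O x) := fun x =>
    (Ψ x).1.isOpen_image_map ((Ψ x).1.isOpen_box _) ((Ψ x).1.box_subset _)
  have hOx : ∀ x, x ∈ O x := fun x => by
    have := (Ψ x).1.mult_cast_pos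
    have hpi := Real.pi_pos
    have h1 : 0 < Real.pi / ((Ψ x).1.mult : ℝ) := by positivity
    exact ⟨(0, θ x), ⟨by simp, by constructor <;> simp [h1]⟩, hΨ x⟩
  obtain ⟨t, ht⟩ := CompactSpace.elim_nhds_subcover O fun x => (hOo x).mem_nhds (hOx x)
  have hcov : ∀ x : M, ∃ i ∈ t, x ∈ O i := fun x => by
    have hx : x ∈ ⋃ i ∈ t, O i := ht ▸ mem_univ x
    simpa using hx
  -- a measurable partition of unity
  set N : M → ENNReal := fun x => ∑ i ∈ t, (O i).indicator 1 x with hN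
  have hNm : Measurable N :=
    Finset.measurable_fun_sum t fun i _ => measurable_one.indicator (hOo i).measurableSet
  have hN0 : ∀ x, N x ≠ 0 := fun x => by
    obtain ⟨i, hi, hxi⟩ := hcov x
    have : (1 : ENNReal) ≤ N x := by
      calc (1 : ENNReal) = (O i).indicator 1 x := by simp [hxi]
        _ ≤ N x := Finset.single_le_sum (f := fun i => (O i).indicator (1 : M → ENNReal) x)
          (fun _ _ => zero_le) hi
    exact (zero_lt_one.trans_le this).ne'
  have hNtop : ∀ x, N x ≠ ⊤ := fun x => by
    refine ENNReal.sum_ne_top.2 fun i _ => ?_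
    by_cases h : x ∈ O i <;> simp [h]
  set χ : M → M → ENNReal := fun i x => (O i).indicator 1 x / N x with hχ
  have hχm : ∀ i, Measurable (χ i) := fun i =>
    (measurable_one.indicator (hOo i).measurableSet).div hNm
  have hχsum : ∀ x, ∑ i ∈ t, χ i x = 1 := fun x => by
    simp only [hχ, div_eq_mul_inv, ← Finset.sum_mul]
    exact ENNReal.mul_inv_cancel (hN0 x) (hNtop x)
  have hχ0 : ∀ i x, x ∉ O i → χ i x = 0 := fun i x hx => by simp [hχ, hx]
  have hρm : ∀ (Φ : S.Chart) (s : Set (ℂ × ℝ)), MeasurableSet s → s ⊆ solidTorusCover →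
      AEMeasurable (fun w : ℂ × ℝ => ENNReal.ofReal (ρ Φ w.1)) (volume.restrict s) := by
    intro Φ s hs hss
    refine ENNReal.measurable_ofReal.comp_aemeasurable (ContinuousOn.aemeasurable ?_ hs)
    exact (hρ.contDiffOn Φ trivial).continuousOn.comp continuous_fst.continuousOn
      fun w hw => mem_solidTorusCover.1 (hss hw)
  have hmapm : ∀ (Φ : S.Chart) (s : Set (ℂ × ℝ)), MeasurableSet s → s ⊆ solidTorusCover →
      AEMeasurable Φ.1.map (volume.restrict s) := fun Φ s hs hss =>
    (Φ.1.continuousOn_map.mono hss).aemeasurable hs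
  set bx : M → Set (ℂ × ℝ) := fun i => (Ψ i).1.box (θ i) with hbx
  have hbm : ∀ i, MeasurableSet (bx i) := fun i => ((Ψ i).1.isOpen_box _).measurableSet
  have hbs : ∀ i, bx i ⊆ solidTorusCover := fun i => (Ψ i).1.box_subset _
  set d : M → ℂ × ℝ → ENNReal := fun i w => χ i ((Ψ i).1.map w) * ENNReal.ofReal (ρ (Ψ i) w.1)
    with hd
  have hdm : ∀ i, AEMeasurable (d i) (volume.restrict (bx i)) := fun i =>
    ((hχm i).comp_aemeasurable (hmapm _ _ (hbm i) (hbs i))).mul (hρm _ _ (hbm i) (hbs i))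
  set ν : Measure M :=
    ∑ i ∈ t, ((volume.restrict (bx i)).withDensity (d i)).map (Ψ i).1.map with hν
  have hint : ∀ f : M → ENNReal, Measurable f →
      ∫⁻ x, f x ∂ν = ∑ i ∈ t, ∫⁻ w in bx i, d i w * f ((Ψ i).1.map w) := by
    intro f hf
    rw [hν, lintegral_finsetSum_measure]
    refine Finset.sum_congr rfl fun i _ => ?_
    rw [lintegral_map' hf.aemeasurable ((hmapm _ _ (hbm i) (hbs i)).mono_ac
      (withDensity_absolutelyContinuous _ _)), lintegral_withDensity_eq_lintegral_mul₀ (hdm i)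
      (g := fun w => f ((Ψ i).1.map w)) (hf.comp_aemeasurable (hmapm _ _ (hbm i) (hbs i)))]
    rfl
  refine ⟨ν, ⟨?_⟩, ?_⟩
  · rw [← lintegral_one, hint _ measurable_const]
    refine ENNReal.sum_lt_top.2 fun i _ => ?_
    obtain ⟨C, hC⟩ : ∃ C, ∀ z ∈ Metric.closedBall (0 : ℂ) (1 / 2), ρ (Ψ i) z ≤ C := by
      have := (isCompact_closedBall (0 : ℂ) (1 / 2)).bddAbove_image
        (((hρ.contDiffOn (Ψ i) trivial).continuousOn).mono
          (Metric.closedBall_subset_ball (by norm_num)))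
      obtain ⟨C, hC⟩ := this
      exact ⟨C, fun z hz => hC ⟨z, hz, rfl⟩⟩
    have hle : ∫⁻ w in bx i, d i w * 1 ≤ ∫⁻ w in bx i, ENNReal.ofReal C := by
      refine setLIntegral_mono measurable_const fun w hw => ?_
      have h1 : χ i ((Ψ i).1.map w) ≤ 1 := by
        rw [← hχsum ((Ψ i).1.map w)]
        exact Finset.single_le_sum (f := fun j => χ j ((Ψ i).1.map w)) (fun _ _ => zero_le)
          (by assumption)
      calc d i w * 1 ≤ 1 * ENNReal.ofReal C * 1 := by
            gcongr
            exact mul_le_mul' h1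
              (ENNReal.ofReal_le_ofReal (hC _ (Metric.ball_subset_closedBall hw.1)))
        _ = ENNReal.ofReal C := by simp
    refine hle.trans_lt ?_
    rw [setLIntegral_const]
    refine ENNReal.mul_lt_top ENNReal.ofReal_lt_top ?_
    exact ((Metric.isBounded_ball.prod (Metric.isBounded_Ioo _ _))).measure_lt_top
  · intro Φ f hf hf0
    have hΦo : IsOpen (Φ.1.map '' solidTorusCover) :=
      Φ.1.isOpen_image_map isOpen_solidTorusCover subset_rfl
    rw [hint f hf]
    have hterm : ∀ i ∈ t, ∫⁻ w in bx i, d i w * f ((Ψ i).1.map w) =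
        ∫⁻ w in Φ.1.fundamentalDomain,
          (f (Φ.1.map w) * χ i (Φ.1.map w)) * ENNReal.ofReal (ρ Φ w.1) := by
      intro i _
      have e1 : ∫⁻ w in bx i, d i w * f ((Ψ i).1.map w) =
          ∫⁻ w in bx i, (f ((Ψ i).1.map w) * χ i ((Ψ i).1.map w)) *
            ENNReal.ofReal (ρ (Ψ i) w.1) := by
        congr 1
        ext w
        simp only [hd]
        ring
      rw [e1, setLIntegral_eq_inter_of_eq_zero (hbm i)
        (t := solidTorusCover ∩ (Ψ i).1.map ⁻¹' (Φ.1.map '' solidTorusCover)),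
        lintegral_box_eq hρ Φ (Ψ i) (θ i) (fun x => f x * χ i x),
        ← setLIntegral_eq_inter_of_eq_zero Φ.1.measurableSet_fundamentalDomain]
      · exact (Φ.1.continuousOn_map.isOpen_inter_preimage isOpen_solidTorusCover
          (hOo i)).measurableSet
      · intro w hw hw'
        have : Φ.1.map w ∉ O i := fun h => hw' ⟨Φ.1.fundamentalDomain_subset hw, h⟩
        rw [hχ0 i _ this]
        simp
      · exact ((Ψ i).1.continuousOn_map.isOpen_inter_preimage isOpen_solidTorusCover
          hΦo).measurableSet
      · intro w hw hw'
        have : (Ψ i).1.map w ∉ Φ.1.map '' solidTorusCover := fun h => hw' ⟨hbs i hw, h⟩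
        rw [hf0 _ this]
        simp
    have hFm := Φ.1.measurableSet_fundamentalDomain
    have hFs := Φ.1.fundamentalDomain_subset
    rw [Finset.sum_congr rfl hterm, ← lintegral_finsetSum']
    · refine setLIntegral_congr_fun hFm fun w _ => ?_
      rw [← Finset.sum_mul, ← Finset.mul_sum, hχsum, mul_one]
    · intro i _
      exact ((hf.comp_aemeasurable (hmapm _ _ hFm hFs)).mul
        ((hχm i).comp_aemeasurable (hmapm _ _ hFm hFs))).mul (hρm _ _ hFm hFs)

/-- Integration of functions on the base which are supported in one chart: the fibers have length
`2π`, but the disc covers its image in the base `a` times, which accounts for the factor `2π / a`. -/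
lemma exists_measure_integral {ρ : S.Chart → ℂ → ℝ} (hρ : S.IsSection densityAction univ ρ)
    (hpos : ∀ Φ, ∀ z ∈ Metric.ball (0 : ℂ) 1, 0 < ρ Φ z) :
    ∃ ν : Measure M, IsFiniteMeasure ν ∧ ∀ (Φ : S.Chart) (u : B → ℝ), Continuous u →
      (∀ b, b ∉ Φ.1.base '' Metric.ball 0 1 → u b = 0) →
      ∫ x, u (S.proj x) ∂ν =
        2 * Real.pi / Φ.1.mult * ∫ z in Metric.ball (0 : ℂ) 1, u (Φ.1.base z) * ρ Φ z := by
  obtain ⟨ν, hfin, hν⟩ := exists_measure hρ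
  refine ⟨ν, hfin, fun Φ u hu hu0 => ?_⟩
  have hΦo : IsOpen (Φ.1.map '' solidTorusCover) :=
    Φ.1.isOpen_image_map isOpen_solidTorusCover subset_rfl
  have hFm := Φ.1.measurableSet_fundamentalDomain
  have hFs := Φ.1.fundamentalDomain_subset
  have hmapm : AEMeasurable Φ.1.map (volume.restrict Φ.1.fundamentalDomain) :=
    (Φ.1.continuousOn_map.mono hFs).aemeasurable hFm
  have hρm : AEMeasurable (fun w : ℂ × ℝ => ENNReal.ofReal (ρ Φ w.1))
      (volume.restrict Φ.1.fundamentalDomain) := by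
    refine ENNReal.measurable_ofReal.comp_aemeasurable (ContinuousOn.aemeasurable ?_ hFm)
    exact (hρ.contDiffOn Φ trivial).continuousOn.comp continuous_fst.continuousOn
      fun w hw => mem_solidTorusCover.1 (hFs hw)
  have hmapm' : AEMeasurable Φ.1.map ((volume.restrict Φ.1.fundamentalDomain).withDensity
      fun w => ENNReal.ofReal (ρ Φ w.1)) :=
    hmapm.mono_ac (withDensity_absolutelyContinuous _ _)
  have hmeas : ν.restrict (Φ.1.map '' solidTorusCover) =
      ((volume.restrict Φ.1.fundamentalDomain).withDensity
        fun w => ENNReal.ofReal (ρ Φ w.1)).map Φ.1.map := by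
    refine Measure.ext fun T hT => ?_
    have h1 := hν Φ ((T ∩ Φ.1.map '' solidTorusCover).indicator 1)
      (measurable_one.indicator (hT.inter hΦo.measurableSet)) (fun x hx => by simp [hx])
    rw [Measure.restrict_apply hT, Measure.map_apply_of_aemeasurable hmapm' hT,
      ← lintegral_indicator_one (hT.inter hΦo.measurableSet), h1]
    have hind : MeasurableSet[(inferInstance : MeasurableSpace M)] T := hT
    rw [← Measure.map_apply_of_aemeasurable hmapm' hT, ← lintegral_indicator_one hT,
      lintegral_map' (measurable_one.indicator hT).aemeasurable hmapm',
      lintegral_withDensity_eq_lintegral_mul₀ hρm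
        (g := fun w => T.indicator 1 (Φ.1.map w))
        ((measurable_one.indicator hT).comp_aemeasurable hmapm)]
    refine setLIntegral_congr_fun hFm fun w hw => ?_
    have hw' : Φ.1.map w ∈ Φ.1.map '' solidTorusCover := ⟨w, hFs hw, rfl⟩
    by_cases hwT : Φ.1.map w ∈ T
    · simp [hwT, hw']
    · simp [hwT]
  have hsupp : ∀ x, x ∉ Φ.1.map '' solidTorusCover → u (S.proj x) = 0 := by
    intro x hx
    refine hu0 _ ?_
    rintro ⟨z, hz, hzx⟩
    obtain ⟨s, rfl⟩ := Φ.1.exists_map_eq hz hzx.symm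
    exact hx ⟨(z, s), mk_mem_solidTorusCover hz, rfl⟩
  rw [← setIntegral_eq_integral_of_forall_compl_eq_zero hsupp, hmeas,
    integral_map (f := fun x => u (S.proj x)) hmapm'
      (hu.comp S.continuous_proj).aestronglyMeasurable,
    integral_withDensity_eq_integral_toReal_smul₀ hρm (by simp)]
  -- the integrand depends on the first coordinate only
  have e1 : ∫ w in Φ.1.fundamentalDomain,
      (ENNReal.ofReal (ρ Φ w.1)).toReal • u (S.proj (Φ.1.map w)) =
      ∫ w in Φ.1.fundamentalDomain, (fun z => u (Φ.1.base z) * ρ Φ z) w.1 := by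
    refine setIntegral_congr_fun hFm fun w hw => ?_
    have hw1 := mem_solidTorusCover.1 (hFs hw)
    simp only [smul_eq_mul]
    rw [ENNReal.toReal_ofReal (hpos Φ _ hw1).le, Φ.1.proj_map (hFs hw), mul_comm]
  have hc : 0 ≤ 2 * Real.pi / (Φ.1.mult : ℝ) := by positivity
  rw [e1, fundamentalDomain, Measure.volume_eq_prod, ← Measure.prod_restrict,
    integral_fun_fst (fun z => u (Φ.1.base z) * ρ Φ z)]
  simp [hc]

end SeifertFibration

/-! ### The compactly supported Poincaré lemma on the disc -/

/-- The integral of an exact compactly supported `2`-form vanishes. -/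
lemma integral_curl_eq_zero {η : ℂ → ℂ →L[ℝ] ℝ} (hη : ContDiff ℝ ∞ η)
    (hsupp : HasCompactSupport η) : ∫ z, curl η z = 0 := by
  have key : ∀ u v : ℂ, Integrable (fun z => fderiv ℝ η z u v) ∧ ∫ z, fderiv ℝ η z u v = 0 := by
    intro u v
    have hg : ContDiff ℝ ∞ fun z => η z v := hη.clm_apply contDiff_const
    have hgs : HasCompactSupport fun z => η z v :=
      hsupp.comp_left (g := fun L : ℂ →L[ℝ] ℝ => L v) rfl
    have hfd : ∀ z, fderiv ℝ (fun z => η z v) z u = fderiv ℝ η z u v := by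
      intro z
      rw [fderiv_clm_apply (hη.contDiffAt.differentiableAt (by simp)) (differentiableAt_const v)]
      simp
    have hi : Integrable fun z => fderiv ℝ (fun z => η z v) z u := by
      refine Continuous.integrable_of_hasCompactSupport ?_ ?_
      · exact (hg.continuous_fderiv (by simp)).clm_apply continuous_const
      · exact (hgs.fderiv (𝕜 := ℝ)).comp_left (g := fun L : ℂ →L[ℝ] ℝ => L u) rfl
    simp only [hfd] at hi
    refine ⟨hi, ?_⟩
    have h1 := integral_mul_fderiv_eq_neg_fderiv_mul_of_integrable (μ := volume)
      (f := fun _ : ℂ => (1 : ℝ)) (g := fun z => η z v) (v := u) (by simp)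
      (by simpa [hfd] using hi)
      (by simpa using hg.continuous.integrable_of_hasCompactSupport hgs)
      (fun _ _ => differentiableAt_const _)
      (fun z _ => hg.contDiffAt.differentiableAt (by simp))
    simpa [hfd] using h1
  simp only [curl, extd]
  rw [integral_sub (key _ _).1 (key _ _).1, (key _ _).2, (key _ _).2, sub_zero]

/-- A primitive in one variable depends smoothly on a parameter. -/
lemma contDiff_parametric_primitive {ψ : ℝ → ℝ → ℝ} (hψ : ContDiff ℝ ∞ (Function.uncurry ψ))
    (hsupp : ∀ y x, 1 / 2 < |x| → ψ y x = 0) :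
    ContDiff ℝ ∞ fun q : ℝ × ℝ => ∫ t in (-1 : ℝ)..q.2, ψ q.1 t := by
  -- the primitive is the convolution with the indicator function of `[0, ∞)`
  have hf : LocallyIntegrable ((Ici (0 : ℝ)).indicator fun _ => (1 : ℝ)) :=
    (locallyIntegrable_const (1 : ℝ)).indicator measurableSet_Ici
  have h1 := contDiffOn_convolution_right_with_param (μ := volume) (n := ⊤)
    (ContinuousLinearMap.mul ℝ ℝ) (g := ψ) (s := univ) (k := Icc (-(1 / 2)) (1 / 2)) isOpen_univ
    isCompact_Icc (fun y x _ hx => hsupp y x (by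
      rw [mem_Icc, ← abs_le] at hx
      exact not_le.1 hx)) hf (hψ.contDiffOn)
  rw [univ_prod_univ, contDiffOn_univ] at h1
  convert h1 using 1
  ext ⟨y, x⟩
  have hcont : Continuous (ψ y) := hψ.continuous.comp (by fun_prop : Continuous fun t => (y, t))
  have hint : Integrable (ψ y) := hcont.integrable_of_hasCompactSupport
    (HasCompactSupport.intro (isCompact_Icc (a := -(1 / 2 : ℝ)) (b := 1 / 2)) fun t ht => by
      rw [mem_Icc, ← abs_le] at ht
      exact hsupp y t (not_le.1 ht))
  have h2 : ∫ t in Iic (-1 : ℝ), ψ y t = 0 := by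
    refine setIntegral_eq_zero_of_forall_eq_zero fun t ht => hsupp y t ?_
    rw [mem_Iic] at ht
    rw [abs_of_neg (by linarith)]
    linarith
  rw [convolution_eq_swap]
  simp only
  rw [intervalIntegral.integral_Iic_sub_Iic hint.integrableOn hint.integrableOn |>.symm, h2,
    sub_zero, ← integral_indicator measurableSet_Iic]
  congr 1
  ext t
  by_cases ht : t ≤ x
  · simp [ht]
  · simp [ht]

/-- The Poincaré lemma with compact supports, for functions supported in the disc of radius
`1 / 2`. -/
lemma exists_curl_eq {φ : ℂ → ℝ} (hφ : ContDiff ℝ ∞ φ) (hsupp : ∀ z, 1 / 2 < ‖z‖ → φ z = 0)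
    (hint : ∫ z, φ z = 0) :
    ∃ η : ℂ → ℂ →L[ℝ] ℝ, ContDiff ℝ ∞ η ∧ (∀ z, 3 / 4 < ‖z‖ → η z = 0) ∧
      ∀ z, curl η z = φ z := by
  set ψ : ℝ → ℝ → ℝ := fun y x => φ (x + y * Complex.I) with hψ
  have hψs : ContDiff ℝ ∞ (Function.uncurry ψ) := by
    refine hφ.comp (f := fun q : ℝ × ℝ => ((q.2 : ℂ) + q.1 * Complex.I)) ?_
    have h1 : ContDiff ℝ ∞ fun q : ℝ × ℝ => (q.2 : ℂ) :=
      Complex.ofRealCLM.contDiff.comp contDiff_snd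
    have h2 : ContDiff ℝ ∞ fun q : ℝ × ℝ => (q.1 : ℂ) :=
      Complex.ofRealCLM.contDiff.comp contDiff_fst
    exact h1.add (h2.mul contDiff_const)
  have hψx : ∀ y x, 1 / 2 < |x| → ψ y x = 0 := fun y x hx => hsupp _ (hx.trans_le (by
    simpa using Complex.abs_re_le_norm (x + y * Complex.I)))
  have hψy : ∀ y x, 1 / 2 < |y| → ψ y x = 0 := fun y x hy => hsupp _ (hy.trans_le (by
    simpa using Complex.abs_im_le_norm (x + y * Complex.I)))
  -- integrals over lines, and a bump function of total mass one
  set m : ℝ → ℝ := fun y => ∫ t in (-1 : ℝ)..1, ψ y t with hm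
  have hms : ContDiff ℝ ∞ m := (contDiff_parametric_primitive hψs hψx).comp
    (f := fun y : ℝ => (y, (1 : ℝ))) (by fun_prop)
  have hm0 : ∀ y, 1 / 2 < |y| → m y = 0 := fun y hy => by simp [hm, hψy y _ hy]
  let bmp : ContDiffBump (0 : ℝ) := ⟨1 / 4, 1 / 2, by norm_num, by norm_num⟩
  set κ : ℝ → ℝ := bmp.normed volume with hκ
  have hκs : ContDiff ℝ ∞ κ := bmp.contDiff_normed
  have hκ0 : ∀ x, 1 / 2 ≤ |x| → κ x = 0 := by
    intro x hx
    by_contra hne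
    have h1 : x ∈ Function.support κ := hne
    rw [hκ, bmp.support_normed_eq] at h1
    rw [Metric.mem_ball, dist_zero_right, Real.norm_eq_abs] at h1
    exact absurd h1 (not_lt.2 hx)
  have hκint : ∫ t in (-1 : ℝ)..1, κ t = 1 := by
    rw [intervalIntegral.integral_of_le (by norm_num)]
    refine (setIntegral_eq_integral_of_forall_compl_eq_zero fun x hx => hκ0 x ?_).trans
      bmp.integral_normed
    by_contra! hlt
    rw [abs_lt] at hlt
    exact hx ⟨by linarith [hlt.1], by linarith [hlt.2]⟩
  -- `ψ'` has integral zero on all horizontal lines, and `m` has integral zero by Fubini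
  set ψ' : ℝ → ℝ → ℝ := fun y x => ψ y x - κ x * m y with hψ'
  have hψ's : ContDiff ℝ ∞ (Function.uncurry ψ') :=
    hψs.sub ((hκs.comp contDiff_snd).mul (hms.comp contDiff_fst))
  have hψ'x : ∀ y x, 1 / 2 < |x| → ψ' y x = 0 := fun y x hx => by
    simp [hψ', hψx y x hx, hκ0 x hx.le]
  have hψ'y : ∀ y x, 1 / 2 < |y| → ψ' y x = 0 := fun y x hy => by
    simp [hψ', hψy y x hy, hm0 y hy]
  have hψ'c : ∀ y, Continuous (ψ' y) := fun y =>
    hψ's.continuous.comp (by fun_prop : Continuous fun t => (y, t))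
  have hψc : ∀ y, Continuous (ψ y) := fun y =>
    hψs.continuous.comp (by fun_prop : Continuous fun t => (y, t))
  have hψ'int : ∀ y, ∫ t in (-1 : ℝ)..1, ψ' y t = 0 := by
    intro y
    have hc : IntervalIntegrable (fun t => κ t * m y) volume (-1) 1 :=
      (hκs.continuous.mul continuous_const).intervalIntegrable _ _
    simp only [hψ']
    rw [intervalIntegral.integral_sub ((hψc y).intervalIntegrable _ _) hc,
      intervalIntegral.integral_mul_const, hκint, one_mul, sub_self]
  have hmint : ∫ t in (-1 : ℝ)..1, m t = 0 := by
    have hφi : Integrable φ := hφ.continuous.integrable_of_hasCompactSupport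
      (HasCompactSupport.intro (isCompact_closedBall (0 : ℂ) (1 / 2)) fun z hz => hsupp z (by
        simpa using hz))
    have hline : ∀ y, ∫ x, ψ y x = m y := by
      intro y
      simp only [hm]
      rw [intervalIntegral.integral_of_le (by norm_num)]
      refine (setIntegral_eq_integral_of_forall_compl_eq_zero fun x hx => hψx y x ?_).symm
      by_contra! hle
      rw [abs_le] at hle
      exact hx ⟨by linarith [hle.1], by linarith [hle.2]⟩
    have hmline : ∫ y, m y = ∫ t in (-1 : ℝ)..1, m t := by
      rw [intervalIntegral.integral_of_le (by norm_num)]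
      refine (setIntegral_eq_integral_of_forall_compl_eq_zero fun x hx => hm0 x ?_).symm
      by_contra! hle
      rw [abs_le] at hle
      exact hx ⟨by linarith [hle.1], by linarith [hle.2]⟩
    have hvp := Complex.volume_preserving_equiv_real_prod.symm
    have h1 : ∫ q : ℝ × ℝ, φ (Complex.measurableEquivRealProd.symm q) = ∫ z, φ z :=
      hvp.integral_comp Complex.measurableEquivRealProd.symm.measurableEmbedding φ
    have h2 : Integrable (fun q : ℝ × ℝ => φ (Complex.measurableEquivRealProd.symm q)) :=
      (hvp.integrable_comp_emb Complex.measurableEquivRealProd.symm.measurableEmbedding).2 hφi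
    rw [Measure.volume_eq_prod] at h1 h2
    rw [integral_prod_symm _ h2] at h1
    rw [← hmline, ← hint, ← h1]
    congr 1
    ext y
    rw [← hline y]
    congr 1
    ext x
    simp only [hψ]
    congr 1
    apply Complex.ext <;> simp [Complex.measurableEquivRealProd]
  -- the form is `P dx + Q dy`, with `∂Q/∂x = ψ'` and `∂P/∂y = -κ m`
  set Q : ℂ → ℝ := fun z => ∫ t in (-1 : ℝ)..z.re, ψ' z.im t with hQ
  set R : ℂ → ℝ := fun z => ∫ t in (-1 : ℝ)..z.im, m t with hR
  have hQs : ContDiff ℝ ∞ Q := (contDiff_parametric_primitive hψ's hψ'x).comp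
    (f := fun z : ℂ => (z.im, z.re)) (Complex.imCLM.contDiff.prodMk Complex.reCLM.contDiff)
  have hRs : ContDiff ℝ ∞ R := by
    have h1 : ContDiff ℝ ∞ (Function.uncurry fun _ : ℝ => m) := hms.comp contDiff_snd
    exact (contDiff_parametric_primitive h1 fun _ x hx => hm0 x hx).comp
      (f := fun z : ℂ => ((0 : ℝ), z.im)) (contDiff_const.prodMk Complex.imCLM.contDiff)
  set P : ℂ → ℝ := fun z => -(κ z.re * R z) with hP
  have hPs : ContDiff ℝ ∞ P := ((hκs.comp Complex.reCLM.contDiff).mul hRs).neg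
  -- to the right of the square the primitives are the full integrals, which vanish
  have hQ0 : ∀ z : ℂ, (1 / 2 < |z.re| ∨ 1 / 2 < |z.im|) → Q z = 0 := by
    rintro z (hz | hz)
    · rcases lt_abs.1 hz with h | h
      · have h1 : ∫ t in (1 : ℝ)..z.re, ψ' z.im t = 0 := by
          rw [intervalIntegral.integral_congr (g := fun _ => 0)]
          · simp
          · intro t ht
            refine hψ'x _ _ ?_
            rw [uIcc, mem_Icc] at ht
            have : 1 / 2 < t := (lt_min (by norm_num) h).trans_le ht.1
            exact lt_abs.2 (Or.inl this)
        have h2 := intervalIntegral.integral_add_adjacent_intervals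
          ((hψ'c z.im).intervalIntegrable (-1) 1 (μ := volume))
          ((hψ'c z.im).intervalIntegrable 1 z.re (μ := volume))
        rw [hψ'int, h1] at h2
        simp only [hQ]
        linarith
      · simp only [hQ]
        rw [intervalIntegral.integral_congr (g := fun _ => 0)]
        · simp
        · intro t ht
          refine hψ'x _ _ ?_
          rw [uIcc, mem_Icc] at ht
          have : t < -(1 / 2) := ht.2.trans_lt (max_lt (by norm_num) (by linarith))
          exact lt_abs.2 (Or.inr (by linarith))
    · simp [hQ, hψ'y z.im _ hz]
  have hP0 : ∀ z : ℂ, (1 / 2 < |z.re| ∨ 1 / 2 < |z.im|) → P z = 0 := by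
    rintro z (hz | hz)
    · simp [hP, hκ0 _ hz.le]
    · have hR0 : R z = 0 := by
        rcases lt_abs.1 hz with h | h
        · have h1 : ∫ t in (1 : ℝ)..z.im, m t = 0 := by
            rw [intervalIntegral.integral_congr (g := fun _ => 0)]
            · simp
            · intro t ht
              refine hm0 _ ?_
              rw [uIcc, mem_Icc] at ht
              have : 1 / 2 < t := (lt_min (by norm_num) h).trans_le ht.1
              exact lt_abs.2 (Or.inl this)
          have h2 := intervalIntegral.integral_add_adjacent_intervals
            (hms.continuous.intervalIntegrable (-1) 1 (μ := volume))
            (hms.continuous.intervalIntegrable 1 z.im (μ := volume))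
          rw [hmint, h1] at h2
          simp only [hR]
          linarith
        · simp only [hR]
          rw [intervalIntegral.integral_congr (g := fun _ => 0)]
          · simp
          · intro t ht
            refine hm0 _ ?_
            rw [uIcc, mem_Icc] at ht
            have : t < -(1 / 2) := ht.2.trans_lt (max_lt (by norm_num) (by linarith))
            exact lt_abs.2 (Or.inr (by linarith))
      simp [hP, hR0]
  have hQd : ∀ z, fderiv ℝ Q z 1 = ψ' z.im z.re := by
    intro z
    rw [← (hQs.contDiffAt.differentiableAt (by simp)).lineDeriv_eq_fderiv, lineDeriv]
    have h1 : (fun t : ℝ => Q (z + t • (1 : ℂ))) =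
        fun t => ∫ s in (-1 : ℝ)..(z.re + t), ψ' z.im s := by
      ext t; simp [hQ]
    rw [h1]
    have h2 : HasDerivAt (fun u => ∫ s in (-1 : ℝ)..u, ψ' z.im s) (ψ' z.im (z.re + 0)) (z.re + 0) :=
      intervalIntegral.integral_hasDerivAt_right ((hψ'c _).intervalIntegrable _ _)
        (hψ'c _).stronglyMeasurable.stronglyMeasurableAtFilter (hψ'c _).continuousAt
    have h3 := (h2.comp_const_add z.re 0).deriv
    rw [h3, add_zero]
  have hPd : ∀ z, fderiv ℝ P z Complex.I = -(κ z.re * m z.im) := by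
    intro z
    rw [← (hPs.contDiffAt.differentiableAt (by simp)).lineDeriv_eq_fderiv, lineDeriv]
    have h1 : (fun t : ℝ => P (z + t • Complex.I)) =
        fun t => -(κ z.re * ∫ s in (-1 : ℝ)..(z.im + t), m s) := by
      ext t; simp [hP, hR]
    rw [h1]
    have h2 : HasDerivAt (fun u => ∫ s in (-1 : ℝ)..u, m s) (m (z.im + 0)) (z.im + 0) :=
      intervalIntegral.integral_hasDerivAt_right (hms.continuous.intervalIntegrable _ _)
        hms.continuous.stronglyMeasurable.stronglyMeasurableAtFilter hms.continuous.continuousAt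
    have h3 := ((h2.comp_const_add z.im 0).const_mul (κ z.re)).fun_neg.deriv
    rw [h3, add_zero]
  refine ⟨fun z => P z • Complex.reCLM + Q z • Complex.imCLM,
    (hPs.smul contDiff_const).add (hQs.smul contDiff_const), ?_, ?_⟩
  · intro z hz
    have h1 : 1 / 2 < |z.re| ∨ 1 / 2 < |z.im| := by
      by_contra! h
      have h2 : z.re ^ 2 ≤ (1 / 2) ^ 2 := sq_le_sq' (abs_le.1 h.1).1 (abs_le.1 h.1).2
      have h3 : z.im ^ 2 ≤ (1 / 2) ^ 2 := sq_le_sq' (abs_le.1 h.2).1 (abs_le.1 h.2).2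
      have h4 : ‖z‖ ^ 2 = z.re ^ 2 + z.im ^ 2 := by
        rw [← Complex.normSq_eq_norm_sq, Complex.normSq_apply]; ring
      nlinarith
    simp [hP0 z h1, hQ0 z h1]
  · intro z
    have dP : HasFDerivAt P (fderiv ℝ P z) z :=
      (hPs.contDiffAt.differentiableAt (by simp)).hasFDerivAt
    have dQ : HasFDerivAt Q (fderiv ℝ Q z) z :=
      (hQs.contDiffAt.differentiableAt (by simp)).hasFDerivAt
    have d := (dP.smul_const Complex.reCLM).add (dQ.smul_const Complex.imCLM)
    have d' : fderiv ℝ (fun z => P z • Complex.reCLM + Q z • Complex.imCLM) z = _ := d.fderiv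
    simp only [curl, extd, d']
    simp [hQd, hPd, hψ', hψ]

/-- A sum over a full period does not depend on its starting point. -/
lemma sum_range_add_eq_of_periodic {A : Type*} [AddCommGroup A] {a : ℕ} {F : ℤ → A}
    (hF : ∀ k, F (k + a) = F k) (j : ℤ) :
    ∑ k ∈ Finset.range a, F (k + j) = ∑ k ∈ Finset.range a, F k := by
  have step : ∀ G : ℤ → A, (∀ k, G (k + a) = G k) →
      ∑ k ∈ Finset.range a, G (k + 1) = ∑ k ∈ Finset.range a, G k := by
    intro G hG
    have h1 := Finset.sum_range_succ (fun k : ℕ => G k) a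
    have h2 := Finset.sum_range_succ' (fun k : ℕ => G k) a
    rw [h1] at h2
    have h3 : G (a : ℕ) = G (0 : ℕ) := by simpa using hG 0
    rw [h3] at h2
    simpa using (add_right_cancel h2).symm
  induction j using Int.induction_on with
  | zero => simp
  | succ i ih =>
    rw [← ih, ← step (fun k => F (k + i)) (fun k => by rw [add_right_comm, hF])]
    refine Finset.sum_congr rfl fun k _ => ?_
    congr 1
    ring
  | pred i ih =>
    rw [← ih, ← step (fun k => F (k + (-i - 1))) (fun k => by rw [add_right_comm, hF])]
    refine Finset.sum_congr rfl fun k _ => ?_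
    congr 1
    ring

/-- The equivariant version of the Poincaré lemma with compact supports, obtained by averaging. -/
lemma exists_curl_eq_invariant {a : ℕ} (ha : 0 < a) {φ : ℂ → ℝ} (hφ : ContDiff ℝ ∞ φ)
    (hsupp : ∀ z, 1 / 2 < ‖z‖ → φ z = 0) (hint : ∫ z, φ z = 0)
    (hrot : ∀ (k : ℤ) z, φ (rootOfUnityPow a k * z) = φ z) :
    ∃ η : ℂ → ℂ →L[ℝ] ℝ, ContDiff ℝ ∞ η ∧ (∀ z, 3 / 4 < ‖z‖ → η z = 0) ∧
      (∀ z, curl η z = φ z) ∧ ∀ (k : ℤ) z, η z = (η (rootOfUnityPow a k * z)).comp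
        (rootOfUnityPow a k • ContinuousLinearMap.id ℝ ℂ) := by
  obtain ⟨η, hη, hη0, hcurl⟩ := exists_curl_eq hφ hsupp hint
  have ha' : (a : ℝ) ≠ 0 := by exact_mod_cast ha.ne'
  set F : ℤ → ℂ → ℂ →L[ℝ] ℝ := fun k z => (η (rootOfUnityPow a k * z)).comp
    (rootOfUnityPow a k • ContinuousLinearMap.id ℝ ℂ) with hF
  have hFper : ∀ z k, F (k + a) z = F k z := by
    intro z k
    have : rootOfUnityPow a (k + a) = rootOfUnityPow a k :=
      rootOfUnityPow_eq_of_dvd ha (by simp)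
    simp only [hF, this]
  have hFd : ∀ k z, HasFDerivAt (fun z : ℂ => rootOfUnityPow a k * z)
      (rootOfUnityPow a k • ContinuousLinearMap.id ℝ ℂ) z := fun k z =>
    (hasFDerivAt_id z).const_mul _
  have hFs : ∀ k, ContDiff ℝ ∞ (F k) := fun k =>
    (hη.comp (contDiff_const.mul contDiff_id)).clm_comp contDiff_const
  have hFcurl : ∀ k z, curl (F k) z = φ z := by
    intro k z
    have h1 : F k = fun z => (η (rootOfUnityPow a k * z)).comp
        (fderiv ℝ (fun z : ℂ => rootOfUnityPow a k * z) z) := by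
      ext1 z
      rw [(hFd k z).fderiv]
    rw [curl, h1, extd_pullback (f := fun z : ℂ => rootOfUnityPow a k * z)
      (hη.contDiffAt.differentiableAt (by simp))
      (contDiff_const.mul contDiff_id : ContDiff ℝ ∞ _).contDiffAt, extd_eq_det_mul_curl,
      (hFd k z).fderiv, det_rootOfUnityPow_smul_id, one_mul, hcurl, hrot]
  refine ⟨fun z => (a : ℝ)⁻¹ • ∑ k ∈ Finset.range a, F k z, ?_, ?_, ?_, ?_⟩
  · exact (ContDiff.sum (f := fun k : ℕ => F k) fun k _ => hFs k).const_smul _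
  · intro z hz
    have : ∀ k : ℤ, F k z = 0 := by
      intro k
      simp only [hF]
      rw [hη0 _ (by simpa [FiberedChart.rootOfUnityPow_norm] using hz),
        ContinuousLinearMap.zero_comp]
    simp [this]
  · intro z
    have hd : ∀ k : ℤ, DifferentiableAt ℝ (F k) z := fun k =>
      (hFs k).contDiffAt.differentiableAt (by simp)
    have hsum : ∀ n : ℕ, curl (fun z => ∑ k ∈ Finset.range n, F k z) z = n * φ z := by
      intro n
      induction n with
      | zero => simp [curl, extd]
      | succ n ih =>
        simp only [Finset.sum_range_succ]
        rw [curl,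
          extd_add (DifferentiableAt.fun_sum (A := fun k : ℕ => F k) fun k _ => hd k) (hd n)]
        change curl _ z + curl _ z = _
        rw [ih, hFcurl]
        push_cast
        ring
    rw [curl, extd_const_smul (DifferentiableAt.fun_sum (A := fun k : ℕ => F k) fun k _ => hd k)]
    change _ * curl _ z = _
    rw [hsum]
    field_simp
  · intro j z
    have h1 := sum_range_add_eq_of_periodic (F := fun k => F k z) (hFper z) j
    beta_reduce
    rw [← h1, ContinuousLinearMap.smul_comp]
    congr 1
    ext v
    simp only [_root_.sum_apply, ContinuousLinearMap.comp_apply, hF, rootOfUnityPow_add]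
    refine Finset.sum_congr rfl fun k _ => ?_
    simp [mul_assoc]

/-- Extension by zero of a smooth function with support in a smaller disc. -/
lemma contDiff_indicator_ball {V : Type*} [NormedAddCommGroup V] [NormedSpace ℝ V] {f : ℂ → V}
    {r : ℝ} (hr : r < 1) (hf : ContDiffOn ℝ ∞ f (Metric.ball 0 1))
    (hsupp : ∀ z ∈ Metric.ball (0 : ℂ) 1, r < ‖z‖ → f z = 0) :
    ContDiff ℝ ∞ ((Metric.ball (0 : ℂ) 1).indicator f) := by
  rw [contDiff_iff_contDiffAt]
  intro z
  by_cases hz : z ∈ Metric.ball (0 : ℂ) 1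
  · refine (hf.contDiffAt (Metric.isOpen_ball.mem_nhds hz)).congr_of_eventuallyEq ?_
    filter_upwards [Metric.isOpen_ball.mem_nhds hz] with y hy
    exact indicator_of_mem hy f
  · have h1 : r < ‖z‖ := hr.trans_le (by simpa using hz)
    refine (contDiffAt_const (c := (0 : V))).congr_of_eventuallyEq ?_
    filter_upwards [continuous_norm.continuousAt.eventually (lt_mem_nhds h1)] with y hy
    by_cases hyD : y ∈ Metric.ball (0 : ℂ) 1
    · rw [indicator_of_mem hyD, hsupp y hyD hy]
    · exact indicator_of_notMem hyD f

namespace SeifertFibration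

open FiberedChart

/-! ### Integration and exactness on the base -/

variable {M B : Type*} [TopologicalSpace M] [ChartedSpace E3 M] [TopologicalSpace B]
  {S : SeifertFibration M B}

lemma norm_eq_of_base_eq (Φ : S.Chart) {z z' : ℂ} (hz : z ∈ Metric.ball (0 : ℂ) 1)
    (hz' : z' ∈ Metric.ball (0 : ℂ) 1) (h : Φ.1.base z = Φ.1.base z') : ‖z'‖ = ‖z‖ := by
  obtain ⟨k, rfl⟩ := (Φ.1.base_eq_iff hz hz').1 h
  rw [norm_mul, rootOfUnityPow_norm, one_mul]

lemma base_notMem_image_closedBall (Φ : S.Chart) {r : ℝ} (hr : r < 1) {z : ℂ}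
    (hz : z ∈ Metric.ball (0 : ℂ) 1) (h : r < ‖z‖) :
    Φ.1.base z ∉ Φ.1.base '' Metric.closedBall 0 r := by
  rintro ⟨z', hz', he⟩
  have h1 := norm_eq_of_base_eq Φ (Metric.closedBall_subset_ball hr hz') hz he
  rw [mem_closedBall_zero_iff] at hz'
  linarith

lemma isSection_zero_form : S.IsSection (formAction 0) univ fun _ _ => 0 where
  contDiffOn _ _ := contDiffOn_const
  eq_act Φ _ Ψ _ W τ h ε T z _ := by simp [formAction]

variable (S) in
/-- The function `u` times the density `ρ` is the exterior derivative of a `1`-form with values in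
the local system of fiber orientations. -/
def IsExact (ρ : S.Chart → ℂ → ℝ) (u : B → ℝ) : Prop :=
  ∃ η : S.Chart → ℂ → ℂ →L[ℝ] ℝ, S.IsSection (formAction 0) univ η ∧
    ∀ Φ : S.Chart, ∀ z ∈ Metric.ball (0 : ℂ) 1, curl (η Φ) z = u (Φ.1.base z) * ρ Φ z

lemma IsExact.add {ρ : S.Chart → ℂ → ℝ} {u v : B → ℝ} (hu : S.IsExact ρ u) (hv : S.IsExact ρ v) :
    S.IsExact ρ fun b => u b + v b := by
  obtain ⟨η, h1, h2⟩ := hu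
  obtain ⟨η', h1', h2'⟩ := hv
  refine ⟨fun Φ z => η Φ z + η' Φ z, by simpa using h1.add_form h1', fun Φ z hz => ?_⟩
  rw [curl, extd_add ((h1.contDiffOn Φ trivial).differentiableAt_of_isOpen Metric.isOpen_ball hz)
    ((h1'.contDiffOn Φ trivial).differentiableAt_of_isOpen Metric.isOpen_ball hz), add_mul,
    ← h2 Φ z hz, ← h2' Φ z hz]
  rfl

lemma IsExact.const_mul {ρ : S.Chart → ℂ → ℝ} {u : B → ℝ} (hu : S.IsExact ρ u) (c : ℝ) :
    S.IsExact ρ fun b => c * u b := by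
  obtain ⟨η, h1, h2⟩ := hu
  refine ⟨fun Φ z => c • η Φ z, by simpa using h1.const_smul_form c, fun Φ z hz => ?_⟩
  rw [curl, extd_const_smul
    ((h1.contDiffOn Φ trivial).differentiableAt_of_isOpen Metric.isOpen_ball hz), mul_assoc,
    ← h2 Φ z hz]
  rfl

lemma isExact_zero {ρ : S.Chart → ℂ → ℝ} : S.IsExact ρ fun _ => 0 :=
  ⟨fun _ _ => 0, isSection_zero_form, fun Φ z _ => by simp [curl, extd]⟩

lemma IsExact.sum {ι : Type*} {ρ : S.Chart → ℂ → ℝ} {t : Finset ι} {u : ι → B → ℝ}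
    (hu : ∀ i ∈ t, S.IsExact ρ (u i)) : S.IsExact ρ fun b => ∑ i ∈ t, u i b := by
  classical
  induction t using Finset.induction_on with
  | empty => simpa using isExact_zero
  | insert i t hi ih =>
    simp only [Finset.sum_insert hi]
    exact (hu i (Finset.mem_insert_self _ _)).add
      (ih fun j hj => hu j (Finset.mem_insert_of_mem hj))

variable [IsManifold (𝓡 3) ∞ M]

/-- A density is invariant under the rotations of a chart. -/
lemma IsSection.density_rootOfUnityPow_mul {ρ : S.Chart → ℂ → ℝ}
    (hρ : S.IsSection densityAction univ ρ) (Φ : S.Chart) (k : ℤ) {z : ℂ}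
    (hz : z ∈ Metric.ball (0 : ℂ) 1) : ρ Φ (rootOfUnityPow Φ.1.mult k * z) = ρ Φ z := by
  have hz' : rootOfUnityPow Φ.1.mult k * z ∈ Metric.ball (0 : ℂ) 1 := by
    simpa [rootOfUnityPow_norm] using hz
  obtain ⟨W, τ, h, ε, T, hzW, hτz⟩ := S.exists_isTransition Φ Φ hz hz'
    ((Φ.1.base_eq_iff hz hz').2 ⟨k, rfl⟩)
  obtain ⟨rfl, -, j, hj⟩ := T.self_eq hzW
  have hj' : τ =ᶠ[𝓝 z] fun y => rootOfUnityPow Φ.1.mult j * y := hj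
  have hfd : fderiv ℝ τ z = rootOfUnityPow Φ.1.mult j • ContinuousLinearMap.id ℝ ℂ := by
    rw [hj'.fderiv_eq]
    exact ((hasFDerivAt_id z).const_mul _).fderiv
  rw [hρ.eq_act _ trivial _ trivial _ _ _ _ T z hzW, hτz, hfd]
  simp [densityAction, det_rootOfUnityPow_smul_id]

variable (S) in
/-- The measure `ν` on `M` is, in every fibered chart, the quotient of the product of `ρ` with the
length measure of the fibers; only its values on functions of the base matter. -/
def IsFiberMeasure [MeasurableSpace M] (ρ : S.Chart → ℂ → ℝ) (ν : Measure M) : Prop :=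
  ∀ (Φ : S.Chart) (u : B → ℝ), Continuous u →
    (∀ b, b ∉ Φ.1.base '' Metric.ball 0 1 → u b = 0) →
    ∫ x, u (S.proj x) ∂ν =
      2 * Real.pi / Φ.1.mult * ∫ z in Metric.ball (0 : ℂ) 1, u (Φ.1.base z) * ρ Φ z

variable [T2Space B] [CompactSpace M] [MeasurableSpace M] [BorelSpace M]
  {ρ : S.Chart → ℂ → ℝ} {ν : Measure M} [IsFiniteMeasure ν]

lemma IsSmooth.integrable {u : B → ℝ} (hu : S.IsSmooth u) :
    Integrable (fun x => u (S.proj x)) ν :=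
  ((continuous_of_isSmooth hu).comp S.continuous_proj).integrable_of_hasCompactSupport
    (HasCompactSupport.of_compactSpace _)

omit [BorelSpace M] [IsFiniteMeasure ν] in
/-- Stokes' theorem for forms with support in a chart. -/
lemma IsFiberMeasure.integral_eq_zero_of_support (hν : S.IsFiberMeasure ρ ν)
    (hpos : ∀ Φ, ∀ z ∈ Metric.ball (0 : ℂ) 1, 0 < ρ Φ z) (Φ : S.Chart)
    {η : S.Chart → ℂ → ℂ →L[ℝ] ℝ} (hη : S.IsSection (formAction 0) univ η)
    (hsupp : ∀ Ψ : S.Chart, ∀ z ∈ Metric.ball (0 : ℂ) 1,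
      Ψ.1.base z ∉ Φ.1.base '' Metric.closedBall 0 (1 / 2) → η Ψ z = 0)
    {v : B → ℝ} (hv : S.IsSmooth v) (hvη : ∀ Ψ : S.Chart, ∀ z ∈ Metric.ball (0 : ℂ) 1,
      curl (η Ψ) z = v (Ψ.1.base z) * ρ Ψ z) :
    ∫ x, v (S.proj x) ∂ν = 0 := by
  have hK : IsClosed (Φ.1.base '' Metric.closedBall 0 (1 / 2)) :=
    S.isClosed_image_base Φ (by norm_num)
  -- off the support of `η` there is a chart in which `η` vanishes identically
  have hv0 : ∀ b, b ∉ Φ.1.base '' Metric.closedBall 0 (1 / 2) → v b = 0 := by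
    intro b hb
    obtain ⟨Ψ, rfl, hΨ⟩ := S.exists_chart_base_zero hK.isOpen_compl hb
    have h0 : η Ψ =ᶠ[𝓝 0] fun _ => 0 := by
      filter_upwards [Metric.ball_mem_nhds (0 : ℂ) one_pos] with z hz
      exact hsupp Ψ z hz (hΨ z hz)
    have h1 := hvη Ψ 0 (by simp)
    rw [curl, extd_congr h0] at h1
    have h2 : v (Ψ.1.base 0) * ρ Ψ 0 = 0 := by rw [← h1]; simp [extd]
    exact (mul_eq_zero.1 h2).resolve_right (hpos Ψ 0 (by simp)).ne'
  rw [hν Φ v (continuous_of_isSmooth hv) fun b hb => hv0 b fun hb' =>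
    hb (image_mono (Metric.closedBall_subset_ball (by norm_num)) hb')]
  have hs : ∀ z ∈ Metric.ball (0 : ℂ) 1, 1 / 2 < ‖z‖ → η Φ z = 0 := fun z hz h =>
    hsupp Φ z hz (base_notMem_image_closedBall Φ (by norm_num) hz h)
  have h3 := contDiff_indicator_ball (by norm_num) (hη.contDiffOn Φ trivial) hs
  have h4 : HasCompactSupport ((Metric.ball (0 : ℂ) 1).indicator (η Φ)) :=
    HasCompactSupport.intro (isCompact_closedBall (0 : ℂ) 1) fun z hz =>
      indicator_of_notMem (fun h => hz (Metric.ball_subset_closedBall h)) _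
  have h5 := integral_curl_eq_zero h3 h4
  have h6 : ∫ z in Metric.ball (0 : ℂ) 1, v (Φ.1.base z) * ρ Φ z =
      ∫ z, curl ((Metric.ball (0 : ℂ) 1).indicator (η Φ)) z := by
    refine Eq.trans ?_ (setIntegral_eq_integral_of_forall_compl_eq_zero
      (s := Metric.ball (0 : ℂ) 1) ?_)
    · refine setIntegral_congr_fun measurableSet_ball fun z hz => ?_
      rw [← hvη Φ z hz]
      refine extd_congr ?_ _ _
      filter_upwards [Metric.isOpen_ball.mem_nhds hz] with y hy
      exact (indicator_of_mem hy _).symm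
    · intro z hz
      have hz1 : 1 / 2 < ‖z‖ := lt_of_lt_of_le (by norm_num) (by simpa using hz : 1 ≤ ‖z‖)
      have hev : (Metric.ball (0 : ℂ) 1).indicator (η Φ) =ᶠ[𝓝 z] fun _ => 0 := by
        filter_upwards [continuous_norm.continuousAt.eventually (lt_mem_nhds hz1)] with y hy
        by_cases hyD : y ∈ Metric.ball (0 : ℂ) 1
        · rw [indicator_of_mem hyD, hs y hyD hy]
        · exact indicator_of_notMem hyD _
      exact (extd_congr hev _ _).trans (by simp [extd])
  rw [h6, h5, mul_zero]

/-- Stokes' theorem on the base. -/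
lemma IsFiberMeasure.integral_eq_zero (hν : S.IsFiberMeasure ρ ν)
    (hρ : S.IsSection densityAction univ ρ) (hpos : ∀ Φ, ∀ z ∈ Metric.ball (0 : ℂ) 1, 0 < ρ Φ z)
    {v : B → ℝ} (hv : S.IsExact ρ v) :
    ∫ x, v (S.proj x) ∂ν = 0 := by
  obtain ⟨η, hη, hvη⟩ := hv
  choose Φ hΦ _ using fun b : B => S.exists_chart_base_zero isOpen_univ (mem_univ b)
  obtain ⟨t, χ, hχ, hχ0, hχ1⟩ := exists_partitionOfUnity Φ hΦ
  have hs : ∀ i, S.IsSection (formAction 0) univ fun Ψ z => χ i (Ψ.1.base z) • η Ψ z := fun i =>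
    hη.smul_form (hχ i)
  -- `d (χ i η) = w i ρ`; the `w i` are supported in charts and have sum `v`
  choose w hw hwη using fun i => (hs i).curl.exists_ratio hρ hpos
  have hw0 : ∀ i, ∫ x, w i (S.proj x) ∂ν = 0 := fun i =>
    hν.integral_eq_zero_of_support hpos (Φ i) (hs i)
      (fun Ψ z _ hzK => by rw [hχ0 i _ hzK, zero_smul]) (hw i)
      (fun Ψ z hz => (hwη i Ψ z hz).symm)
  have hsum : ∀ b, v b = ∑ i ∈ t, w i b := by
    intro b
    obtain ⟨z, hz⟩ : ∃ z : ℂ, z = 0 := ⟨0, rfl⟩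
    have hzD : z ∈ Metric.ball (0 : ℂ) 1 := by simp [hz]
    have hb : (Φ b).1.base z = b := by rw [hz, hΦ]
    rw [← hb]
    refine mul_right_cancel₀ (hpos (Φ b) z hzD).ne' ?_
    rw [← hvη _ _ hzD, Finset.sum_mul]
    simp only [hwη _ (Φ b) z hzD]
    have hd : ∀ i, DifferentiableAt ℝ (fun y => χ i ((Φ b).1.base y) • η (Φ b) y) z := fun i =>
      ((hs i).contDiffOn (Φ b) trivial).differentiableAt_of_isOpen Metric.isOpen_ball hzD
    have hcs : ∀ t : Finset B,
        curl (fun y => ∑ i ∈ t, χ i ((Φ b).1.base y) • η (Φ b) y) z =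
          ∑ i ∈ t, curl (fun y => χ i ((Φ b).1.base y) • η (Φ b) y) z := by
      classical
      intro t
      induction t using Finset.induction_on with
      | empty => simp [curl, extd]
      | insert i t hi ih =>
        simp only [Finset.sum_insert hi]
        rw [← ih, curl, extd_add (hd i) (DifferentiableAt.fun_sum fun j _ => hd j)]
        rfl
    rw [← hcs t]
    simp only [← Finset.sum_smul, hχ1, one_smul]
  simp only [hsum]
  rw [integral_finsetSum _ fun i _ => (hw i).integrable]
  exact Finset.sum_eq_zero fun i _ => hw0 i

omit [BorelSpace M] [IsFiniteMeasure ν] in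
/-- The converse of Stokes' theorem for functions with support in a chart. -/
lemma IsFiberMeasure.isExact_of_support (hν : S.IsFiberMeasure ρ ν)
    (hρ : S.IsSection densityAction univ ρ) (Φ : S.Chart) {v : B → ℝ}
    (hv : S.IsSmooth v) (hsupp : ∀ b, b ∉ Φ.1.base '' Metric.closedBall 0 (1 / 2) → v b = 0)
    (hint : ∫ x, v (S.proj x) ∂ν = 0) : S.IsExact ρ v := by
  have hs : ∀ z ∈ Metric.ball (0 : ℂ) 1, 1 / 2 < ‖z‖ → v (Φ.1.base z) * ρ Φ z = 0 := by
    intro z hz h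
    rw [hsupp _ (base_notMem_image_closedBall Φ (by norm_num) hz h), zero_mul]
  -- an invariant primitive on the disc, which extends by zero to the base
  set φ : ℂ → ℝ := (Metric.ball (0 : ℂ) 1).indicator fun z => v (Φ.1.base z) * ρ Φ z with hφ
  have hφs : ContDiff ℝ ∞ φ := contDiff_indicator_ball (by norm_num)
    ((hv Φ).mul (hρ.contDiffOn Φ trivial)) hs
  have hφD : ∀ z ∈ Metric.ball (0 : ℂ) 1, φ z = v (Φ.1.base z) * ρ Φ z := fun z hz =>
    indicator_of_mem hz _
  have hφ0 : ∀ z, 1 / 2 < ‖z‖ → φ z = 0 := by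
    intro z hz
    by_cases hzD : z ∈ Metric.ball (0 : ℂ) 1
    · rw [hφD z hzD, hs z hzD hz]
    · exact indicator_of_notMem hzD _
  have hφi : ∫ z, φ z = 0 := by
    rw [hν Φ v (continuous_of_isSmooth hv) fun b hb => hsupp b fun hb' =>
      hb (image_mono (Metric.closedBall_subset_ball (by norm_num)) hb')] at hint
    rw [hφ, integral_indicator Metric.isOpen_ball.measurableSet]
    refine (mul_eq_zero.1 hint).resolve_left ?_
    have := Φ.1.mult_cast_pos
    positivity
  have hφr : ∀ (k : ℤ) z, φ (rootOfUnityPow Φ.1.mult k * z) = φ z := by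
    intro k z
    have hiff : rootOfUnityPow Φ.1.mult k * z ∈ Metric.ball (0 : ℂ) 1 ↔
        z ∈ Metric.ball (0 : ℂ) 1 := by simp [rootOfUnityPow_norm]
    by_cases hz : z ∈ Metric.ball (0 : ℂ) 1
    · rw [hφD _ (hiff.2 hz), hφD z hz, hρ.density_rootOfUnityPow_mul Φ k hz,
        (Φ.1.base_eq_iff hz (hiff.2 hz)).2 ⟨k, rfl⟩]
    · rw [hφ, indicator_of_notMem hz, indicator_of_notMem (mt hiff.1 hz)]
  obtain ⟨η, hη, hη0, hcurl, hrot⟩ := exists_curl_eq_invariant Φ.1.mult_pos hφs hφ0 hφi hφr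
  obtain ⟨F, hF, hFΦ, hF0⟩ := exists_isSection_extend_zero (𝒩 := formAction 0)
    (fun ε A l => by simp [formAction]) Φ (r := 3 / 4) (by norm_num) (by norm_num)
    hη.contDiffOn hη0 (fun k z _ => by
      rw [hrot k z]
      simp [formAction])
  refine ⟨F, hF, fun Ψ z hz => ?_⟩
  by_cases hb : Ψ.1.base z ∈ Φ.1.base '' Metric.closedBall 0 (3 / 4)
  · obtain ⟨z', hz', he⟩ := hb
    have hz'D := Metric.closedBall_subset_ball (by norm_num : (3 / 4 : ℝ) < 1) hz'
    obtain ⟨W, τ, h, ε, T, hzW, rfl⟩ := S.exists_isTransition Ψ Φ hz hz'D he.symm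
    have h1 := hF.curl.eq_act _ trivial _ trivial _ _ _ _ T z hzW
    have h2 : curl (F Φ) (τ z) = v (Φ.1.base (τ z)) * ρ Φ (τ z) := by
      have hev : F Φ =ᶠ[𝓝 (τ z)] η := by
        filter_upwards [Metric.isOpen_ball.mem_nhds hz'D] with y hy
        exact hFΦ y hy
      rw [curl, extd_congr hev, ← hφD _ hz'D]
      exact hcurl _
    rw [h1, h2, hρ.eq_act _ trivial _ trivial _ _ _ _ T z hzW, he]
    simp only [densityAction]
    ring
  · have hev : F Ψ =ᶠ[𝓝 z] fun _ => 0 := by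
      have hK := (S.isClosed_image_base Φ (by norm_num : (3 / 4 : ℝ) < 1)).isOpen_compl
      filter_upwards [Metric.isOpen_ball.mem_nhds hz,
        (S.continuousAt_base Ψ hz).eventually (hK.mem_nhds hb)] with y hy hyK
      exact hF0 Ψ y hy hyK
    rw [curl, extd_congr hev, hsupp _ fun hb' =>
      hb (image_mono (Metric.closedBall_subset_closedBall (by norm_num)) hb')]
    simp [extd]

omit [BorelSpace M] [IsFiniteMeasure ν] in
lemma IsFiberMeasure.integral_pos_of_bump (hν : S.IsFiberMeasure ρ ν)
    (hρ : S.IsSection densityAction univ ρ) (hpos : ∀ Φ, ∀ z ∈ Metric.ball (0 : ℂ) 1, 0 < ρ Φ z)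
    (Φ : S.Chart) {u : B → ℝ} (hu : S.IsSmooth u)
    (hur : ∀ z ∈ Metric.ball (0 : ℂ) 1, u (Φ.1.base z) = radialBump z)
    (hsupp : ∀ b, b ∉ Φ.1.base '' Metric.closedBall 0 (1 / 2) → u b = 0) :
    0 < ∫ x, u (S.proj x) ∂ν := by
  rw [hν Φ u (continuous_of_isSmooth hu) fun b hb => hsupp b fun hb' =>
    hb (image_mono (Metric.closedBall_subset_ball (by norm_num)) hb')]
  have hm := Φ.1.mult_cast_pos
  refine mul_pos (by positivity) ?_
  rw [setIntegral_congr_fun (g := fun z => radialBump z * ρ Φ z) Metric.isOpen_ball.measurableSet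
    fun z hz => by beta_reduce; rw [hur z hz],
    ← integral_indicator Metric.isOpen_ball.measurableSet]
  have hs : ContDiff ℝ ∞ ((Metric.ball (0 : ℂ) 1).indicator fun z => radialBump z * ρ Φ z) :=
    contDiff_indicator_ball (r := 1 / 2) (by norm_num)
      (contDiff_radialBump.contDiffOn.mul (hρ.contDiffOn Φ trivial))
      fun z _ h => by rw [radialBump_eq_zero h.le, zero_mul]
  refine hs.continuous.integral_pos_of_hasCompactSupport_nonneg_nonzero (x := 0)
    (HasCompactSupport.intro (isCompact_closedBall (0 : ℂ) 1) fun z hz =>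
      indicator_of_notMem (fun h => hz (Metric.ball_subset_closedBall h)) _)
    (fun z => indicator_nonneg (fun z hz => mul_nonneg (radialBump_nonneg z) (hpos Φ z hz).le) z) ?_
  rw [indicator_of_mem (by simp)]
  exact (mul_pos (radialBump_pos (by simp)) (hpos Φ 0 (by simp))).ne'

/-- The converse of Stokes' theorem: on a connected base, every smooth function of integral zero is
exact. -/
lemma IsFiberMeasure.isExact [ConnectedSpace M] (hν : S.IsFiberMeasure ρ ν)
    (hρ : S.IsSection densityAction univ ρ) (hpos : ∀ Φ, ∀ z ∈ Metric.ball (0 : ℂ) 1, 0 < ρ Φ z)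
    {v : B → ℝ} (hv : S.IsSmooth v) (hint : ∫ x, v (S.proj x) ∂ν = 0) : S.IsExact ρ v := by
  have := S.connectedSpace_base
  choose Φ hΦ _ using fun b : B => S.exists_chart_base_zero isOpen_univ (mem_univ b)
  obtain ⟨b₀⟩ : Nonempty B := inferInstance
  obtain ⟨β₀, hβ₀, -, hβ₀r, hβ₀s⟩ := exists_bump (Φ b₀)
  have hc := hν.integral_pos_of_bump hρ hpos (Φ b₀) hβ₀ hβ₀r hβ₀s
  set c := ∫ x, β₀ (S.proj x) ∂ν with hcdef
  -- the points near which functions are multiples of `β₀` up to exact functions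
  set G : Set B := {b | ∀ u : B → ℝ, S.IsSmooth u →
    (∀ b', b' ∉ (Φ b).1.base '' Metric.closedBall 0 (1 / 2) → u b' = 0) →
    S.IsExact ρ fun b' => u b' - (∫ x, u (S.proj x) ∂ν) / c * β₀ b'} with hG
  set N : B → Set B := fun b => (Φ b).1.base '' Metric.ball 0 (1 / 2) with hN
  have hNo : ∀ b, IsOpen (N b) := fun b =>
    S.isOpen_image_base (Φ b) Metric.isOpen_ball (Metric.ball_subset_ball (by norm_num))
  have hbN : ∀ b, b ∈ N b := fun b => ⟨0, by simp, hΦ b⟩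
  have hNK : ∀ b, N b ⊆ (Φ b).1.base '' Metric.closedBall 0 (1 / 2) := fun b =>
    image_mono Metric.ball_subset_closedBall
  have hlocal : ∀ (Ψ : S.Chart) (u β : B → ℝ), S.IsSmooth u → S.IsSmooth β →
      (∀ b', b' ∉ Ψ.1.base '' Metric.closedBall 0 (1 / 2) → u b' = 0) →
      (∀ b', b' ∉ Ψ.1.base '' Metric.closedBall 0 (1 / 2) → β b' = 0) →
      0 < ∫ x, β (S.proj x) ∂ν →
      S.IsExact ρ fun b' => u b' - (∫ x, u (S.proj x) ∂ν) / (∫ x, β (S.proj x) ∂ν) * β b' := by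
    intro Ψ u β hu hβ hus hβs hpos'
    refine hν.isExact_of_support hρ Ψ (hu.sub ((isSmooth_const _).mul hβ)) ?_ ?_
    · intro b' hb'
      simp [hus b' hb', hβs b' hb']
    · rw [integral_sub hu.integrable (hβ.integrable.const_mul _), integral_const_mul,
        div_mul_cancel₀ _ hpos'.ne', sub_self]
  -- a function on the second disc is moved into the intersection, and from there to `β₀`
  have hprop : ∀ b b', (N b ∩ N b').Nonempty → b ∈ G → b' ∈ G := by
    rintro b b' ⟨a, ha⟩ hb u hu hus
    obtain ⟨Ψ, -, hΨ⟩ := S.exists_chart_base_zero ((hNo b).inter (hNo b')) ha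
    obtain ⟨β, hβ, -, hβr, hβs⟩ := exists_bump Ψ
    have hm := hν.integral_pos_of_bump hρ hpos Ψ hβ hβr hβs
    have hΨ' : ∀ a, a ∉ N b ∨ a ∉ N b' → β a = 0 := by
      intro a ha
      refine hβs a ?_
      rintro ⟨z, hz, rfl⟩
      have := hΨ z (Metric.closedBall_subset_ball (by norm_num) hz)
      exact ha.elim (fun h => h this.1) (fun h => h this.2)
    have e1 := hlocal (Φ b') u β hu hβ hus (fun a ha => hΨ' a (Or.inr (mt (@hNK b' a) ha))) hm
    have e2 := hb β hβ (fun a ha => hΨ' a (Or.inl (mt (@hNK b a) ha)))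
    have e3 := e1.add (e2.const_mul ((∫ x, u (S.proj x) ∂ν) / (∫ x, β (S.proj x) ∂ν)))
    convert e3 using 2 with a
    have := hm.ne'
    field_simp
    ring
  have hb₀ : b₀ ∈ G := fun u hu hus => hlocal (Φ b₀) u β₀ hu hβ₀ hus hβ₀s hc
  have hGuniv : G = univ := by
    refine IsClopen.eq_univ ⟨?_, ?_⟩ ⟨b₀, hb₀⟩
    · rw [← isOpen_compl_iff, isOpen_iff_mem_nhds]
      intro b hb
      filter_upwards [(hNo b).mem_nhds (hbN b)] with b' hb' hb'G
      exact hb (hprop b' b ⟨b', hbN b', hb'⟩ hb'G)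
    · rw [isOpen_iff_mem_nhds]
      intro b hb
      filter_upwards [(hNo b).mem_nhds (hbN b)] with b' hb'
      exact hprop b b' ⟨b', hb', hbN b'⟩ hb
  -- the multiples of `β₀` to which the parts `χ i v` are reduced cancel, as `v` has integral zero
  obtain ⟨t, χ, hχ, hχ0, hχ1⟩ := exists_partitionOfUnity Φ hΦ
  have hsm : ∀ i, S.IsSmooth fun b => χ i b * v b := fun i => (hχ i).mul hv
  have hex : ∀ i, S.IsExact ρ fun b => χ i b * v b -
      (∫ x, χ i (S.proj x) * v (S.proj x) ∂ν) / c * β₀ b := by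
    intro i
    have hi : i ∈ G := hGuniv ▸ mem_univ i
    exact hi _ (hsm i) fun b hb => by simp [hχ0 i b hb]
  have hint' : ∑ i ∈ t, ∫ x, χ i (S.proj x) * v (S.proj x) ∂ν = 0 := by
    rw [← integral_finsetSum _ fun i _ => (hsm i).integrable]
    simpa only [← Finset.sum_mul, hχ1, one_mul] using hint
  have := IsExact.sum (t := t) fun i _ => hex i
  convert this using 2 with b
  rw [Finset.sum_sub_distrib, ← Finset.sum_mul, ← Finset.sum_mul, ← Finset.sum_div, hχ1, hint']
  simp

end SeifertFibration

/-! ### Cutting off a closed form at the puncture of a disc -/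

/-- The profile of the radial bump function, in terms of the square of the radius. -/
noncomputable def bumpProfile (s : ℝ) : ℝ := Real.smoothTransition ((1 / 4 - s) * (16 / 3))

lemma contDiff_bumpProfile : ContDiff ℝ ∞ bumpProfile :=
  Real.smoothTransition.contDiff.comp ((contDiff_const.sub contDiff_id).mul contDiff_const)

lemma hasFDerivAt_radialBump (z : ℂ) :
    HasFDerivAt radialBump (deriv bumpProfile (‖z‖ ^ 2) • (2 • innerSL ℝ z)) z := by
  have h1 : HasDerivAt bumpProfile (deriv bumpProfile (‖z‖ ^ 2)) (‖z‖ ^ 2) :=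
    (contDiff_bumpProfile.differentiable (by simp)).differentiableAt.hasDerivAt
  have h2 : HasFDerivAt (fun z : ℂ => ‖z‖ ^ 2) (2 • innerSL ℝ z) z :=
    (hasStrictFDerivAt_norm_sq z).hasFDerivAt
  have h3 := HasDerivAt.comp_hasFDerivAt (f := fun z : ℂ => ‖z‖ ^ 2) z h1 h2
  exact h3

/-- For a closed form `l`, only the derivative of the cut-off function contributes to the exterior
derivative, and it is radial. -/
lemma curl_one_sub_radialBump_smul {l : ℂ → ℂ →L[ℝ] ℝ} {z : ℂ} (hl : DifferentiableAt ℝ l z)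
    (hcurl : curl l z = 0) :
    curl (fun y => (1 - radialBump y) • l y) z =
      -(2 * deriv bumpProfile (‖z‖ ^ 2)) * l z (Complex.I * z) := by
  have h1 : HasFDerivAt (fun y => 1 - radialBump y)
      (-(deriv bumpProfile (‖z‖ ^ 2) • (2 • innerSL ℝ z))) z :=
    (hasFDerivAt_radialBump z).const_sub 1
  rw [curl] at hcurl
  rw [curl, extd_smul hl h1.differentiableAt, h1.fderiv, hcurl]
  have h2 : Complex.I * z = (-z.im) • (1 : ℂ) + z.re • Complex.I := by
    apply Complex.ext <;> simp
  rw [h2, map_add, map_smul, map_smul]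
  simp [innerSL_apply_apply, Complex.inner]
  ring

/-- The integral of the exterior derivative of a closed form on the punctured disc, cut off near the
puncture, is its period. -/
lemma integral_curl_one_sub_radialBump_smul {l : ℂ → ℂ →L[ℝ] ℝ}
    (hl : ContDiffOn ℝ ∞ l (Metric.ball 0 1 \ {0}))
    (hcurl : ∀ z ∈ Metric.ball (0 : ℂ) 1 \ {0}, curl l z = 0) {c : ℝ}
    (hper : ∀ r ∈ Ioo (0 : ℝ) 1, ∫ φ in (-Real.pi)..Real.pi,
      l (r * Complex.exp (φ * Complex.I)) (Complex.I * (r * Complex.exp (φ * Complex.I))) = c) :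
    ∫ z in Metric.ball (0 : ℂ) 1, curl (fun y => (1 - radialBump y) • l y) z = c := by
  have hUo : IsOpen (Metric.ball (0 : ℂ) 1 \ {0}) := Metric.isOpen_ball.sdiff isClosed_singleton
  set η : ℂ → ℂ →L[ℝ] ℝ := fun y => (1 - radialBump y) • l y with hη
  have hηs : ContDiffOn ℝ ∞ η (Metric.ball 0 1) := by
    intro z hz
    refine ContDiffAt.contDiffWithinAt ?_
    by_cases h0 : z = 0
    · refine (contDiffAt_const (c := (0 : ℂ →L[ℝ] ℝ))).congr_of_eventuallyEq ?_
      filter_upwards [Metric.ball_mem_nhds z (by norm_num : (0 : ℝ) < 1 / 4)] with y hy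
      rw [h0, mem_ball_zero_iff] at hy
      simp [hη, radialBump_eq_one hy.le]
    · exact (contDiff_const.sub contDiff_radialBump).contDiffAt.smul
        (hl.contDiffAt (hUo.mem_nhds ⟨hz, h0⟩))
  have hform : ∀ z ∈ Metric.ball (0 : ℂ) 1 \ {0}, curl η z =
      -(2 * deriv bumpProfile (‖z‖ ^ 2)) * l z (Complex.I * z) := fun z hz =>
    curl_one_sub_radialBump_smul (hl.differentiableAt_of_isOpen hUo hz) (hcurl z hz)
  have hout : ∀ z ∈ Metric.ball (0 : ℂ) 1, 1 / 2 < ‖z‖ → curl η z = 0 := by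
    intro z hz hz2
    have hz0 : z ≠ 0 := by
      rintro rfl
      norm_num at hz2
    rw [← hcurl z ⟨hz, hz0⟩]
    refine extd_congr ?_ _ _
    filter_upwards [continuous_norm.continuousAt.eventually (lt_mem_nhds hz2)] with y hy
    simp [hη, radialBump_eq_zero hy.le]
  set F : ℂ → ℝ := (Metric.ball (0 : ℂ) 1).indicator (curl η) with hF
  have hFc : Continuous F := (contDiff_indicator_ball (by norm_num)
    (contDiffOn_curl Metric.isOpen_ball hηs) hout).continuous
  rw [← integral_indicator measurableSet_ball, ← Complex.integral_comp_polarCoord_symm]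
  set G : ℝ × ℝ → ℝ := fun q => q.1 * F (q.1 * Complex.exp (q.2 * Complex.I)) with hG
  have hGeq : ∀ q : ℝ × ℝ, q.1 • F (Complex.polarCoord.symm q) = G q := by
    intro q
    rw [Complex.polarCoord_symm_apply, Complex.ofReal_cos, Complex.ofReal_sin,
      Complex.cos_add_sin_I]
    rfl
  simp only [← hF, hGeq]
  have hGc : Continuous G := by
    refine continuous_fst.mul (hFc.comp ?_)
    fun_prop
  have hnorm : ∀ r φ : ℝ, 0 < r → ‖(r : ℂ) * Complex.exp (φ * Complex.I)‖ = r := by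
    intro r φ hr
    rw [norm_mul, Complex.norm_exp_ofReal_mul_I, mul_one, Complex.norm_real, Real.norm_eq_abs,
      abs_of_pos hr]
  have hG0 : ∀ q : ℝ × ℝ, 1 ≤ q.1 → G q = 0 := by
    intro q hq
    simp only [hG, hF]
    rw [indicator_of_notMem, mul_zero]
    rw [mem_ball_zero_iff, hnorm _ _ (by linarith)]
    linarith
  have hset : ∫ q in polarCoord.target, G q =
      ∫ q in Ioo (0 : ℝ) 1 ×ˢ Ioo (-Real.pi) Real.pi, G q := by
    refine setIntegral_eq_of_subset_of_forall_sdiff_eq_zero ?_ ?_ ?_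
    · exact polarCoord.open_target.measurableSet
    · rintro q ⟨h1, h2⟩
      exact ⟨h1.1, h2⟩
    · rintro q ⟨⟨h1, h2⟩, h3⟩
      refine hG0 q (not_lt.1 fun h => h3 ⟨⟨h1, h⟩, h2⟩)
  have hGi : IntegrableOn G (Ioo (0 : ℝ) 1 ×ˢ Ioo (-Real.pi) Real.pi) (volume.prod volume) := by
    rw [← Measure.volume_eq_prod]
    exact (hGc.continuousOn.integrableOn_compact (isCompact_Icc.prod isCompact_Icc)).mono_set
      (prod_mono Ioo_subset_Icc_self Ioo_subset_Icc_self)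
  rw [hset, Measure.volume_eq_prod, setIntegral_prod _ hGi]
  have hpi := Real.pi_pos
  -- on the circle of radius `r` the angular integral is the period
  have hinner : ∀ r ∈ Ioo (0 : ℝ) 1, ∫ φ in Ioo (-Real.pi) Real.pi, G (r, φ) =
      -(2 * r * deriv bumpProfile (r ^ 2)) * c := by
    intro r hr
    rw [← hper r hr, intervalIntegral.integral_of_le (by linarith), ← integral_Ioc_eq_integral_Ioo,
      ← integral_const_mul]
    refine integral_congr_ae (ae_of_all _ fun φ => ?_)
    have hn := hnorm r φ hr.1
    have hD : (r : ℂ) * Complex.exp (φ * Complex.I) ∈ Metric.ball (0 : ℂ) 1 := by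
      rw [mem_ball_zero_iff, hn]
      exact hr.2
    simp only [hG, hF]
    rw [indicator_of_mem hD, hform _ ⟨hD, by
      rw [mem_singleton_iff, ← norm_eq_zero, hn]
      exact hr.1.ne'⟩, hn]
    ring
  rw [setIntegral_congr_fun measurableSet_Ioo hinner, ← integral_Ioc_eq_integral_Ioo,
    ← intervalIntegral.integral_of_le zero_le_one, intervalIntegral.integral_mul_const]
  have hd : ∀ r : ℝ, HasDerivAt (fun r : ℝ => -bumpProfile (r ^ 2))
      (-(2 * r * deriv bumpProfile (r ^ 2))) r := by
    intro r
    have h1 : HasDerivAt bumpProfile (deriv bumpProfile (r ^ 2)) (r ^ 2) :=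
      (contDiff_bumpProfile.differentiable (by simp)).differentiableAt.hasDerivAt
    have h2 : HasDerivAt (fun r : ℝ => r ^ 2) (2 * r) r := by simpa using hasDerivAt_pow 2 r
    refine (HasDerivAt.comp (h := fun r : ℝ => r ^ 2) r h1 h2).fun_neg.congr_deriv ?_
    ring
  rw [intervalIntegral.integral_eq_sub_of_hasDerivAt fun r _ => hd r]
  · have h0 : bumpProfile (0 ^ 2) = 1 := by
      rw [bumpProfile, Real.smoothTransition.one_of_one_le (by norm_num)]
    have h1 : bumpProfile (1 ^ 2) = 0 := by
      rw [bumpProfile, Real.smoothTransition.zero_of_nonpos (by norm_num)]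
    rw [h0, h1]
    ring
  · refine Continuous.intervalIntegrable ?_ _ _
    have := contDiff_bumpProfile.continuous_deriv (by simp)
    fun_prop

namespace SeifertFibration

open FiberedChart

/-! ### The flat connection of a section -/

variable {M B : Type*} [TopologicalSpace M] [ChartedSpace E3 M] [TopologicalSpace B]
  {S : SeifertFibration M B} {σ : B → M}

/-- The section `σ` is the graph of the smooth function `f` over the open set `W` in the chart
`Ψ`. -/
structure IsLift (σ : B → M) (Ψ : S.Chart) (W : Set ℂ) (f : ℂ → ℝ) : Prop where
  isOpen : IsOpen W
  subset : W ⊆ Metric.ball 0 1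
  contDiffOn : ContDiffOn ℝ ∞ f W
  map_eq : ∀ z ∈ W, σ (Ψ.1.base z) = Ψ.1.map (z, f z)

lemma IsLift.contDiffAt {Ψ : S.Chart} {W : Set ℂ} {f : ℂ → ℝ} (h : IsLift σ Ψ W f) {z : ℂ}
    (hz : z ∈ W) : ContDiffAt ℝ ∞ f z := h.contDiffOn.contDiffAt (h.isOpen.mem_nhds hz)

lemma IsLift.hasFDerivAt {Ψ : S.Chart} {W : Set ℂ} {f : ℂ → ℝ} (h : IsLift σ Ψ W f) {z : ℂ}
    (hz : z ∈ W) : HasFDerivAt f (fderiv ℝ f z) z :=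
  ((h.contDiffAt hz).differentiableAt (by simp)).hasFDerivAt

/-- Two lifts of the same section differ locally by a constant. -/
lemma IsLift.fderiv_eq {Ψ : S.Chart} {W W' : Set ℂ} {f f' : ℂ → ℝ} (h : IsLift σ Ψ W f)
    (h' : IsLift σ Ψ W' f') {z : ℂ} (hz : z ∈ W) (hz' : z ∈ W') : fderiv ℝ f z = fderiv ℝ f' z := by
  have hc : 0 < 2 * Real.pi / Ψ.1.mult := by
    have := Ψ.1.mult_cast_pos
    positivity
  have key : ∀ y ∈ W, y ∈ W' → ∃ m : ℤ, f' y = f y + 2 * Real.pi / Ψ.1.mult * m := fun y hy hy' =>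
    Ψ.1.exists_int_of_map_eq (h.subset hy) (h.subset hy)
      ((h.map_eq y hy).symm.trans (h'.map_eq y hy'))
  have hev : (fun y => f' y - f y) =ᶠ[𝓝 z] fun _ => f' z - f z := by
    refine eventually_eq_of_sub_mem_lattice (f := fun y => f' y - f y)
      ((h'.contDiffAt hz').continuousAt.sub (h.contDiffAt hz).continuousAt) hc ?_
    filter_upwards [h.isOpen.mem_nhds hz, h'.isOpen.mem_nhds hz'] with y hy hy'
    obtain ⟨m, hm⟩ := key y hy hy'
    obtain ⟨n, hn⟩ := key z hz hz'
    refine ⟨m - n, ?_⟩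
    rw [hm, hn]
    push_cast
    ring
  have h1 := hev.fderiv_eq (𝕜 := ℝ)
  rw [fderiv_fun_const, fderiv_fun_sub (h'.hasFDerivAt hz').differentiableAt
    (h.hasFDerivAt hz).differentiableAt] at h1
  exact (sub_eq_zero.1 h1).symm

lemma IsLift.comp {Φ Ψ : S.Chart} {W W' : Set ℂ} {τ : ℂ → ℂ} {h f : ℂ → ℝ} {ε : ℝ}
    (hf : IsLift σ Ψ W' f) (T : IsTransition Φ.1 Ψ.1 W τ h ε) :
    IsLift σ Φ (W ∩ τ ⁻¹' W') fun z => ε * (f (τ z) - h z) where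
  isOpen := T.contDiffOn_base.continuousOn.isOpen_inter_preimage T.isOpen hf.isOpen
  subset := inter_subset_left.trans T.subset
  contDiffOn := contDiffOn_const.mul ((hf.contDiffOn.comp (T.contDiffOn_base.mono inter_subset_left)
    fun _ hz => hz.2).sub (T.contDiffOn_shift.mono inter_subset_left))
  map_eq z hz := by
    rw [T.base_eq hz.1, hf.map_eq _ hz.2, T.map_eq z hz.1, ← mul_assoc, T.sign_mul_sign, one_mul,
      sub_add_cancel]

/-- A section which is smooth over the disc of a chart, possibly except for some points, is locally
a graph.  In particular, a chart over whose center it is smooth has multiplicity one. -/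
lemma exists_isLift_of_contMDiffOn {Ψ : S.Chart} {U : Set ℂ} (hU : IsOpen U)
    (hUD : U ⊆ Metric.ball 0 1)
    (hσ : ContMDiffOn 𝓘(ℝ, ℂ) (𝓡 3) ∞ (fun z => σ (Ψ.1.base z)) U)
    (hsec : ∀ z ∈ U, S.proj (σ (Ψ.1.base z)) = Ψ.1.base z) {z₀ : ℂ} (hz₀ : z₀ ∈ U) :
    ∃ W f, IsLift σ Ψ W f ∧ z₀ ∈ W := by
  obtain ⟨θ, hθ⟩ := Ψ.1.exists_map_eq (hUD hz₀) (hsec z₀ hz₀)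
  obtain ⟨O, G, hO, hxO, hG, hΨG, hGD, -, hGx⟩ :=
    Ψ.1.exists_local_inverse (mk_mem_solidTorusCover (s := θ) (hUD hz₀))
  rw [hθ] at hxO hGx
  set F : ℂ → ℂ × ℝ := fun z => G (σ (Ψ.1.base z)) with hF
  set U' : Set ℂ := U ∩ (fun z => σ (Ψ.1.base z)) ⁻¹' O with hU'
  have hU'o : IsOpen U' := hσ.continuousOn.isOpen_inter_preimage hU hO
  have hz₀' : z₀ ∈ U' := ⟨hz₀, hxO⟩
  have hFs : ContDiffOn ℝ ∞ F U' :=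
    contMDiffOn_iff_contDiffOn.1 (hG.comp (hσ.mono inter_subset_left) fun z hz => hz.2)
  have hFmap : ∀ z ∈ U', Ψ.1.map (F z) = σ (Ψ.1.base z) := fun z hz => hΨG _ hz.2
  have hrot : ∀ z ∈ U', ∃ k : ℤ, (F z).1 = rootOfUnityPow Ψ.1.mult k * z := by
    intro z hz
    have h1 := Ψ.1.proj_map (hGD _ hz.2)
    rw [hΨG _ hz.2, hsec z hz.1] at h1
    exact (Ψ.1.base_eq_iff (hUD hz.1) (mem_solidTorusCover.1 (hGD _ hz.2))).1 h1
  have hζs : ContDiffAt ℝ ∞ (fun z => (F z).1) z₀ :=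
    contDiff_fst.contDiffAt.comp z₀ (hFs.contDiffAt (hU'o.mem_nhds hz₀'))
  have hF₀ : (F z₀).1 = z₀ := by rw [hF]; simp [hGx]
  have hev : ∀ᶠ z in 𝓝 z₀, (F z).1 = z := by
    by_cases h0 : z₀ = 0
    · subst h0
      set g := rootOfUnityPow Ψ.1.mult 1 with hg
      have hgn : ‖g‖ = 1 := rootOfUnityPow_norm _ _
      set L := fderiv ℝ (fun z => (F z).1) 0 with hL
      have hLd : HasFDerivAt (fun z => (F z).1) L 0 :=
        (hζs.differentiableAt (by simp)).hasFDerivAt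
      -- the derivative of the base component is invariant under rotation, but injective
      have hginv : ∀ v, L (g * v) = L v := by
        have h1 : HasFDerivAt (fun z : ℂ => g * z) (g • ContinuousLinearMap.id ℝ ℂ) 0 :=
          (hasFDerivAt_id (0 : ℂ)).const_mul g
        have h2 : HasFDerivAt (fun z => (F (g * z)).1) (L.comp (g • ContinuousLinearMap.id ℝ ℂ)) 0 :=
          HasFDerivAt.comp (g := fun z => (F z).1) (f := fun z : ℂ => g * z) 0
            (by simpa using hLd) h1
        have h3 : (fun z => (F (g * z)).1) =ᶠ[𝓝 0] fun z => (F z).1 := by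
          filter_upwards [Metric.ball_mem_nhds (0 : ℂ) one_pos] with z hz
          have hgz : g * z ∈ Metric.ball (0 : ℂ) 1 := by simpa [hgn] using hz
          simp only [hF]
          rw [← (Ψ.1.base_eq_iff hz hgz).2 ⟨1, rfl⟩]
        intro v
        have h4 := (h2.congr_of_eventuallyEq h3.symm).unique hLd
        simpa using congrArg (fun A : ℂ →L[ℝ] ℂ => A v) h4
      have hinj : ∀ v, L v = 0 → v = 0 := by
        intro v hv
        by_contra hv0
        have h1 := (hasFDerivAt_iff_isLittleO_nhds_zero.1 hLd).def
          (by norm_num : (0 : ℝ) < 1 / 2)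
        have h2 : Tendsto (fun t : ℝ => (t : ℂ) * v) (𝓝[>] 0) (𝓝 0) := by
          have : Continuous fun t : ℝ => (t : ℂ) * v := by fun_prop
          simpa using (this.tendsto 0).mono_left nhdsWithin_le_nhds
        obtain ⟨t, ⟨h3, h4⟩, h5⟩ := ((h2.eventually (h1.and (hU'o.mem_nhds hz₀'))).and
          self_mem_nhdsWithin).exists
        have h5' : (0 : ℝ) < t := h5
        obtain ⟨k, hk⟩ := hrot _ h4
        have h6 : L ((t : ℂ) * v) = 0 := by
          rw [← Complex.real_smul, map_smul, hv, smul_zero]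
        rw [zero_add, hk, hF₀, h6, sub_zero, sub_zero, norm_mul, rootOfUnityPow_norm, one_mul] at h3
        have h7 : 0 < ‖(t : ℂ) * v‖ := norm_pos_iff.2 (mul_ne_zero (by exact_mod_cast h5'.ne') hv0)
        linarith
      have hg1 : g = 1 := by
        have h1 : L (g - 1) = 0 := by
          have := hginv 1
          rw [mul_one] at this
          rw [map_sub, this, sub_self]
        exact sub_eq_zero.1 (hinj _ h1)
      have hm := (rootOfUnityPow_eq_one_iff Ψ.1.mult_pos 1).1 hg1
      filter_upwards [hU'o.mem_nhds hz₀'] with z hz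
      obtain ⟨k, hk⟩ := hrot z hz
      rw [hk, (rootOfUnityPow_eq_one_iff Ψ.1.mult_pos k).2 (hm.trans (one_dvd k)), one_mul]
    · obtain ⟨δ, hδ, hδk⟩ := exists_pos_le_norm_rootOfUnityPow_sub_one Ψ.1.mult_pos
      have hn0 : 0 < ‖z₀‖ := norm_pos_iff.2 h0
      have h1 : Tendsto (fun z => ‖(F z).1 - z‖ - δ * ‖z‖) (𝓝 z₀) (𝓝 (-(δ * ‖z₀‖))) := by
        have : ContinuousAt (fun z => ‖(F z).1 - z‖ - δ * ‖z‖) z₀ :=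
          (hζs.continuousAt.sub continuousAt_id).norm.sub
            (continuousAt_const.mul continuous_norm.continuousAt)
        simpa [ContinuousAt, hF₀] using this
      filter_upwards [hU'o.mem_nhds hz₀',
        h1.eventually (gt_mem_nhds (by nlinarith : -(δ * ‖z₀‖) < 0))] with z hz hz2
      obtain ⟨k, hk⟩ := hrot z hz
      rcases hδk k with h | h
      · rw [hk, h, one_mul]
      · exfalso
        have h3 : (F z).1 - z = (rootOfUnityPow Ψ.1.mult k - 1) * z := by rw [hk]; ring
        rw [h3, norm_mul] at hz2
        have := mul_le_mul_of_nonneg_right h (norm_nonneg z)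
        linarith
  obtain ⟨W, hW, hWo, hz₀W⟩ := mem_nhds_iff.1 (hev.and (hU'o.mem_nhds hz₀'))
  refine ⟨W, fun z => (F z).2, ⟨hWo, fun z hz => hUD (hW hz).2.1,
    contDiff_snd.comp_contDiffOn (hFs.mono fun z hz => (hW hz).2), fun z hz => ?_⟩, hz₀W⟩
  rw [← hFmap z (hW hz).2]
  congr 1
  exact Prod.ext (hW hz).1 rfl

open Classical in
/-- The local connection form of the flat connection whose horizontal planes are tangent to the
section `σ`: the section is the graph of a function `f`, and `dθ - df` vanishes on it. -/
noncomputable def liftForm (σ : B → M) (Ψ : S.Chart) (z : ℂ) : ℂ →L[ℝ] ℝ :=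
  if h : ∃ q : Set ℂ × (ℂ → ℝ), IsLift σ Ψ q.1 q.2 ∧ z ∈ q.1 then -fderiv ℝ h.choose.2 z else 0

lemma IsLift.liftForm_eq {Ψ : S.Chart} {W : Set ℂ} {f : ℂ → ℝ} (h : IsLift σ Ψ W f) {z : ℂ}
    (hz : z ∈ W) : liftForm σ Ψ z = -fderiv ℝ f z := by
  have hex : ∃ q : Set ℂ × (ℂ → ℝ), IsLift σ Ψ q.1 q.2 ∧ z ∈ q.1 := ⟨(W, f), h, hz⟩
  rw [liftForm, dif_pos hex, hex.choose_spec.1.fderiv_eq h hex.choose_spec.2 hz]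

lemma IsLift.contDiffAt_liftForm {Ψ : S.Chart} {W : Set ℂ} {f : ℂ → ℝ} (h : IsLift σ Ψ W f) {z : ℂ}
    (hz : z ∈ W) : ContDiffAt ℝ ∞ (liftForm σ Ψ) z := by
  have h1 : ContDiffAt ℝ ∞ (fderiv ℝ f) z := (h.contDiffAt hz).fderiv_right (by simp)
  refine h1.neg.congr_of_eventuallyEq ?_
  filter_upwards [h.isOpen.mem_nhds hz] with y hy
  exact h.liftForm_eq hy

/-- The connection defined by a section is flat. -/
lemma IsLift.curl_liftForm {Ψ : S.Chart} {W : Set ℂ} {f : ℂ → ℝ} (h : IsLift σ Ψ W f) {z : ℂ}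
    (hz : z ∈ W) : curl (liftForm σ Ψ) z = 0 := by
  have h1 : ContDiffAt ℝ ∞ (fderiv ℝ f) z := (h.contDiffAt hz).fderiv_right (by simp)
  have hev : liftForm σ Ψ =ᶠ[𝓝 z] fun y => (-1 : ℝ) • fderiv ℝ f y := by
    filter_upwards [h.isOpen.mem_nhds hz] with y hy
    rw [h.liftForm_eq hy, neg_one_smul]
  rw [curl, extd_congr hev, extd_const_smul (h1.differentiableAt (by simp)),
    extd_fderiv (h.contDiffAt hz), mul_zero]

lemma IsLift.liftForm_eq_act {Φ Ψ : S.Chart} {W W' : Set ℂ} {τ : ℂ → ℂ} {h f : ℂ → ℝ} {ε : ℝ}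
    (hf : IsLift σ Ψ W' f) (T : IsTransition Φ.1 Ψ.1 W τ h ε) {z : ℂ} (hz : z ∈ W)
    (hz' : τ z ∈ W') : liftForm σ Φ z =
      (formAction 1).act ε (fderiv ℝ τ z) (fderiv ℝ h z) (liftForm σ Ψ (τ z)) := by
  have hd : HasFDerivAt (fun z => ε * (f (τ z) - h z))
      (ε • ((fderiv ℝ f (τ z)).comp (fderiv ℝ τ z) - fderiv ℝ h z)) z :=
    (((hf.hasFDerivAt hz').comp z (T.hasFDerivAt_base hz)).sub (T.hasFDerivAt_shift hz)).const_mul ε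
  rw [(hf.comp T).liftForm_eq ⟨hz, hz'⟩, hf.liftForm_eq hz', hd.fderiv]
  ext v
  simp [formAction]
  ring

variable [IsManifold (𝓡 3) ∞ M]

/-- A section which is smooth in the given charts is a graph locally in every chart of the maximal
atlas. -/
lemma exists_isLift_of_mem_charts {Z : Set B}
    (h : ∀ (Ψ : FiberedChart S.proj) (hΨ : Ψ ∈ S.charts), ∀ z ∈ Metric.ball (0 : ℂ) 1,
      Ψ.base z ∉ Z → ∃ W f, IsLift σ (S.ofMem hΨ) W f ∧ z ∈ W)
    (Φ : S.Chart) {z : ℂ} (hz : z ∈ Metric.ball (0 : ℂ) 1) (hzZ : Φ.1.base z ∉ Z) :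
    ∃ W f, IsLift σ Φ W f ∧ z ∈ W := by
  obtain ⟨Ψ, hΨ, z', hz', hb⟩ := S.exists_base_eq (Φ.1.base z)
  obtain ⟨W, τ, g, ε, T, hzW, rfl⟩ := S.exists_isTransition Φ (S.ofMem hΨ) hz hz' hb.symm
  obtain ⟨W', f, hf, hzW'⟩ := h Ψ hΨ (τ z) hz' (hb ▸ hzZ)
  exact ⟨_, _, hf.comp T, hzW, hzW'⟩

section Cutoff

variable {ι : Type*} {P : ι → S.Chart}

omit [IsManifold (𝓡 3) ∞ M] in
lemma base_ne_base_of_disjoint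
    (hdisj : ∀ j j', j ≠ j' →
      Disjoint ((P j).1.map '' solidTorusCover) ((P j').1.map '' solidTorusCover))
    {j j' : ι} (hj : j ≠ j') {z z' : ℂ} (hz : z ∈ Metric.ball (0 : ℂ) 1)
    (hz' : z' ∈ Metric.ball (0 : ℂ) 1) : (P j).1.base z ≠ (P j').1.base z' := by
  intro h
  obtain ⟨θ, hθ⟩ := (P j').1.exists_map_eq hz' h
  exact disjoint_left.1 (hdisj j j' hj) ⟨_, mk_mem_solidTorusCover hz, rfl⟩
    ⟨_, mk_mem_solidTorusCover hz', hθ⟩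

omit [IsManifold (𝓡 3) ∞ M] in
lemma base_ne_center_of_disjoint
    (hdisj : ∀ j j', j ≠ j' →
      Disjoint ((P j).1.map '' solidTorusCover) ((P j').1.map '' solidTorusCover))
    {j : ι} {z : ℂ} (hz : z ∈ Metric.ball (0 : ℂ) 1) (hz0 : z ≠ 0) (j' : ι) :
    (P j).1.base z ≠ (P j').1.base 0 := by
  by_cases hj : j = j'
  · subst hj
    intro h
    have := norm_eq_of_base_eq (P j) hz (by simp) h
    rw [norm_zero, eq_comm, norm_eq_zero] at this
    exact hz0 this
  · exact base_ne_base_of_disjoint hdisj hj hz (by simp)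

variable [T2Space B] [Finite ι]

/-- The flat connection of a section over the complement of finitely many points of the base, cut
off near these points. -/
lemma exists_connection_of_section
    (hdisj : ∀ j j', j ≠ j' →
      Disjoint ((P j).1.map '' solidTorusCover) ((P j').1.map '' solidTorusCover))
    (hlift : ∀ (Ψ : S.Chart), ∀ z ∈ Metric.ball (0 : ℂ) 1, (∀ j, Ψ.1.base z ≠ (P j).1.base 0) →
      ∃ W f, IsLift σ Ψ W f ∧ z ∈ W) :
    ∃ l : S.Chart → ℂ → ℂ →L[ℝ] ℝ, S.IsSection (formAction 1) univ l ∧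
      (∀ j, ∀ z ∈ Metric.ball (0 : ℂ) 1, l (P j) z = (1 - radialBump z) • liftForm σ (P j) z) ∧
      ∀ Ψ : S.Chart, ∀ z ∈ Metric.ball (0 : ℂ) 1,
        (∀ j, Ψ.1.base z ∉ (P j).1.base '' Metric.closedBall 0 (1 / 2)) →
        l Ψ z = liftForm σ Ψ z := by
  classical
  set K : ι → Set B := fun j => (P j).1.base '' Metric.closedBall 0 (1 / 2) with hK
  have hKc : IsClosed (⋃ j, K j) :=
    isClosed_iUnion_of_finite fun j => S.isClosed_image_base (P j) (by norm_num)
  have hcenter : ∀ j, (P j).1.base 0 ∈ K j := fun j => ⟨0, by simp, rfl⟩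
  -- the form is prescribed in the charts `P j`, where it is cut off, and in the charts disjoint from
  -- the discs of radius `1 / 2`
  set C : Set S.Chart :=
    range P ∪ {Ψ | ∀ z ∈ Metric.ball (0 : ℂ) 1, ∀ j, Ψ.1.base z ∉ K j} with hC
  set F : S.Chart → ℂ → ℂ →L[ℝ] ℝ := fun Ψ z =>
    if Ψ ∈ range P then (1 - radialBump z) • liftForm σ Ψ z else liftForm σ Ψ z with hF
  have hFP : ∀ j z, F (P j) z = (1 - radialBump z) • liftForm σ (P j) z := fun j z => by simp [hF]
  have hFC : ∀ Ψ : S.Chart, (∀ z ∈ Metric.ball (0 : ℂ) 1, ∀ j, Ψ.1.base z ∉ K j) →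
      F Ψ = liftForm σ Ψ := by
    intro Ψ hΨ
    ext1 z
    simp only [hF]
    rw [if_neg]
    rintro ⟨j, rfl⟩
    exact hΨ 0 (by simp) j (hcenter j)
  have hliftC : ∀ Ψ : S.Chart, ∀ z ∈ Metric.ball (0 : ℂ) 1, (∀ j, Ψ.1.base z ∉ K j) →
      ∃ W f, IsLift σ Ψ W f ∧ z ∈ W := fun Ψ z hz h =>
    hlift Ψ z hz fun j he => h j (he ▸ hcenter j)
  have hnormP : ∀ j, ∀ z ∈ Metric.ball (0 : ℂ) 1, (P j).1.base z ∉ K j → radialBump z = 0 := by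
    intro j z hz h
    refine radialBump_eq_zero (le_of_not_gt fun hlt => h ⟨z, ?_, rfl⟩)
    rw [mem_closedBall_zero_iff]
    exact hlt.le
  have hsec : S.IsSection (formAction 1) C F := by
    refine ⟨?_, ?_⟩
    · rintro Φ (⟨j, rfl⟩ | hΦ) z hz
      · refine ContDiffAt.contDiffWithinAt ?_
        by_cases h0 : z = 0
        · refine (contDiffAt_const (c := (0 : ℂ →L[ℝ] ℝ))).congr_of_eventuallyEq ?_
          filter_upwards [Metric.ball_mem_nhds z (by norm_num : (0 : ℝ) < 1 / 4)] with y hy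
          rw [h0, mem_ball_zero_iff] at hy
          simp [hFP, radialBump_eq_one hy.le]
        · obtain ⟨W, f, hf, hzW⟩ := hlift (P j) z hz (base_ne_center_of_disjoint hdisj hz h0)
          have : F (P j) = fun z => (1 - radialBump z) • liftForm σ (P j) z := by
            ext1 z
            rw [hFP]
          rw [this]
          exact (contDiff_const.sub contDiff_radialBump).contDiffAt.smul
            (hf.contDiffAt_liftForm hzW)
      · obtain ⟨W, f, hf, hzW⟩ := hliftC Φ z hz (hΦ z hz)
        rw [hFC Φ hΦ]
        exact (hf.contDiffAt_liftForm hzW).contDiffWithinAt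
    · rintro Φ (⟨j, rfl⟩ | hΦ) Ψ (⟨j', rfl⟩ | hΨ) W τ h ε T z hz
      · by_cases hj : j = j'
        · subst hj
          obtain ⟨rfl, hh, k, hk⟩ := T.self_eq hz
          have hτ : τ z = rootOfUnityPow (P j).1.mult k * z := hk.self_of_nhds
          have hbump : radialBump (τ z) = radialBump z := by
            rw [hτ, radialBump_rootOfUnityPow_mul]
          rw [hFP, hFP, hbump]
          by_cases h0 : z = 0
          · rw [hh, h0, radialBump_eq_one (by simp)]
            simp [formAction]
          · have hτ0 : τ z ≠ 0 := by
              rw [hτ]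
              exact mul_ne_zero (rootOfUnityPow_ne_zero _ _) h0
            obtain ⟨W', f, hf, hzW'⟩ := hlift (P j) (τ z) (T.mapsTo hz)
              (base_ne_center_of_disjoint hdisj (T.mapsTo hz) hτ0)
            rw [hf.liftForm_eq_act T hz hzW', hh]
            ext v
            simp [formAction]
        · exact absurd (T.base_eq hz)
            (base_ne_base_of_disjoint hdisj hj (T.subset hz) (T.mapsTo hz))
      · obtain ⟨W', f, hf, hzW'⟩ := hliftC Ψ (τ z) (T.mapsTo hz) (hΨ _ (T.mapsTo hz))
        have hb : radialBump z = 0 := hnormP j z (T.subset hz)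
          (T.base_eq hz ▸ hΨ _ (T.mapsTo hz) j)
        rw [hFP, hb, sub_zero, one_smul, hFC Ψ hΨ, hf.liftForm_eq_act T hz hzW']
      · have hb : radialBump (τ z) = 0 := hnormP j' _ (T.mapsTo hz)
          ((T.base_eq hz).symm ▸ hΦ _ (T.subset hz) j')
        have hc : ∀ i, (P j').1.base (τ z) ≠ (P i).1.base 0 := by
          intro i he
          rw [← T.base_eq hz] at he
          exact hΦ z (T.subset hz) i (he ▸ hcenter i)
        obtain ⟨W', f, hf, hzW'⟩ := hlift (P j') (τ z) (T.mapsTo hz) hc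
        rw [hFP, hb, sub_zero, one_smul, hFC Φ hΦ, hf.liftForm_eq_act T hz hzW']
      · obtain ⟨W', f, hf, hzW'⟩ := hliftC Ψ (τ z) (T.mapsTo hz) (hΨ _ (T.mapsTo hz))
        rw [hFC Φ hΦ, hFC Ψ hΨ, hf.liftForm_eq_act T hz hzW']
  have hcov : ∀ b : B, (∀ j, b ∉ K j) → ∃ Φ : S.Chart, Φ.1.base 0 = b ∧
      ∀ z ∈ Metric.ball (0 : ℂ) 1, ∀ j, Φ.1.base z ∉ K j := by
    intro b hb
    obtain ⟨Φ, h1, h2⟩ := S.exists_chart_base_zero hKc.isOpen_compl (b := b) (by simpa using hb)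
    exact ⟨Φ, h1, fun z hz => by simpa using h2 z hz⟩
  obtain ⟨l, hl, hlC⟩ := hsec.exists_extension (by
    intro b
    by_cases hb : ∃ j, b ∈ K j
    · obtain ⟨j, z, hz, rfl⟩ := hb
      exact ⟨P j, Or.inl ⟨j, rfl⟩, z, Metric.closedBall_subset_ball (by norm_num) hz, rfl⟩
    · obtain ⟨Φ, h1, h2⟩ := hcov b (by simpa using hb)
      exact ⟨Φ, Or.inr h2, 0, by simp, h1⟩)
  refine ⟨l, hl, fun j z hz => by rw [hlC _ (Or.inl ⟨j, rfl⟩) z hz, hFP], ?_⟩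
  intro Ψ z hz hzK
  obtain ⟨Φ, h1, h2⟩ := hcov _ hzK
  obtain ⟨W, τ, h, ε, T, hzW, hτz⟩ := S.exists_isTransition Ψ Φ hz (by simp) h1.symm
  have h0D : τ z ∈ Metric.ball (0 : ℂ) 1 := T.mapsTo hzW
  obtain ⟨W', f, hf, hzW'⟩ := hliftC Φ (τ z) h0D (h2 _ h0D)
  rw [hl.eq_act _ trivial _ trivial _ _ _ _ T z hzW, hlC Φ (Or.inr h2) _ h0D, hFC Φ h2,
    hf.liftForm_eq_act T hzW hzW']

end Cutoff

end SeifertFibration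

namespace SeifertFibration

open FiberedChart

/-! ### The total curvature of a connection -/

variable {M B : Type*} [TopologicalSpace M] [ChartedSpace E3 M] [TopologicalSpace B]
  {S : SeifertFibration M B} {σ : B → M}

/-- The period of the flat connection of a section around the center of a chart is minus the change
of the fiber coordinate along the section. -/
lemma integral_liftForm_circle {Φ : S.Chart} {r c : ℝ} (hr : r ∈ Ioo (0 : ℝ) 1)
    (hlift : ∀ z ∈ Metric.ball (0 : ℂ) 1, z ≠ 0 → ∃ W f, IsLift σ Φ W f ∧ z ∈ W)
    {f : ℝ → ℝ} (hf : Continuous f)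
    (hfσ : ∀ φ : ℝ, σ (Φ.1.base (r * Complex.exp (φ * Complex.I))) =
      Φ.1.map (r * Complex.exp (φ * Complex.I), f φ))
    (hfper : ∀ φ, f (φ + 2 * Real.pi) = f φ - c) :
    ∫ φ in (-Real.pi)..Real.pi, liftForm σ Φ (r * Complex.exp (φ * Complex.I))
      (Complex.I * (r * Complex.exp (φ * Complex.I))) = c := by
  set ζ : ℝ → ℂ := fun φ => r * Complex.exp (φ * Complex.I) with hζ
  have hζc : Continuous ζ := by fun_prop
  have hζn : ∀ φ, ‖ζ φ‖ = r := fun φ => by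
    rw [hζ]
    simp [Complex.norm_exp_ofReal_mul_I, abs_of_pos hr.1]
  have hζD : ∀ φ, ζ φ ∈ Metric.ball (0 : ℂ) 1 := fun φ => by
    rw [mem_ball_zero_iff, hζn]
    exact hr.2
  have hζ0 : ∀ φ, ζ φ ≠ 0 := fun φ => by
    rw [← norm_pos_iff, hζn]
    exact hr.1
  have hζd : ∀ φ, HasDerivAt ζ (Complex.I * ζ φ) φ := by
    intro φ
    have h1 : HasDerivAt (fun φ : ℝ => (φ : ℂ) * Complex.I) (1 * Complex.I) φ :=
      Complex.ofRealCLM.hasDerivAt.mul_const Complex.I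
    refine (h1.cexp.const_mul (r : ℂ)).congr_deriv ?_
    simp only [hζ]
    ring
  have hc : 0 < 2 * Real.pi / Φ.1.mult := by
    have := Φ.1.mult_cast_pos
    positivity
  -- along the circle, `f` differs from the local lifts of the section by locally constant functions
  have hd : ∀ φ, HasDerivAt f (-(liftForm σ Φ (ζ φ) (Complex.I * ζ φ))) φ := by
    intro φ
    obtain ⟨W, g, hg, hW⟩ := hlift (ζ φ) (hζD φ) (hζ0 φ)
    have h1 : HasDerivAt (fun ψ => g (ζ ψ)) (fderiv ℝ g (ζ φ) (Complex.I * ζ φ)) φ :=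
      (hg.hasFDerivAt hW).comp_hasDerivAt φ (hζd φ)
    have key : ∀ ψ, ζ ψ ∈ W → ∃ m : ℤ, f ψ = g (ζ ψ) + 2 * Real.pi / Φ.1.mult * m := fun ψ hψ =>
      Φ.1.exists_int_of_map_eq (hζD ψ) (hζD ψ) ((hg.map_eq _ hψ).symm.trans (hfσ ψ))
    have h2 : ∀ᶠ ψ in 𝓝 φ, f ψ - g (ζ ψ) = f φ - g (ζ φ) := by
      refine eventually_eq_of_sub_mem_lattice (f := fun ψ => f ψ - g (ζ ψ))
        (hf.continuousAt.sub h1.continuousAt) hc ?_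
      filter_upwards [hζc.continuousAt (hg.isOpen.mem_nhds hW)] with ψ hψ
      obtain ⟨m, hm⟩ := key ψ hψ
      obtain ⟨n, hn⟩ := key φ hW
      refine ⟨m - n, ?_⟩
      rw [hm, hn]
      push_cast
      ring
    have h3 : f =ᶠ[𝓝 φ] fun ψ => g (ζ ψ) + (f φ - g (ζ φ)) := by
      filter_upwards [h2] with ψ hψ
      linarith
    refine ((h1.add_const _).congr_of_eventuallyEq h3).congr_deriv ?_
    rw [hg.liftForm_eq hW]
    simp
  have hcont : Continuous fun φ => liftForm σ Φ (ζ φ) (Complex.I * ζ φ) := by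
    rw [continuous_iff_continuousAt]
    intro φ
    obtain ⟨W, g, hg, hW⟩ := hlift (ζ φ) (hζD φ) (hζ0 φ)
    have h1 : ContinuousAt (fun φ => liftForm σ Φ (ζ φ)) φ :=
      ContinuousAt.comp (f := ζ) (hg.contDiffAt_liftForm hW).continuousAt hζc.continuousAt
    exact h1.clm_apply (continuous_const.mul hζc).continuousAt
  have h1 := intervalIntegral.integral_eq_sub_of_hasDerivAt (a := -Real.pi) (b := Real.pi)
    (fun φ _ => hd φ) (hcont.neg.intervalIntegrable _ _)
  rw [intervalIntegral.integral_neg] at h1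
  have h2 := hfper (-Real.pi)
  rw [show -Real.pi + 2 * Real.pi = Real.pi by ring] at h2
  rw [h2] at h1
  linarith

variable [IsManifold (𝓡 3) ∞ M] [T2Space B] [CompactSpace M] [MeasurableSpace M] [BorelSpace M]
  {ρ : S.Chart → ℂ → ℝ} {ν : Measure M} [IsFiniteMeasure ν]

/-- The total curvature of the cut-off flat connection of a section is given by the periods of the
section around the fibers where it is not defined. -/
lemma IsFiberMeasure.integral_curvature {ι : Type*} [Fintype ι] {P : ι → S.Chart} {s : ι → ℝ}
    (hν : S.IsFiberMeasure ρ ν) (hpos : ∀ Φ, ∀ z ∈ Metric.ball (0 : ℂ) 1, 0 < ρ Φ z)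
    (hdisj : ∀ j j', j ≠ j' →
      Disjoint ((P j).1.map '' solidTorusCover) ((P j').1.map '' solidTorusCover))
    (hlift : ∀ (Ψ : S.Chart), ∀ z ∈ Metric.ball (0 : ℂ) 1, (∀ j, Ψ.1.base z ≠ (P j).1.base 0) →
      ∃ W f, IsLift σ Ψ W f ∧ z ∈ W)
    (hσ : ∀ j, ∀ r ∈ Ioo (0 : ℝ) 1, ∃ f : ℝ → ℝ, Continuous f ∧
      (∀ φ : ℝ, σ ((P j).1.base (r * Complex.exp (φ * Complex.I))) =
        (P j).1.map (r * Complex.exp (φ * Complex.I), f φ)) ∧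
      ∀ φ : ℝ, f (φ + 2 * Real.pi) = f φ - 2 * Real.pi * s j)
    {l : S.Chart → ℂ → ℂ →L[ℝ] ℝ}
    (hlP : ∀ j, ∀ z ∈ Metric.ball (0 : ℂ) 1,
      l (P j) z = (1 - radialBump z) • liftForm σ (P j) z)
    (hlK : ∀ Ψ : S.Chart, ∀ z ∈ Metric.ball (0 : ℂ) 1,
      (∀ j, Ψ.1.base z ∉ (P j).1.base '' Metric.closedBall 0 (1 / 2)) →
      l Ψ z = liftForm σ Ψ z)
    {κ : B → ℝ} (hκ : S.IsSmooth κ)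
    (hκl : ∀ Ψ : S.Chart, ∀ z ∈ Metric.ball (0 : ℂ) 1, κ (Ψ.1.base z) * ρ Ψ z = curl (l Ψ) z) :
    ∫ x, κ (S.proj x) ∂ν = ∑ j, 2 * Real.pi / (P j).1.mult * (2 * Real.pi * s j) := by
  classical
  set K : ι → Set B := fun j => (P j).1.base '' Metric.closedBall 0 (1 / 2) with hK
  have hKj : ∀ j, IsClosed (K j) := fun j => S.isClosed_image_base (P j) (by norm_num)
  have hKc : IsClosed (⋃ j, K j) := isClosed_iUnion_of_finite hKj
  have hhalf : Metric.closedBall (0 : ℂ) (1 / 2) ⊆ Metric.ball 0 1 :=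
    Metric.closedBall_subset_ball (by norm_num)
  have hKdisj : ∀ j j' b, j ≠ j' → b ∈ K j → b ∉ K j' := by
    rintro j j' _ hj ⟨z, hz, rfl⟩ ⟨z', hz', he⟩
    exact base_ne_base_of_disjoint hdisj hj (hhalf hz) (hhalf hz') he.symm
  have hliftP : ∀ j, ∀ z ∈ Metric.ball (0 : ℂ) 1, z ≠ 0 → ∃ W f, IsLift σ (P j) W f ∧ z ∈ W :=
    fun j z hz hz0 => hlift (P j) z hz (base_ne_center_of_disjoint hdisj hz hz0)
  -- the curvature is concentrated in the solid tori
  have hκ0 : ∀ b, (∀ j, b ∉ K j) → κ b = 0 := by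
    intro b hb
    obtain ⟨Ψ, rfl, hΨ⟩ := S.exists_chart_base_zero hKc.isOpen_compl (b := b) (by simpa using hb)
    have hΨ' : ∀ z ∈ Metric.ball (0 : ℂ) 1, ∀ j, Ψ.1.base z ∉ K j := fun z hz => by
      simpa using hΨ z hz
    obtain ⟨W, f, hf, hW⟩ := hlift Ψ 0 (by simp) fun j he =>
      hb j (he ▸ ⟨0, by simp, rfl⟩)
    have hev : l Ψ =ᶠ[𝓝 0] liftForm σ Ψ := by
      filter_upwards [Metric.ball_mem_nhds (0 : ℂ) one_pos] with z hz
      exact hlK Ψ z hz (hΨ' z hz)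
    have h1 := hκl Ψ 0 (by simp)
    rw [curl, extd_congr hev] at h1
    rw [← curl, hf.curl_liftForm hW] at h1
    exact (mul_eq_zero.1 h1).resolve_right (hpos Ψ 0 (by simp)).ne'
  -- as the `K j` are disjoint and `κ` vanishes outside of them, its restrictions are continuous
  set κ' : ι → B → ℝ := fun j => (K j).indicator κ with hκ'
  have hκc : Continuous κ := continuous_of_isSmooth hκ
  have hκ'c : ∀ j, Continuous (κ' j) := by
    intro j
    rw [continuous_iff_continuousAt]
    intro b
    have hKo : IsClosed (⋃ i : {i // i ≠ j}, K i) := isClosed_iUnion_of_finite fun i => hKj i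
    by_cases hb : b ∈ K j
    · have hb' : b ∈ (⋃ i : {i // i ≠ j}, K i)ᶜ := by
        simp only [mem_compl_iff, mem_iUnion, not_exists]
        exact fun i => hKdisj j i b i.2.symm hb
      refine hκc.continuousAt.congr ?_
      filter_upwards [hKo.isOpen_compl.mem_nhds hb'] with a ha
      by_cases haj : a ∈ K j
      · exact (indicator_of_mem haj κ).symm
      · refine Eq.trans (hκ0 a ?_) (indicator_of_notMem haj κ).symm
        intro i
        by_cases hij : i = j
        · exact hij ▸ haj
        · exact fun hai => ha (mem_iUnion.2 ⟨⟨i, hij⟩, hai⟩)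
    · refine (continuousAt_const (y := (0 : ℝ))).congr ?_
      filter_upwards [(hKj j).isOpen_compl.mem_nhds hb] with a ha
      exact (indicator_of_notMem ha κ).symm
  have hsum : ∀ b, κ b = ∑ j, κ' j b := by
    intro b
    by_cases hb : ∃ j, b ∈ K j
    · obtain ⟨j, hj⟩ := hb
      rw [Finset.sum_eq_single j]
      · exact (indicator_of_mem hj κ).symm
      · intro i _ hij
        exact indicator_of_notMem (hKdisj j i b hij.symm hj) κ
      · simp
    · have hb' : ∀ j, b ∉ K j := by simpa using hb
      rw [hκ0 b hb', eq_comm]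
      exact Finset.sum_eq_zero fun j _ => indicator_of_notMem (hb' j) κ
  simp only [hsum]
  have hint : ∀ j, Integrable (fun x => κ' j (S.proj x)) ν := fun j =>
    ((hκ'c j).comp S.continuous_proj).integrable_of_hasCompactSupport
      (HasCompactSupport.of_compactSpace _)
  rw [integral_finsetSum _ fun j _ => hint j]
  refine Finset.sum_congr rfl fun j _ => ?_
  rw [hν (P j) (κ' j) (hκ'c j) fun b hb => indicator_of_notMem (fun hb' =>
    hb (image_mono hhalf hb')) κ]
  congr 1
  have hUo : IsOpen (Metric.ball (0 : ℂ) 1 \ {0}) := Metric.isOpen_ball.sdiff isClosed_singleton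
  have hl1 : ContDiffOn ℝ ∞ (liftForm σ (P j)) (Metric.ball 0 1 \ {0}) := by
    intro z hz
    obtain ⟨W, f, hf, hW⟩ := hliftP j z hz.1 hz.2
    exact (hf.contDiffAt_liftForm hW).contDiffWithinAt
  have hl2 : ∀ z ∈ Metric.ball (0 : ℂ) 1 \ {0}, curl (liftForm σ (P j)) z = 0 := by
    intro z hz
    obtain ⟨W, f, hf, hW⟩ := hliftP j z hz.1 hz.2
    exact hf.curl_liftForm hW
  rw [← integral_curl_one_sub_radialBump_smul hl1 hl2 (c := 2 * Real.pi * s j) (by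
    intro r hr
    obtain ⟨f, h1, h2, h3⟩ := hσ j r hr
    exact integral_liftForm_circle hr (hliftP j) h1 h2 h3)]
  refine setIntegral_congr_fun measurableSet_ball fun z hz => ?_
  have h1 : κ' j ((P j).1.base z) = κ ((P j).1.base z) := by
    by_cases hz' : (P j).1.base z ∈ K j
    · exact indicator_of_mem hz' κ
    · refine (indicator_of_notMem hz' κ).trans (hκ0 _ ?_).symm
      intro i
      by_cases hij : i = j
      · exact hij ▸ hz'
      · rintro ⟨z', hz'', he⟩
        exact base_ne_base_of_disjoint hdisj hij (hhalf hz'') hz he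
  rw [h1, hκl _ _ hz]
  refine extd_congr ?_ _ _
  filter_upwards [Metric.isOpen_ball.mem_nhds hz] with y hy
  exact hlP j y hy

end SeifertFibration

/-! ### The form `γ ∧ dγ` -/

section WedgeExtd

variable {E F : Type*} [NormedAddCommGroup E] [NormedSpace ℝ E] [NormedAddCommGroup F]
  [NormedSpace ℝ F]

/-- The value of the `3`-form `γ ∧ dγ` at `x` on three vectors. -/
noncomputable def wedgeExtd (γ : E → E →L[ℝ] ℝ) (x u v w : E) : ℝ :=
  γ x u * extd γ x v w - γ x v * extd γ x u w + γ x w * extd γ x u v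

lemma wedgeExtd_congr {γ γ' : E → E →L[ℝ] ℝ} {x : E} (h : γ =ᶠ[𝓝 x] γ') (u v w : E) :
    wedgeExtd γ x u v w = wedgeExtd γ' x u v w := by
  simp only [wedgeExtd, h.self_of_nhds, extd_congr h]

lemma wedgeExtd_pullback {γ : F → F →L[ℝ] ℝ} {f : E → F} {x : E}
    (hγ : DifferentiableAt ℝ γ (f x)) (hf : ContDiffAt ℝ ∞ f x) (u v w : E) :
    wedgeExtd (fun y => (γ (f y)).comp (fderiv ℝ f y)) x u v w =
      wedgeExtd γ (f x) (fderiv ℝ f x u) (fderiv ℝ f x v) (fderiv ℝ f x w) := by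
  simp only [wedgeExtd, extd_pullback hγ hf, ContinuousLinearMap.comp_apply]

/-- `(f γ) ∧ d(f γ) = f² γ ∧ dγ`. -/
lemma wedgeExtd_smul {γ : E → E →L[ℝ] ℝ} {f : E → ℝ} {x : E} (h : DifferentiableAt ℝ γ x)
    (hf : DifferentiableAt ℝ f x) (u v w : E) :
    wedgeExtd (fun y => f y • γ y) x u v w = f x ^ 2 * wedgeExtd γ x u v w := by
  simp only [wedgeExtd, extd_smul h hf, _root_.smul_apply, smul_eq_mul]
  ring

end WedgeExtd

lemma contactVolume_eq_wedgeExtd (α : E3 → E3 →L[ℝ] ℝ) (y : E3) :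
    contactVolume α y = wedgeExtd α y (EuclideanSpace.single 0 1) (EuclideanSpace.single 1 1)
      (EuclideanSpace.single 2 1) := rfl

/-- Comparison of the model frame and the standard basis of `E3` on the top-degree form `α ∧ dα`. -/
lemma wedgeExtd_frame (α : E3 → E3 →L[ℝ] ℝ) (y : E3) (L : ℂ × ℝ →L[ℝ] E3) :
    wedgeExtd α y (L (modelFrame 0)) (L (modelFrame 1)) (L (modelFrame 2)) =
      frameDet L * contactVolume α y := by
  have hexp : ∀ v : E3, v = v 0 • EuclideanSpace.single 0 1 + v 1 • EuclideanSpace.single 1 1 +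
      v 2 • (EuclideanSpace.single 2 1 : E3) := by
    intro v
    ext i
    fin_cases i <;> simp
  rw [contactVolume_eq_wedgeExtd, frameDet, Matrix.det_fin_three]
  simp only [Matrix.of_apply]
  generalize L (modelFrame 0) = u
  generalize L (modelFrame 1) = v
  generalize L (modelFrame 2) = w
  conv_lhs => rw [hexp u, hexp v, hexp w]
  generalize (EuclideanSpace.single 0 1 : E3) = a
  generalize (EuclideanSpace.single 1 1 : E3) = b
  generalize (EuclideanSpace.single 2 1 : E3) = c
  simp only [wedgeExtd, extd, map_add, map_smul, _root_.add_apply, _root_.smul_apply, smul_eq_mul]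
  ring

/-- The invariant connection form `dθ + l` on `D² × ℝ`. -/
noncomputable def connectionForm (l : ℂ → ℂ →L[ℝ] ℝ) (w : ℂ × ℝ) : ℂ × ℝ →L[ℝ] ℝ :=
  ContinuousLinearMap.snd ℝ ℂ ℝ + (l w.1).comp (ContinuousLinearMap.fst ℝ ℂ ℝ)

lemma connectionForm_apply (l : ℂ → ℂ →L[ℝ] ℝ) (w v : ℂ × ℝ) :
    connectionForm l w v = v.2 + l w.1 v.1 := by
  simp [connectionForm]

lemma contDiffAt_connectionForm {l : ℂ → ℂ →L[ℝ] ℝ} {w : ℂ × ℝ} (hl : ContDiffAt ℝ ∞ l w.1) :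
    ContDiffAt ℝ ∞ (connectionForm l) w :=
  contDiffAt_const.add (ContDiffAt.clm_comp (hl.comp w contDiffAt_fst) contDiffAt_const)

/-- `(dθ + l) ∧ d(dθ + l) = dθ ∧ dl`, as `l ∧ dl` is a `3`-form on the disc. -/
lemma wedgeExtd_connectionForm {l : ℂ → ℂ →L[ℝ] ℝ} {w : ℂ × ℝ} (hl : DifferentiableAt ℝ l w.1) :
    wedgeExtd (connectionForm l) w (modelFrame 0) (modelFrame 1) (modelFrame 2) = curl l w.1 := by
  have hd : HasFDerivAt (connectionForm l)
      (((ContinuousLinearMap.compL ℝ (ℂ × ℝ) ℂ ℝ).flip (ContinuousLinearMap.fst ℝ ℂ ℝ)).comp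
        ((fderiv ℝ l w.1).comp (ContinuousLinearMap.fst ℝ ℂ ℝ))) w := by
    have h1 : HasFDerivAt (fun w : ℂ × ℝ => l w.1)
        ((fderiv ℝ l w.1).comp (ContinuousLinearMap.fst ℝ ℂ ℝ)) w :=
      hl.hasFDerivAt.comp w hasFDerivAt_fst
    exact (((ContinuousLinearMap.compL ℝ (ℂ × ℝ) ℂ ℝ).flip
      (ContinuousLinearMap.fst ℝ ℂ ℝ)).hasFDerivAt.comp w h1).const_add _
  simp only [wedgeExtd, extd, hd.fderiv, curl, connectionForm_apply]
  simp [modelFrame]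

/-- The kernel of a `1`-form which does not vanish on the fiber direction determines a connection
form. -/
lemma apply_eq_mul_connection {γ : ℂ × ℝ →L[ℝ] ℝ} (hγ : γ (0, 1) ≠ 0) (v : ℂ × ℝ) :
    γ v = γ (0, 1) * (v.2 + ((γ (0, 1))⁻¹ • γ.comp (ContinuousLinearMap.inl ℝ ℂ ℝ)) v.1) := by
  have h1 : v = (v.1, 0) + v.2 • ((0 : ℂ), (1 : ℝ)) := by ext <;> simp
  conv_lhs => rw [h1, map_add, map_smul]
  simp only [_root_.smul_apply, ContinuousLinearMap.comp_apply, ContinuousLinearMap.inl_apply,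
    smul_eq_mul]
  field_simp
  ring

/-! ### Contact structures and connections -/

namespace FiberedChart

variable {M B : Type*} [TopologicalSpace M] [ChartedSpace E3 M] {p : M → B}

/-- The derivative of a fibered chart. -/
noncomputable def tangentMap (Φ : FiberedChart p) (w : ℂ × ℝ) : ℂ × ℝ →L[ℝ] E3 :=
  mfderiv 𝓘(ℝ, ℂ × ℝ) (𝓡 3) Φ.map w

lemma mdifferentiableAt_map (Φ : FiberedChart p) {w : ℂ × ℝ} (hw : w ∈ solidTorusCover) :
    MDifferentiableAt 𝓘(ℝ, ℂ × ℝ) (𝓡 3) Φ.map w :=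
  (Φ.localDiffeo ⟨w, hw⟩).contMDiffAt.mdifferentiableAt (by simp)

lemma injective_tangentMap (Φ : FiberedChart p) {w : ℂ × ℝ} (hw : w ∈ solidTorusCover) :
    Function.Injective (Φ.tangentMap w) := by
  obtain ⟨O, G, hO, hwO, hG, -, -, hGev, -⟩ := Φ.exists_local_inverse hw
  have hGd : MDifferentiableAt (𝓡 3) 𝓘(ℝ, ℂ × ℝ) G (Φ.map w) :=
    (hG.contMDiffAt (hO.mem_nhds hwO)).mdifferentiableAt (by simp)
  have h1 := mfderiv_comp w hGd (Φ.mdifferentiableAt_map hw)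
  have h2 : (G ∘ Φ.map) =ᶠ[𝓝 w] id := hGev
  rw [h2.mfderiv_eq, mfderiv_id] at h1
  have h3 : ∀ v : ℂ × ℝ, mfderiv (𝓡 3) 𝓘(ℝ, ℂ × ℝ) G (Φ.map w) (Φ.tangentMap w v) = v := fun v =>
    (congrArg (fun L : ℂ × ℝ →L[ℝ] ℂ × ℝ => L v) h1).symm
  intro v v' hvv'
  rw [← h3 v, ← h3 v', hvv']

lemma mem_pullback_iff {Φ : FiberedChart p} {ξ : TangentField M} {w v : ℂ × ℝ} :
    v ∈ SeifertFibration.pullback Φ ξ w ↔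
      Φ.tangentMap w v ∈ (ξ (Φ.map w) : Submodule ℝ E3) := Iff.rfl

namespace IsTransition

variable {Φ Ψ : FiberedChart p} {W : Set ℂ} {τ : ℂ → ℂ} {h : ℂ → ℝ} {ε : ℝ}

lemma hasFDerivAt_map (T : IsTransition Φ Ψ W τ h ε) {z : ℂ} (hz : z ∈ W) (s : ℝ) :
    HasFDerivAt (fun v : ℂ × ℝ => (τ v.1, ε * v.2 + h v.1))
      (fiberedLinear (fderiv ℝ τ z) ε (fderiv ℝ h z)) (z, s) := by
  have d1 : HasFDerivAt τ (fderiv ℝ τ z) ((z, s) : ℂ × ℝ).1 := T.hasFDerivAt_base hz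
  have d2 : HasFDerivAt h (fderiv ℝ h z) ((z, s) : ℂ × ℝ).1 := T.hasFDerivAt_shift hz
  exact (d1.comp (z, s) hasFDerivAt_fst).prodMk
    ((hasFDerivAt_snd.const_mul ε).add (d2.comp (z, s) hasFDerivAt_fst))

lemma tangentMap_eq (T : IsTransition Φ Ψ W τ h ε) {z : ℂ} (hz : z ∈ W) (s : ℝ) (v : ℂ × ℝ) :
    Φ.tangentMap (z, s) v = Ψ.tangentMap (τ z, ε * s + h z)
      (fiberedLinear (fderiv ℝ τ z) ε (fderiv ℝ h z) v) := by
  have hev : Φ.map =ᶠ[𝓝 (z, s)] Ψ.map ∘ fun v : ℂ × ℝ => (τ v.1, ε * v.2 + h v.1) := by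
    have : ∀ᶠ v : ℂ × ℝ in 𝓝 (z, s), v.1 ∈ W := continuous_fst.continuousAt (T.mem_nhds hz)
    filter_upwards [this] with v hv
    exact T.map_eq v.1 hv v.2
  have hd := T.hasFDerivAt_map hz s
  have h1 := mfderiv_comp (z, s)
    (f := fun v : ℂ × ℝ => (τ v.1, ε * v.2 + h v.1)) (I := 𝓘(ℝ, ℂ × ℝ)) (I' := 𝓘(ℝ, ℂ × ℝ))
    (Ψ.mdifferentiableAt_map (w := (τ z, ε * s + h z)) (mk_mem_solidTorusCover (T.mapsTo hz)))
    hd.differentiableAt.mdifferentiableAt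
  rw [mfderiv_eq_fderiv, hd.fderiv] at h1
  have h2 := hev.mfderiv_eq (I := 𝓘(ℝ, ℂ × ℝ)) (I' := 𝓡 3)
  exact congrArg (fun L : ℂ × ℝ →L[ℝ] E3 => L v) (h2.trans h1)

lemma mem_pullback_iff (T : IsTransition Φ Ψ W τ h ε) (ξ : TangentField M) {z : ℂ} (hz : z ∈ W)
    (s : ℝ) (v : ℂ × ℝ) : v ∈ SeifertFibration.pullback Φ ξ (z, s) ↔
      fiberedLinear (fderiv ℝ τ z) ε (fderiv ℝ h z) v ∈
        SeifertFibration.pullback Ψ ξ (τ z, ε * s + h z) := by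
  rw [FiberedChart.mem_pullback_iff, FiberedChart.mem_pullback_iff, T.tangentMap_eq hz s v,
    T.map_eq z hz s]

end IsTransition

/-- Membership in the kernel of a connection form transforms by `formAction 1`. -/
lemma connectionForm_fiberedLinear {ε : ℝ} (hε : ε = 1 ∨ ε = -1) (A : ℂ →L[ℝ] ℂ) (l : ℂ →L[ℝ] ℝ)
    (m : ℂ →L[ℝ] ℝ) (v : ℂ × ℝ) :
    (fiberedLinear A ε l v).2 + m (fiberedLinear A ε l v).1 = 0 ↔
      v.2 + (formAction 1).act ε A l m v.1 = 0 := by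
  rw [fiberedLinear_apply]
  rcases hε with rfl | rfl
  · simp [formAction]
    constructor <;> intro h <;> linarith
  · simp [formAction]
    constructor <;> intro h <;> linarith

end FiberedChart

namespace SeifertFibration

open FiberedChart

variable {M B : Type*} [TopologicalSpace M] [ChartedSpace E3 M] [TopologicalSpace B]
  {S : SeifertFibration M B} [IsManifold (𝓡 3) ∞ M]

/-- The local `1`-form of a contact structure, pulled back to a fibered chart. -/
lemma exists_pullback_eq_ker {ξ : TangentField M} (hξ : IsPositiveContactStructure ξ)
    (Φ : FiberedChart S.proj) {w₀ : ℂ × ℝ} (hw₀ : w₀ ∈ solidTorusCover) :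
    ∃ (U : Set (ℂ × ℝ)) (γ : ℂ × ℝ → ℂ × ℝ →L[ℝ] ℝ), IsOpen U ∧ w₀ ∈ U ∧ U ⊆ solidTorusCover ∧
      ContDiffOn ℝ ∞ γ U ∧ (∀ w ∈ U, ∀ v, v ∈ pullback Φ ξ w ↔ γ w v = 0) ∧
      0 < wedgeExtd γ w₀ (modelFrame 0) (modelFrame 1) (modelFrame 2) := by
  obtain ⟨V, α, hV, hxV, hVt, hα, hcontact⟩ := hξ (Φ.map w₀)
  set e := chartAt E3 (Φ.map w₀) with he
  set g : ℂ × ℝ → E3 := e ∘ Φ.map with hg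
  set U : Set (ℂ × ℝ) := solidTorusCover ∩ Φ.map ⁻¹' (e.source ∩ e ⁻¹' V) with hU
  have hUo : IsOpen U := Φ.continuousOn_map.isOpen_inter_preimage isOpen_solidTorusCover
    (e.isOpen_inter_preimage hV)
  have hw₀U : w₀ ∈ U := ⟨hw₀, mem_chart_source _ _, hxV⟩
  have hgs : ∀ w ∈ U, ContDiffAt ℝ ∞ g w := fun w hw => Φ.contDiffAt_chart_comp hw.1 hw.2.1
  have hαat : ∀ w ∈ U, ContDiffAt ℝ ∞ α (g w) := fun w hw => hα.contDiffAt (hV.mem_nhds hw.2.2)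
  refine ⟨U, fun w => (α (g w)).comp (fderiv ℝ g w), hUo, hw₀U, fun w hw => hw.1, ?_, ?_, ?_⟩
  · intro w hw
    exact (((hαat w hw).comp w (hgs w hw)).clm_comp
      ((hgs w hw).fderiv_right (by simp))).contDiffWithinAt
  · intro w hw v
    have hsymm : e.symm (g w) = Φ.map w := e.left_inv hw.2.1
    have hev : Φ.map =ᶠ[𝓝 w] e.symm ∘ g := by
      filter_upwards [hUo.mem_nhds hw] with y hy
      exact (e.left_inv hy.2.1).symm
    have hed : MDifferentiableAt 𝓘(ℝ, E3) (𝓡 3) e.symm (g w) :=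
      mdifferentiableAt_atlas_symm (chart_mem_atlas E3 _) (hVt hw.2.2)
    have h1 := mfderiv_comp w (I := 𝓘(ℝ, ℂ × ℝ)) (I' := 𝓘(ℝ, E3)) hed
      ((hgs w hw).differentiableAt (by simp)).mdifferentiableAt
    rw [mfderiv_eq_fderiv] at h1
    have h2 := hev.mfderiv_eq (I := 𝓘(ℝ, ℂ × ℝ)) (I' := 𝓡 3)
    have h3 : Φ.tangentMap w v =
        mfderiv 𝓘(ℝ, E3) (𝓡 3) e.symm (g w) (fderiv ℝ g w v) :=
      congrArg (fun L : ℂ × ℝ →L[ℝ] E3 => L v) (h2.trans h1)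
    have h4 := (hcontact (g w) hw.2.2).2 (fderiv ℝ g w v)
    rw [ContinuousLinearMap.comp_apply, ← h4, FiberedChart.mem_pullback_iff, h3, ← hsymm]
    rfl
  · rw [wedgeExtd_pullback ((hαat w₀ hw₀U).differentiableAt (by simp)) (hgs w₀ hw₀U),
      wedgeExtd_frame]
    exact mul_pos (Φ.frameDet_pos hw₀) (hcontact (g w₀) hw₀U.2.2).1

/-- An invariant transverse positive contact structure is a connection of positive curvature. -/
lemma exists_connection_of_contact {ξ : TangentField M} (hξ : IsPositiveContactStructure ξ)
    (hinv : S.IsCircleInvariant ξ) (htrans : S.IsTransverse ξ) :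
    ∃ l : S.Chart → ℂ → ℂ →L[ℝ] ℝ, S.IsSection (formAction 1) univ l ∧
      ∀ Φ, ∀ z ∈ Metric.ball (0 : ℂ) 1, 0 < curl (l Φ) z := by
  have hex : ∀ Φ : S.Chart, ∀ z : ℂ, ∃ m : ℂ →L[ℝ] ℝ, Φ.1 ∈ S.charts →
      z ∈ Metric.ball (0 : ℂ) 1 → ∀ s v, v ∈ pullback Φ.1 ξ (z, s) ↔ v.2 + m v.1 = 0 := by
    intro Φ z
    by_cases h : Φ.1 ∈ S.charts ∧ z ∈ Metric.ball (0 : ℂ) 1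
    · have hw := mk_mem_solidTorusCover (s := 0) h.2
      obtain ⟨U, γ, -, hwU, -, -, hker, -⟩ := exists_pullback_eq_ker hξ Φ.1 hw
      have h0 : γ (z, 0) (0, 1) ≠ 0 := fun h0 =>
        htrans Φ.1 h.1 _ hw ((hker _ hwU _).2 h0)
      refine ⟨(γ (z, 0) (0, 1))⁻¹ • (γ (z, 0)).comp (ContinuousLinearMap.inl ℝ ℂ ℝ),
        fun _ _ s v => ?_⟩
      have h1 := hinv Φ.1 h.1 _ hw s
      rw [zero_add] at h1
      rw [h1, hker _ hwU, apply_eq_mul_connection h0, mul_eq_zero_iff_left h0]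
    · exact ⟨0, fun h1 h2 => absurd ⟨h1, h2⟩ h⟩
  choose l hl using hex
  set C : Set S.Chart := {Φ | Φ.1 ∈ S.charts} with hC
  -- the connection form is proportional to the local contact forms
  have hlocal : ∀ Φ ∈ C, ∀ z ∈ Metric.ball (0 : ℂ) 1, ContDiffAt ℝ ∞ (l Φ) z ∧
      0 < curl (l Φ) z := by
    intro Φ hΦ z hz
    have hw := mk_mem_solidTorusCover (s := 0) hz
    obtain ⟨U, γ, hU, hwU, hUs, hγ, hker, hvol⟩ := exists_pullback_eq_ker hξ Φ.1 hw
    have h0 : ∀ w ∈ U, γ w (0, 1) ≠ 0 := fun w hw' h0 =>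
      htrans Φ.1 hΦ w (hUs hw') ((hker w hw' _).2 h0)
    have hleq : ∀ w ∈ U, l Φ w.1 =
        (γ w (0, 1))⁻¹ • (γ w).comp (ContinuousLinearMap.inl ℝ ℂ ℝ) := by
      intro w hw'
      ext1 v
      set m := (γ w (0, 1))⁻¹ • (γ w).comp (ContinuousLinearMap.inl ℝ ℂ ℝ) with hm
      have h1 : ((v, -m v) : ℂ × ℝ) ∈ pullback Φ.1 ξ w := by
        rw [hker w hw', apply_eq_mul_connection (h0 w hw')]
        simp [← hm]
      have h2 := (hl Φ w.1 hΦ (mem_solidTorusCover.1 (hUs hw')) w.2 _).1 h1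
      simp only at h2
      linarith
    have hγat : ContDiffAt ℝ ∞ γ (z, 0) := hγ.contDiffAt (hU.mem_nhds hwU)
    have hγ1 : ContDiffAt ℝ ∞ (fun w => γ w (0, 1)) (z, 0) := hγat.clm_apply contDiffAt_const
    have hιc : ContDiff ℝ ∞ fun z : ℂ => ((z, 0) : ℂ × ℝ) := by fun_prop
    have hls : ContDiffAt ℝ ∞ (l Φ) z := by
      have h1 : ContDiffAt ℝ ∞ (fun w => (γ w (0, 1))⁻¹ •
          (γ w).comp (ContinuousLinearMap.inl ℝ ℂ ℝ)) (z, 0) :=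
        (hγ1.inv (h0 _ hwU)).smul (hγat.clm_comp contDiffAt_const)
      have h2 := ContDiffAt.comp (f := fun z : ℂ => ((z, 0) : ℂ × ℝ)) z h1 hιc.contDiffAt
      refine h2.congr_of_eventuallyEq ?_
      filter_upwards [hιc.continuous.continuousAt (hU.mem_nhds hwU)] with y hy
      exact hleq (y, 0) hy
    refine ⟨hls, ?_⟩
    have hev : γ =ᶠ[𝓝 (z, 0)] fun w => γ w (0, 1) • connectionForm (l Φ) w := by
      filter_upwards [hU.mem_nhds hwU] with w hw'
      refine ContinuousLinearMap.ext fun v => ?_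
      rw [_root_.smul_apply, connectionForm_apply, hleq w hw', smul_eq_mul]
      exact apply_eq_mul_connection (h0 w hw') v
    rw [wedgeExtd_congr hev, wedgeExtd_smul
      ((contDiffAt_connectionForm (w := (z, 0)) hls).differentiableAt (by simp))
      (hγ1.differentiableAt (by simp)),
      wedgeExtd_connectionForm (w := (z, 0)) (hls.differentiableAt (by simp))] at hvol
    exact pos_of_mul_pos_right hvol (sq_nonneg _)
  have hsec : S.IsSection (formAction 1) C l := by
    refine ⟨fun Φ hΦ z hz => (hlocal Φ hΦ z hz).1.contDiffWithinAt, ?_⟩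
    intro Φ hΦ Ψ hΨ W τ h ε T z hz
    ext1 v
    set m := (formAction 1).act ε (fderiv ℝ τ z) (fderiv ℝ h z) (l Ψ (τ z)) with hm
    have h1 : ((v, -m v) : ℂ × ℝ) ∈ pullback Φ.1 ξ (z, 0) := by
      rw [T.mem_pullback_iff ξ hz, hl Ψ _ hΨ (T.mapsTo hz),
        connectionForm_fiberedLinear T.sign]
      simp [← hm]
    have h2 := (hl Φ z hΦ (T.subset hz) 0 _).1 h1
    simp only at h2
    linarith
  obtain ⟨l', hl', hl'C⟩ := hsec.exists_extension (by
    intro b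
    obtain ⟨Φ, hΦ, z, hz, hb⟩ := S.exists_base_eq b
    exact ⟨S.ofMem hΦ, hΦ, z, hz, hb⟩)
  refine ⟨l', hl', fun Φ z hz => ?_⟩
  obtain ⟨Ψ, hΨ, z', hz', hb⟩ := S.exists_base_eq (Φ.1.base z)
  obtain ⟨W, τ, g, ε, T, hzW, rfl⟩ := S.exists_isTransition Φ (S.ofMem hΨ) hz hz' hb.symm
  rw [hl'.curl.eq_act _ trivial _ trivial _ _ _ _ T z hzW]
  refine mul_pos (T.det_pos z hzW) ?_
  have hev : l' (S.ofMem hΨ) =ᶠ[𝓝 (τ z)] l (S.ofMem hΨ) := by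
    filter_upwards [Metric.isOpen_ball.mem_nhds hz'] with y hy
    exact hl'C _ hΨ y hy
  rw [curl, extd_congr hev]
  exact (hlocal _ hΨ _ hz').2

/-- A connection of positive curvature is an invariant transverse positive contact structure. -/
lemma exists_contact_of_connection (hM : IsOrientedAtlas M) {l : S.Chart → ℂ → ℂ →L[ℝ] ℝ}
    (hl : S.IsSection (formAction 1) univ l)
    (hcurl : ∀ Φ, ∀ z ∈ Metric.ball (0 : ℂ) 1, 0 < curl (l Φ) z) :
    ∃ ξ : TangentField M,
      IsPositiveContactStructure ξ ∧ S.IsCircleInvariant ξ ∧ S.IsTransverse ξ := by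
  have hcov : ∀ x : M, ∃ (Φ : S.Chart) (w : ℂ × ℝ), w ∈ solidTorusCover ∧ Φ.1.map w = x := by
    intro x
    obtain ⟨Φ, hΦ, w, hw, hx⟩ := S.cover x
    exact ⟨S.ofMem hΦ, w, hw, hx⟩
  -- the planes are defined using one chosen preimage of each point, and `hpull` says that they are
  -- the kernels of the connection forms in all charts
  choose P q hq hPq using hcov
  obtain ⟨ξ, hξ⟩ : ∃ ξ : TangentField M, ∀ (x : M) (u : E3), u ∈ (ξ x : Submodule ℝ E3) ↔
      ∃ v, connectionForm (l (P x)) (q x) v = 0 ∧ (P x).1.tangentMap (q x) v = u :=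
    ⟨fun x => ((LinearMap.ker (connectionForm (l (P x)) (q x) : ℂ × ℝ →ₗ[ℝ] ℝ)).map
      ((P x).1.tangentMap (q x) : ℂ × ℝ →ₗ[ℝ] E3) : Submodule ℝ E3), fun x u => Iff.rfl⟩
  have hpull : ∀ (Ψ : S.Chart), ∀ w ∈ solidTorusCover, ∀ v,
      v ∈ pullback Ψ.1 ξ w ↔ v.2 + l Ψ w.1 v.1 = 0 := by
    rintro Ψ ⟨z, s⟩ hw v
    obtain ⟨W, τ, h, ε, T, hzW, h1, h2⟩ :=
      (S.compatible_chart Ψ (P (Ψ.1.map (z, s)))).exists_isTransition hw (hq _) (hPq _).symm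
    simp only at hzW h1 h2
    rw [hl.eq_act Ψ trivial _ trivial _ _ _ _ T z hzW, ← connectionForm_fiberedLinear T.sign,
      FiberedChart.mem_pullback_iff, T.tangentMap_eq hzW s v, hξ, h1, h2]
    set A := fiberedLinear (fderiv ℝ τ z) ε (fderiv ℝ h z) v with hA
    constructor
    · rintro ⟨u, hu, hu'⟩
      rwa [(P (Ψ.1.map (z, s))).1.injective_tangentMap (hq _) hu', connectionForm_apply] at hu
    · intro h3
      exact ⟨A, by rwa [connectionForm_apply], rfl⟩
  refine ⟨ξ, ?_, ?_, ?_⟩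
  · intro x
    obtain ⟨Φ, w₀, hw₀, rfl⟩ : ∃ (Φ : S.Chart) (w : ℂ × ℝ), w ∈ solidTorusCover ∧ Φ.1.map w = x :=
      ⟨P x, q x, hq x, hPq x⟩
    obtain ⟨O, G, hO, hwO, hG, hΦG, hGD, hGev, hGw⟩ := Φ.1.exists_local_inverse hw₀
    set e := chartAt E3 (Φ.1.map w₀) with he
    set k : E3 → ℂ × ℝ := G ∘ e.symm with hk
    obtain ⟨Ω, hΩ, hΩo, hwΩ⟩ := mem_nhds_iff.1 hGev
    set V₀ : Set E3 := e.target ∩ e.symm ⁻¹' O with hV₀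
    have hV₀o : IsOpen V₀ := e.isOpen_inter_preimage_symm hO
    have hks : ContDiffOn ℝ ∞ k V₀ := by
      rw [← contMDiffOn_iff_contDiffOn]
      exact hG.comp ((contMDiffOn_chart_symm (I := 𝓡 3) (x := Φ.1.map w₀)).mono inter_subset_left)
        fun y hy => hy.2
    set V : Set E3 := V₀ ∩ k ⁻¹' Ω with hV
    have hVo : IsOpen V := hks.continuousOn.isOpen_inter_preimage hV₀o hΩo
    have hkat : ∀ y ∈ V, ContDiffAt ℝ ∞ k y := fun y hy => hks.contDiffAt (hV₀o.mem_nhds hy.1)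
    have hkD : ∀ y ∈ V, k y ∈ solidTorusCover := fun y hy => hGD _ hy.1.2
    have hΦk : ∀ y ∈ V, Φ.1.map (k y) = e.symm y := fun y hy => hΦG _ hy.1.2
    have hlat : ∀ w ∈ solidTorusCover, ContDiffAt ℝ ∞ (l Φ) w.1 := fun w hw =>
      (hl.contDiffOn Φ trivial).contDiffAt (Metric.isOpen_ball.mem_nhds (mem_solidTorusCover.1 hw))
    have hβat : ∀ w ∈ solidTorusCover, ContDiffAt ℝ ∞ (connectionForm (l Φ)) w := fun w hw =>
      contDiffAt_connectionForm (hlat w hw)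
    set α : E3 → E3 →L[ℝ] ℝ := fun y => (connectionForm (l Φ) (k y)).comp (fderiv ℝ k y) with hα
    have hαat : ∀ y ∈ V, ContDiffAt ℝ ∞ α y := fun y hy =>
      ((hβat _ (hkD y hy)).comp y (hkat y hy)).clm_comp ((hkat y hy).fderiv_right (by simp))
    refine ⟨V, α, hVo, ?_, fun y hy => hy.1.1, fun y hy => (hαat y hy).contDiffWithinAt, ?_⟩
    · have hsymm : e.symm (e (Φ.1.map w₀)) = Φ.1.map w₀ := e.left_inv (mem_chart_source _ _)
      refine ⟨⟨e.map_source (mem_chart_source _ _), ?_⟩, ?_⟩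
      · rw [mem_preimage, hsymm]
        exact hwO
      · rw [mem_preimage, hk, Function.comp_apply, hsymm, hGw]
        exact hwΩ
    · intro y hy
      have hysrc : Φ.1.map (k y) ∈ e.source := by
        rw [hΦk y hy]
        exact e.map_target hy.1.1
      have hey : e (Φ.1.map (k y)) = y := by rw [hΦk y hy, e.right_inv hy.1.1]
      refine ⟨?_, ?_⟩
      · -- pulling `α` back by the chart gives the connection form again
        set g : ℂ × ℝ → E3 := e ∘ Φ.1.map with hg
        have hgy : g (k y) = y := hey
        have hgs : ContDiffAt ℝ ∞ g (k y) := Φ.1.contDiffAt_chart_comp (hkD y hy) hysrc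
        have hnear : ∀ᶠ w in 𝓝 (k y), w ∈ Ω ∧ w ∈ solidTorusCover ∧ Φ.1.map w ∈ e.source ∧
            g w ∈ V := by
          have h1 : ∀ᶠ w in 𝓝 (k y), Φ.1.map w ∈ e.source :=
            (Φ.1.continuousAt_map (hkD y hy)) (e.open_source.mem_nhds hysrc)
          have h2 : ∀ᶠ w in 𝓝 (k y), g w ∈ V :=
            hgs.continuousAt (hVo.mem_nhds (by rwa [hgy]))
          filter_upwards [hΩo.mem_nhds hy.2, isOpen_solidTorusCover.mem_nhds (hkD y hy), h1, h2]
            with w a b c d using ⟨a, b, c, d⟩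
        have hev : (fun w => (α (g w)).comp (fderiv ℝ g w)) =ᶠ[𝓝 (k y)]
            connectionForm (l Φ) := by
          filter_upwards [hnear, hnear.eventually_nhds] with w ⟨hwΩ', hwD, hws, hwV⟩ hw2
          have hkg : k ∘ g =ᶠ[𝓝 w] id := by
            filter_upwards [hw2] with w' ⟨a, _, c, _⟩
            have h1 : G (Φ.1.map w') = w' := hΩ a
            simp only [hk, hg, Function.comp_apply, id]
            rw [e.left_inv c, h1]
          have h1 : HasFDerivAt (k ∘ g) ((fderiv ℝ k (g w)).comp (fderiv ℝ g w)) w :=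
            ((hkat _ hwV).differentiableAt (by simp)).hasFDerivAt.comp w
              ((Φ.1.contDiffAt_chart_comp hwD hws).differentiableAt (by simp)).hasFDerivAt
          have h2 := (h1.congr_of_eventuallyEq hkg.symm).unique (hasFDerivAt_id w)
          have h3 : k (g w) = w := hkg.self_of_nhds
          simp only [hα]
          rw [ContinuousLinearMap.comp_assoc, h2, h3, ContinuousLinearMap.comp_id]
        have h1 := wedgeExtd_pullback (f := g) (x := k y) (γ := α)
          ((by rw [hgy]; exact hαat y hy : ContDiffAt ℝ ∞ α (g (k y))).differentiableAt (by simp))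
          hgs (modelFrame 0) (modelFrame 1) (modelFrame 2)
        rw [wedgeExtd_congr hev, wedgeExtd_connectionForm
          ((hlat _ (hkD y hy)).differentiableAt (by simp)), wedgeExtd_frame, hgy] at h1
        have h2 := hcurl Φ (k y).1 (mem_solidTorusCover.1 (hkD y hy))
        rw [h1] at h2
        refine pos_of_mul_pos_right h2 (le_of_lt ?_)
        -- the coordinate changes of `M` preserve the orientation
        set e' := chartAt E3 (Φ.1.map (k y)) with he'
        have hsrc : e' (Φ.1.map (k y)) ∈ (e'.symm.trans e).source := by
          rw [OpenPartialHomeomorph.trans_source, OpenPartialHomeomorph.symm_source]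
          refine ⟨e'.map_source (mem_chart_source _ _), ?_⟩
          rw [mem_preimage, e'.left_inv (mem_chart_source _ _)]
          exact hysrc
        have h3 := hM e' (chart_mem_atlas _ _) e (chart_mem_atlas _ _) _ hsrc
        have h4 := Φ.1.frameDet_pos (hkD y hy)
        have h5 : g =ᶠ[𝓝 (k y)] (e ∘ e'.symm) ∘ (e' ∘ Φ.1.map) := by
          have : ∀ᶠ w in 𝓝 (k y), Φ.1.map w ∈ e'.source :=
            (Φ.1.continuousAt_map (hkD y hy)) (e'.open_source.mem_nhds (mem_chart_source _ _))
          filter_upwards [this] with w hw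
          simp only [hg, Function.comp_apply]
          rw [e'.left_inv hw]
        have h6 : DifferentiableAt ℝ (e ∘ e'.symm) (e' (Φ.1.map (k y))) := by
          by_contra hnd
          rw [fderiv_zero_of_not_differentiableAt hnd] at h3
          rw [ContinuousLinearMap.det] at h3
          simp at h3
        rw [h5.fderiv_eq, fderiv_comp (g := e ∘ e'.symm) (f := e' ∘ Φ.1.map) (k y) h6
          ((Φ.1.contDiffAt_chart_comp (hkD y hy) (mem_chart_source _ _)).differentiableAt
            (by simp)), frameDet_comp_left]
        exact mul_pos h3 h4
      · intro v
        have hev : e.symm =ᶠ[𝓝 y] Φ.1.map ∘ k := by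
          filter_upwards [hVo.mem_nhds hy] with y' hy'
          exact (hΦk y' hy').symm
        have h1 := mfderiv_comp y (I := 𝓘(ℝ, E3)) (I' := 𝓘(ℝ, ℂ × ℝ))
          (Φ.1.mdifferentiableAt_map (hkD y hy))
          ((hkat y hy).differentiableAt (by simp)).mdifferentiableAt
        rw [mfderiv_eq_fderiv] at h1
        have h2 := hev.mfderiv_eq (I := 𝓘(ℝ, E3)) (I' := 𝓡 3)
        have h3 : (mfderiv 𝓘(ℝ, E3) (𝓡 3) e.symm y v : E3) =
            Φ.1.tangentMap (k y) (fderiv ℝ k y v) :=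
          congrArg (fun L : E3 →L[ℝ] E3 => L v) (h2.trans h1)
        have h4 := hpull Φ (k y) (hkD y hy) (fderiv ℝ k y v)
        rw [FiberedChart.mem_pullback_iff, hΦk y hy] at h4
        have h5 : α y v = (fderiv ℝ k y v).2 + l Φ (k y).1 (fderiv ℝ k y v).1 := by
          simp only [hα]
          rw [ContinuousLinearMap.comp_apply, connectionForm_apply]
        rw [h5, ← h4, ← h3]
        exact Iff.rfl
  · intro Φ hΦ w hw s
    ext v
    have h1 := hpull (S.ofMem hΦ) w hw v
    have h2 := hpull (S.ofMem hΦ) (w.1, w.2 + s)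
      (mk_mem_solidTorusCover (mem_solidTorusCover.1 hw)) v
    exact h2.trans h1.symm
  · intro Φ hΦ w hw h
    have h1 := (hpull (S.ofMem hΦ) w hw _).1 h
    simp at h1

end SeifertFibration

namespace SeifertFibration

open FiberedChart

/-! ### Positivity of the curvature and the Euler number -/

variable {M B : Type*} [TopologicalSpace M] [ChartedSpace E3 M] [TopologicalSpace B]
  {S : SeifertFibration M B} [IsManifold (𝓡 3) ∞ M] [T2Space B] [CompactSpace M]
  [MeasurableSpace M] [BorelSpace M] {ρ : S.Chart → ℂ → ℝ} {ν : Measure M} [IsFiniteMeasure ν]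

omit [BorelSpace M] in
lemma IsFiberMeasure.measureReal_univ_pos [Nonempty M] (hν : S.IsFiberMeasure ρ ν)
    (hρ : S.IsSection densityAction univ ρ)
    (hpos : ∀ Φ, ∀ z ∈ Metric.ball (0 : ℂ) 1, 0 < ρ Φ z) : 0 < ν.real univ := by
  obtain ⟨x⟩ := ‹Nonempty M›
  obtain ⟨Φ, -, -⟩ := S.exists_chart_base_zero isOpen_univ (mem_univ (S.proj x))
  obtain ⟨u, hu, -, hur, hus⟩ := exists_bump Φ
  have h := hν.integral_pos_of_bump hρ hpos Φ hu hur hus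
  refine lt_of_le_of_ne measureReal_nonneg fun h0 => ?_
  rw [eq_comm, measureReal_eq_zero_iff, Measure.measure_univ_eq_zero] at h0
  simp [h0] at h

/-- The total curvature is the same for all connections. -/
lemma IsFiberMeasure.integral_curvature_eq (hν : S.IsFiberMeasure ρ ν)
    (hρ : S.IsSection densityAction univ ρ) (hpos : ∀ Φ, ∀ z ∈ Metric.ball (0 : ℂ) 1, 0 < ρ Φ z)
    {l l' : S.Chart → ℂ → ℂ →L[ℝ] ℝ} (hl : S.IsSection (formAction 1) univ l)
    (hl' : S.IsSection (formAction 1) univ l') {κ κ' : B → ℝ} (hκ : S.IsSmooth κ)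
    (hκ' : S.IsSmooth κ')
    (hκl : ∀ Ψ : S.Chart, ∀ z ∈ Metric.ball (0 : ℂ) 1, κ (Ψ.1.base z) * ρ Ψ z = curl (l Ψ) z)
    (hκl' : ∀ Ψ : S.Chart, ∀ z ∈ Metric.ball (0 : ℂ) 1, κ' (Ψ.1.base z) * ρ Ψ z = curl (l' Ψ) z) :
    ∫ x, κ (S.proj x) ∂ν = ∫ x, κ' (S.proj x) ∂ν := by
  have h1 : S.IsExact ρ fun b => κ b - κ' b := by
    have hs := hl.add_form (hl'.const_smul_form (-1))
    rw [mul_one, add_neg_cancel] at hs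
    refine ⟨_, hs, fun Φ z hz => ?_⟩
    have d := (hl.contDiffOn Φ trivial).differentiableAt_of_isOpen Metric.isOpen_ball hz
    have d' := (hl'.contDiffOn Φ trivial).differentiableAt_of_isOpen Metric.isOpen_ball hz
    rw [curl, extd_add d (d'.fun_const_smul _), extd_const_smul d', sub_mul, hκl Φ z hz,
      hκl' Φ z hz, curl, curl]
    ring
  have h2 := hν.integral_eq_zero hρ hpos h1
  rw [integral_sub hκ.integrable hκ'.integrable] at h2
  linarith

/-- There is a connection of positive curvature if and only if the total curvature is positive. -/
lemma IsFiberMeasure.exists_curl_pos_iff [ConnectedSpace M] (hν : S.IsFiberMeasure ρ ν)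
    (hρ : S.IsSection densityAction univ ρ) (hpos : ∀ Φ, ∀ z ∈ Metric.ball (0 : ℂ) 1, 0 < ρ Φ z)
    {l : S.Chart → ℂ → ℂ →L[ℝ] ℝ} (hl : S.IsSection (formAction 1) univ l)
    {κ : B → ℝ} (hκ : S.IsSmooth κ)
    (hκl : ∀ Ψ : S.Chart, ∀ z ∈ Metric.ball (0 : ℂ) 1, κ (Ψ.1.base z) * ρ Ψ z = curl (l Ψ) z) :
    (∃ l' : S.Chart → ℂ → ℂ →L[ℝ] ℝ, S.IsSection (formAction 1) univ l' ∧
      ∀ Φ, ∀ z ∈ Metric.ball (0 : ℂ) 1, 0 < curl (l' Φ) z) ↔ 0 < ∫ x, κ (S.proj x) ∂ν := by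
  have hvol := hν.measureReal_univ_pos hρ hpos
  constructor
  · rintro ⟨l', hl', hcurl⟩
    obtain ⟨κ', hκ', hκl'⟩ := hl'.curl.exists_ratio hρ hpos
    have hκpos : ∀ b, 0 < κ' b := by
      intro b
      obtain ⟨Φ, rfl, -⟩ := S.exists_chart_base_zero isOpen_univ (mem_univ b)
      have h1 := hcurl Φ 0 (by simp)
      rw [← hκl' Φ 0 (by simp)] at h1
      exact pos_of_mul_pos_left h1 (hpos Φ 0 (by simp)).le
    rw [hν.integral_curvature_eq hρ hpos hl hl' hκ hκ' hκl hκl',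
      integral_pos_iff_support_of_nonneg (fun x => (hκpos _).le) hκ'.integrable]
    have hsupp : Function.support (fun x => κ' (S.proj x)) = univ :=
      eq_univ_of_forall fun x => (hκpos _).ne'
    rw [hsupp]
    exact (ENNReal.toReal_pos_iff.1 hvol).1
  · intro hint
    set c := (∫ x, κ (S.proj x) ∂ν) / ν.real univ with hc
    have hcpos : 0 < c := div_pos hint hvol
    obtain ⟨η, hη, hcurl⟩ := hν.isExact hρ hpos ((isSmooth_const c).sub hκ) (by
      rw [integral_sub (integrable_const c) hκ.integrable, integral_const, smul_eq_mul, hc]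
      field_simp
      ring)
    have hs := hl.add_form hη
    rw [add_zero] at hs
    refine ⟨_, hs, fun Φ z hz => ?_⟩
    rw [curl, extd_add ((hl.contDiffOn Φ trivial).differentiableAt_of_isOpen Metric.isOpen_ball hz)
      ((hη.contDiffOn Φ trivial).differentiableAt_of_isOpen Metric.isOpen_ball hz)]
    change 0 < curl (l Φ) z + curl (η Φ) z
    rw [hcurl Φ z hz, ← hκl Φ z hz, ← add_mul, add_sub_cancel]
    exact mul_pos hcpos (hpos Φ z hz)

end SeifertFibration

lemma NormalizedSeifertInvariants.sum_slope_div_order (I : NormalizedSeifertInvariants) :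
    ∑ j, 2 * Real.pi / (I.order j : ℝ) * (2 * Real.pi * (I.slope j : ℝ)) =
      4 * Real.pi ^ 2 * (-(I.eulerNumber : ℝ)) := by
  rw [Fintype.sum_option]
  simp only [order, slope, eulerNumber]
  push_cast
  rw [neg_sub, sub_neg_eq_add, mul_add, Finset.mul_sum, add_comm]
  congr 1
  · exact Finset.sum_congr rfl fun i _ => by ring
  · ring

theorem proposition3p1 {M B : Type*} [TopologicalSpace M] [ChartedSpace E3 M]
    [IsManifold (𝓡 3) ∞ M] [T2Space M] [CompactSpace M] [ConnectedSpace M]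
    [TopologicalSpace B] [T2Space B] (hM : IsOrientedAtlas M)
    (S : SeifertFibration M B) (I : NormalizedSeifertInvariants)
    (hI : S.HasNormalizedInvariants I) :
    (∃ ξ : TangentField M,
      IsPositiveContactStructure ξ ∧ S.IsCircleInvariant ξ ∧ S.IsTransverse ξ) ↔
      I.eulerNumber < 0 := by
  obtain ⟨Φ, σ, hcomp, hmult, hdisj, hproj, hsm, hbd⟩ := hI
  let : MeasurableSpace M := borel M
  have : BorelSpace M := ⟨rfl⟩
  set P : Option (Fin I.r) → S.Chart := fun j => ⟨Φ j, hcomp j⟩ with hP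
  have hlift : ∀ (Ψ : S.Chart), ∀ z ∈ Metric.ball (0 : ℂ) 1,
      (∀ j, Ψ.1.base z ≠ (P j).1.base 0) → ∃ W f, SeifertFibration.IsLift σ Ψ W f ∧ z ∈ W := by
    intro Ψ z hz hzP
    refine SeifertFibration.exists_isLift_of_mem_charts
      (Z := range fun j => (P j).1.base 0) ?_ Ψ hz ?_
    · intro Χ hΧ y hy hyZ
      have hZ : IsClosed (range fun j => (P j).1.base 0) := (finite_range _).isClosed
      have hU := (S.continuousOn_base (S.ofMem hΧ)).isOpen_inter_preimage Metric.isOpen_ball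
        hZ.isOpen_compl
      have hUP : ∀ y ∈ Metric.ball (0 : ℂ) 1 ∩
          (S.ofMem hΧ).1.base ⁻¹' (range fun j => (P j).1.base 0)ᶜ,
          ∀ j, Χ.base y ≠ (P j).1.base 0 := fun y hy j he => hy.2 ⟨j, he.symm⟩
      exact SeifertFibration.exists_isLift_of_contMDiffOn hU inter_subset_left
        ((hsm Χ hΧ).mono fun y hy => ⟨hy.1, hUP y hy⟩) (fun y hy => hproj _ (hUP y hy)) ⟨hy, hyZ⟩
    · rintro ⟨j, hj⟩
      exact hzP j hj.symm
  -- the cut-off flat connection of the section has total curvature `-4 π² e`, and all others as well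
  obtain ⟨ρ, hρ, hpos⟩ := S.exists_density
  obtain ⟨ν, hfin, hν⟩ := SeifertFibration.exists_measure_integral hρ hpos
  obtain ⟨l, hl, hlP, hlK⟩ := SeifertFibration.exists_connection_of_section (P := P) hdisj hlift
  obtain ⟨κ, hκ, hκl⟩ := hl.curl.exists_ratio hρ hpos
  have htotal : ∫ x, κ (S.proj x) ∂ν = 4 * Real.pi ^ 2 * (-(I.eulerNumber : ℝ)) := by
    rw [SeifertFibration.IsFiberMeasure.integral_curvature (s := fun j => (I.slope j : ℝ))
      hν hpos hdisj hlift hbd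
      hlP hlK hκ hκl, ← I.sum_slope_div_order]
    exact Finset.sum_congr rfl fun j _ => by rw [← hmult j]
  have hiff : 0 < ∫ x, κ (S.proj x) ∂ν ↔ I.eulerNumber < 0 := by
    have hpi : 0 < 4 * Real.pi ^ 2 := by positivity
    rw [htotal, mul_pos_iff_of_pos_left hpi, neg_pos]
    exact_mod_cast Iff.rfl
  rw [← hiff, ← SeifertFibration.IsFiberMeasure.exists_curl_pos_iff hν hρ hpos hl hκ hκl]
  constructor
  · rintro ⟨ξ, hξ, hinv, htrans⟩
    exact SeifertFibration.exists_connection_of_contact hξ hinv htrans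
  · rintro ⟨l', hl', hcurl⟩
    exact SeifertFibration.exists_contact_of_connection hM hl' hcurl
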